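/- Let $n\ge 3$, let $B\subset \mathrm{GL}(n,\mathbb C)$ be the subgroup of upper-triangular matrices, let $\mathcal F=\mathrm{GL}(n,\mathbb C)/B$ be the variety of complete flags in $\mathbb C^n$, and let $F_0$ be the standard flag (the coset of the identity). For $w\in S_n$ let $\mathcal X_w$ be the Schubert variety of $w$, that is, the closure in $\mathcal F$ of the $B$-orbit of the flag $wF_0$, where $w$ acts on $\mathbb C^n$ by permuting the standard basis. In a neighbourhood of $F_0$ the flags are those spanned by the columns of the lower unitriangular matrices $(x_{ij})$, so that the numbers $x_{ij}$ ($i>j$) are local coordinates on $\mathcal F$ at $F_0$ and linear coordinates on the tangent space $T_{F_0}\mathcal F$. The tangent cone $\mathcal T_w\subset T_{F_0}\mathcal F$ of $\mathcal X_w$ at $F_0$ is the set of common zeros of the lowest-degree homogeneous parts of all polynomials in the $x_{ij}$ that vanish on $\mathcal X_w$ in this chart. Then the number of distinct sets among the tangent cones $\mathcal T_w$, where $w$ runs over the permutations in $S_n$ for which $\mathcal X_w$ has codimension $2$ in $\mathcal F$, is $$2+\frac{(n-3)(n+11)}{8}\quad\text{if } n \text{ is odd},\qquad 3+\frac{(n-4)(n+14)}{8}\quad\text{if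 } n\text{ is even}.$$ -/

import Mathlib

noncomputable section

namespace SchubertTangent

open Matrix

/-- The Borel subgroup `B` of upper-triangular matrices in `GL(n, ℂ)`. -/
def borel (n : ℕ) : Subgroup (GL (Fin n) ℂ) where
  carrier := {g | (g : Matrix (Fin n) (Fin n) ℂ).BlockTriangular id}
  one_mem' := blockTriangular_one
  mul_mem' := fun ha hb => BlockTriangular.mul ha hb
  inv_mem' := by
    intro g hg
    have : Invertible (g : Matrix (Fin n) (Fin n) ℂ) := g.invertible
    simpa using blockTriangular_inv_of_blockTriangular hg

/-- The variety of complete flags in `ℂⁿ`, as the homogeneous space `GL(n, ℂ) / B`, with the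
quotient of the classical topology. The coset `g B` is the flag whose `k`-th space is spanned by
the first `k` columns of `g`; the coset of `1` is the standard flag `F₀`. -/
abbrev FlagVariety (n : ℕ) : Type := GL (Fin n) ℂ ⧸ borel n

/-- The matrix of the linear map `ε_j ↦ ε_{w j}`. -/
def permMat {n : ℕ} (w : Equiv.Perm (Fin n)) : Matrix (Fin n) (Fin n) ℂ :=
  Matrix.of fun i j => if i = w j then 1 else 0

theorem permMat_eq {n : ℕ} (w : Equiv.Perm (Fin n)) : permMat w = (w⁻¹).permMatrix ℂ := by
  ext i j
  simp [permMat, PEquiv.toMatrix_apply, Equiv.symm_apply_eq]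

theorem det_permMat_ne_zero {n : ℕ} (w : Equiv.Perm (Fin n)) : (permMat w).det ≠ 0 := by
  rw [permMat_eq, det_permutation]
  exact_mod_cast (Equiv.Perm.sign w⁻¹).ne_zero

/-- The linear map `ε_j ↦ ε_{w j}` as an element of `GL(n, ℂ)`. -/
def permGL {n : ℕ} (w : Equiv.Perm (Fin n)) : GL (Fin n) ℂ :=
  GeneralLinearGroup.mkOfDetNeZero (permMat w) (det_permMat_ne_zero w)

/-- The Schubert cell of `w`: the `B`-orbit of the `w`-image of the standard flag. -/
def schubertCell {n : ℕ} (w : Equiv.Perm (Fin n)) : Set (FlagVariety n) :=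
  MulAction.orbit (borel n) (permGL w : FlagVariety n)

/-- The Schubert variety of `w`: the closure of the Schubert cell. -/
def schubertVariety {n : ℕ} (w : Equiv.Perm (Fin n)) : Set (FlagVariety n) :=
  closure (schubertCell w)

/-- The index set of the local coordinates `x_{ij}`, `i > j`. -/
abbrev Coord (n : ℕ) : Type := {p : Fin n × Fin n // p.2 < p.1}

/-- The lower unitriangular matrix with entries `x_{ij}` below the diagonal. -/
def unipotent {n : ℕ} (x : Coord n → ℂ) : Matrix (Fin n) (Fin n) ℂ :=
  Matrix.of fun i j => if h : j < i then x ⟨(i, j), h⟩ else if i = j then 1 else 0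

theorem det_unipotent {n : ℕ} (x : Coord n → ℂ) : (unipotent x).det = 1 := by
  rw [det_of_isLowerTriangular]
  · simp [unipotent]
  · intro i j hij
    have h : i < j := hij
    simp [unipotent, h.not_gt, h.ne]

/-- The local coordinate system of the flag variety around the standard flag: the flag spanned by
the columns of the unitriangular matrix of `x`. The point `0` goes to the standard flag, and
`Coord n → ℂ` is thereby also the tangent space of the flag variety at the standard flag. -/
def chart {n : ℕ} (x : Coord n → ℂ) : FlagVariety n :=
  (GeneralLinearGroup.mkOfDetNeZero (unipotent x) (by simp [det_unipotent]) : GL (Fin n) ℂ)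

/-- The ideal of the Schubert variety of `w` in the local coordinates around the standard flag. -/
def localIdeal {n : ℕ} (w : Equiv.Perm (Fin n)) : Ideal (MvPolynomial (Coord n) ℂ) :=
  MvPolynomial.vanishingIdeal ℂ (chart ⁻¹' schubertVariety w)

/-- The codimension of the Schubert variety of `w` in the flag variety. The Schubert variety is
irreducible and contains the standard flag, so this is the height of its ideal in the chart. -/
def codim {n : ℕ} (w : Equiv.Perm (Fin n)) : ℕ∞ := (localIdeal w).height

/-- The tangent cone at the origin of the affine variety with ideal `I`: the common zeros of the
lowest-degree homogeneous parts of all elements of `I`. -/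
def tangentConeOfIdeal {σ : Type*} (I : Ideal (MvPolynomial σ ℂ)) : Set (σ → ℂ) :=
  {v | ∀ f ∈ I, ∀ d : ℕ, (∀ e < d, MvPolynomial.homogeneousComponent e f = 0) →
    MvPolynomial.eval v (MvPolynomial.homogeneousComponent d f) = 0}

/-- The tangent cone at the standard flag of the Schubert variety of `w`. -/
def tangentCone {n : ℕ} (w : Equiv.Perm (Fin n)) : Set (Coord n → ℂ) :=
  tangentConeOfIdeal (localIdeal w)

end SchubertTangent

end

/-! ### Double cosets of the Borel subgroup and elementary closure relations -/

noncomputable section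

namespace SchubertTangent

open Matrix Topology Filter

/-! The codimension of the Schubert variety of `w` is the number of pairs that `w` leaves in order
(`codim_eq_card_ascents`). Hence codimension 2 means `w = w₀ s_i s_k` with `i ≠ k`, which is `tau n
i k`.

Let `D_c` be the locus where the lower-left `c × c` corner is singular, that is, `Meets c (n - c)`.
For nonadjacent `i` and `k` the variety is `D_i ∩ D_k` in the chart. For adjacent indices it is the
locus where an `(a + 1) × a` or an `a × (a + 1)` corner drops rank; reflection in the antidiagonal
exchanges the two kinds. These descriptions come from climbing the Bruhat order: a rank condition is
destroyed by so few ascents (`card_essential`) that another ascent can be removed until only two are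
left.

A corner with `r + c ≤ n` lies strictly below the diagonal, so its minors are homogeneous and bound
the tangent cone directly. A larger corner of size `c` is singular exactly when the corner of size
`n - c` of the inverse matrix is. Inversion has differential `-1` at the identity, so `w` and `w⁻¹`
have the same tangent cone, and all sizes can be folded to at most `n / 2`.

The remaining case is the mixed one, `i < n / 2 < k`. With `b = n - k` the tangent cone lies in `D_i
∩ D_b`. A point of this intersection at which a suitable cofactor is nonzero is a tangent direction,
because a vanishing correction of one coordinate repairs the condition on the inverse
(`mem_tangentCone_mixed`); irreducibility extends this to whole varieties. If `i` and `b` differ by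
at least 2, the mixed cone is therefore the unmixed one (`tangentCone_mixed`). New cones occur only
for `b = i` and for adjacent `i` and `b`.

The resulting list is `Canonical`. Its members are separated by the set of `c ≤ n / 2` for which
`D_c` contains the cone, except for the few cones that belong to a common pair of adjacent sizes.
These are separated by whether they contain the rank loci, together with reflection in the
antidiagonal (`Canonical.injective`). Counting the list gives the formula. -/

/-- The unipotent matrix with coordinates `x` as an invertible matrix. -/
def uGL {n : ℕ} (x : Coord n → ℂ) : GL (Fin n) ℂ :=
  GeneralLinearGroup.mkOfDetNeZero (unipotent x) (by simp [det_unipotent])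

@[simp] theorem coe_uGL {n : ℕ} (x : Coord n → ℂ) :
    (uGL x : Matrix (Fin n) (Fin n) ℂ) = unipotent x := rfl

@[simp] theorem coe_permGL {n : ℕ} (w : Equiv.Perm (Fin n)) :
    (permGL w : Matrix (Fin n) (Fin n) ℂ) = permMat w := rfl

theorem mem_borel {n : ℕ} {g : GL (Fin n) ℂ} :
    g ∈ borel n ↔ ∀ i j : Fin n, j < i → (g : Matrix (Fin n) (Fin n) ℂ) i j = 0 :=
  ⟨fun h _ _ hij => h hij, fun h _ _ hij => h _ _ hij⟩

theorem permMat_apply {n : ℕ} (w : Equiv.Perm (Fin n)) (i j : Fin n) :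
    permMat w i j = if i = w j then 1 else 0 := by
  simp only [permMat, of_apply]

theorem permMat_mul {n : ℕ} (v w : Equiv.Perm (Fin n)) :
    permMat (v * w) = permMat v * permMat w := by
  ext i j
  simp only [permMat_apply, Matrix.mul_apply, Equiv.Perm.mul_apply]
  rw [Finset.sum_eq_single (w j)]
  · simp only [if_true, mul_one]
    rfl
  · intro k _ hk
    simp [hk]
  · simp

theorem permMat_one {n : ℕ} : permMat (1 : Equiv.Perm (Fin n)) = 1 := by
  ext i j
  simp only [permMat_apply, Matrix.one_apply]
  rfl

theorem permGL_mul {n : ℕ} (v w : Equiv.Perm (Fin n)) :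
    permGL (v * w) = permGL v * permGL w :=
  Units.ext (permMat_mul v w)

theorem permGL_one {n : ℕ} : permGL (1 : Equiv.Perm (Fin n)) = 1 :=
  Units.ext permMat_one

theorem permGL_inv {n : ℕ} (w : Equiv.Perm (Fin n)) : permGL w⁻¹ = (permGL w)⁻¹ := by
  rw [eq_inv_iff_mul_eq_one, ← permGL_mul, inv_mul_cancel, permGL_one]

/-- The double coset `B w B`. -/
def cell {n : ℕ} (w : Equiv.Perm (Fin n)) : Set (GL (Fin n) ℂ) :=
  {g | ∃ b ∈ borel n, ∃ b' ∈ borel n, g = b * permGL w * b'}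

theorem permGL_mem_cell {n : ℕ} (w : Equiv.Perm (Fin n)) : permGL w ∈ cell w :=
  ⟨1, one_mem _, 1, one_mem _, by simp⟩

theorem mul_mem_cell {n : ℕ} {w : Equiv.Perm (Fin n)} {b g b' : GL (Fin n) ℂ}
    (hb : b ∈ borel n) (hg : g ∈ cell w) (hb' : b' ∈ borel n) : b * g * b' ∈ cell w := by
  obtain ⟨c, hc, c', hc', rfl⟩ := hg
  exact ⟨b * c, mul_mem hb hc, c' * b', mul_mem hc' hb', by group⟩

theorem mul_mem_closure_cell {n : ℕ} {w : Equiv.Perm (Fin n)} {b g b' : GL (Fin n) ℂ}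
    (hb : b ∈ borel n) (hg : g ∈ closure (cell w)) (hb' : b' ∈ borel n) :
    b * g * b' ∈ closure (cell w) :=
  map_mem_closure (f := fun g => b * g * b') (by fun_prop) hg
    (fun _ h => mul_mem_cell hb h hb')

theorem cell_subset_closure_iff {n : ℕ} {v w : Equiv.Perm (Fin n)} :
    cell v ⊆ closure (cell w) ↔ permGL v ∈ closure (cell w) := by
  refine ⟨fun h => h (permGL_mem_cell v), ?_⟩
  rintro h _ ⟨b, hb, b', hb', rfl⟩
  exact mul_mem_closure_cell hb h hb'

theorem mk_mem_schubertCell {n : ℕ} (w : Equiv.Perm (Fin n)) (g : GL (Fin n) ℂ) :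
    (g : FlagVariety n) ∈ schubertCell w ↔ g ∈ cell w := by
  constructor
  · rintro ⟨⟨b, hb⟩, h⟩
    have h' : ((b * permGL w : GL (Fin n) ℂ) : FlagVariety n) = g := h
    rw [QuotientGroup.eq] at h'
    exact ⟨b, hb, _, h', by group⟩
  · rintro ⟨b, hb, b', hb', rfl⟩
    refine ⟨⟨b, hb⟩, ?_⟩
    change ((b * permGL w : GL (Fin n) ℂ) : FlagVariety n) = _
    rw [QuotientGroup.eq]
    simpa [mul_assoc] using hb'

/-- The quotient map is open, so taking preimages commutes with closure and the whole question moves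
to `GL(n, ℂ)`. -/
theorem mk_mem_schubertVariety {n : ℕ} (w : Equiv.Perm (Fin n)) (g : GL (Fin n) ℂ) :
    (g : FlagVariety n) ∈ schubertVariety w ↔ g ∈ closure (cell w) := by
  have h := (QuotientGroup.isOpenMap_coe (N := borel n)).preimage_closure_eq_closure_preimage
    QuotientGroup.continuous_mk (schubertCell w)
  have h2 : ((↑) : GL (Fin n) ℂ → FlagVariety n) ⁻¹' schubertCell w = cell w :=
    Set.ext (mk_mem_schubertCell w)
  rw [h2] at h
  exact Set.ext_iff.mp h g

/-- The Schubert variety of `w` in the chart around the standard flag. -/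
def chartVariety {n : ℕ} (w : Equiv.Perm (Fin n)) : Set (Coord n → ℂ) :=
  {x | uGL x ∈ closure (cell w)}

theorem preimage_schubertVariety {n : ℕ} (w : Equiv.Perm (Fin n)) :
    chart ⁻¹' schubertVariety w = chartVariety w :=
  Set.ext fun x => mk_mem_schubertVariety w (uGL x)

theorem mem_localIdeal {n : ℕ} {w : Equiv.Perm (Fin n)} {p : MvPolynomial (Coord n) ℂ} :
    p ∈ localIdeal w ↔ ∀ x ∈ chartVariety w, MvPolynomial.eval x p = 0 := by
  rw [localIdeal, preimage_schubertVariety, MvPolynomial.mem_vanishingIdeal_iff]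
  rfl

/-- The transvection `1 + c E_{ij}` as an invertible matrix. -/
def elementary {n : ℕ} {i j : Fin n} (h : i ≠ j) (c : ℂ) : GL (Fin n) ℂ where
  val := transvection i j c
  inv := transvection i j (-c)
  val_inv := by rw [transvection_mul_transvection_same _ _ h]; simp
  inv_val := by rw [transvection_mul_transvection_same _ _ h]; simp

theorem continuous_elementary {n : ℕ} {i j : Fin n} (h : i ≠ j) :
    Continuous (elementary h) := by
  have h1 : Continuous fun c : ℂ => transvection i j c := by
    refine continuous_const.add (continuous_matrix fun a b => ?_)
    simp only [single_apply]
    split_ifs <;> fun_prop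
  exact Units.continuous_iff.mpr ⟨h1, h1.comp continuous_neg⟩

theorem elementary_zero {n : ℕ} {i j : Fin n} (h : i ≠ j) : elementary h 0 = 1 :=
  Units.ext (by simp [elementary])

theorem elementary_mem_borel {n : ℕ} {i j : Fin n} (h : i < j) (c : ℂ) :
    elementary h.ne c ∈ borel n := by
  rw [mem_borel]
  intro k l hkl
  have h1 : ¬(i = k ∧ j = l) := by rintro ⟨rfl, rfl⟩; exact lt_asymm h hkl
  simp [elementary, transvection, one_apply, hkl.ne', h1]

theorem permGL_mul_elementary {n : ℕ} (w : Equiv.Perm (Fin n)) {i j : Fin n} (h : i ≠ j) (c : ℂ) :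
    permGL w * elementary h c = elementary (w.injective.ne h) c * permGL w := by
  refine Units.ext ?_
  ext a b
  simp only [elementary, Units.val_mul, coe_permGL, transvection, mul_add, add_mul, mul_one,
    one_mul, Matrix.add_apply, add_right_inj]
  rw [mul_apply, mul_apply]
  simp only [permMat_apply, single_apply, ite_mul, one_mul, zero_mul, mul_ite, mul_one,
    mul_zero]
  rw [Finset.sum_eq_single i, Finset.sum_eq_single (w j)]
  · by_cases h1 : a = w i <;> by_cases h2 : j = b <;> simp [h1, h2, eq_comm]
  · intro k _ hk
    simp [hk.symm]
  · simp
  · intro k _ hk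
    simp [hk.symm]
  · simp

/-- This is the Bruhat decomposition of `SL₂`, embedded in the rows and columns `p` and `q`: a
nontrivial lower transvection lies in the big cell. -/
theorem elementary_mem_cell_swap {n : ℕ} {p q : Fin n} (h : p < q) {c : ℂ} (hc : c ≠ 0) :
    ∃ b ∈ borel n, elementary h.ne' c =
      elementary h.ne c⁻¹ * permGL (Equiv.swap p q) * b := by
  refine ⟨permGL (Equiv.swap p q) * (elementary h.ne (-c⁻¹) * elementary h.ne' c), ?_, ?_⟩
  · have hE : ((elementary h.ne (-c⁻¹) * elementary h.ne' c : GL (Fin n) ℂ) :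
        Matrix (Fin n) (Fin n) ℂ) = 1 + single q p c - single p q c⁻¹ - single p p 1 := by
      have hs : (single p q (-c⁻¹) : Matrix (Fin n) (Fin n) ℂ) = - single p q c⁻¹ := by
        ext; simp [single_apply]; split_ifs <;> simp
      simp only [elementary, Units.val_mul, transvection]
      rw [add_mul, mul_add, mul_add, single_mul_single_same, one_mul, one_mul, mul_one, hs]
      have : -c⁻¹ * c = -1 := by field_simp
      rw [this]
      ext i j
      simp [single_apply]
      split_ifs <;> ring
    rw [mem_borel]
    intro i j hij
    rw [Units.val_mul, hE, mul_apply, Finset.sum_eq_single (Equiv.swap p q i)]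
    · simp only [coe_permGL, permMat_apply, Equiv.swap_apply_self, if_true, one_mul, Matrix.sub_apply,
        Matrix.add_apply, one_apply, single_apply]
      rcases eq_or_ne i p with rfl | hip
      · simp only [Equiv.swap_apply_left]
        have h1 : q ≠ j := (hij.trans h).ne'
        have h2 : i ≠ j := hij.ne'
        simp [h1, h2, h.ne]
      · rcases eq_or_ne i q with rfl | hiq
        · simp only [Equiv.swap_apply_right]
          have h2 : i ≠ j := hij.ne'
          by_cases h3 : p = j <;> simp [h2, h3, h.ne']
        · rw [Equiv.swap_apply_of_ne_of_ne hip hiq]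
          simp [hij.ne', hip.symm, hiq.symm]
    · intro k _ hk
      have : i ≠ Equiv.swap p q k := by rintro rfl; simp at hk
      simp [permMat_apply, this]
    · simp
  · have h1 : permGL (Equiv.swap p q) * permGL (Equiv.swap p q) = 1 := by
      rw [← permGL_mul, Equiv.swap_mul_self, permGL_one]
    have h2 : elementary h.ne c⁻¹ * elementary h.ne (-c⁻¹) = 1 :=
      Units.ext (by simp [elementary, transvection_mul_transvection_same _ _ h.ne])
    calc elementary h.ne' c
        = (elementary h.ne c⁻¹ * elementary h.ne (-c⁻¹)) * elementary h.ne' c := by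
          rw [h2, one_mul]
      _ = elementary h.ne c⁻¹ * (permGL (Equiv.swap p q) * permGL (Equiv.swap p q)) *
          elementary h.ne (-c⁻¹) * elementary h.ne' c := by rw [h1, mul_one]
      _ = _ := by group

/-- The matrices `w (1 + c E_qp)` tend to `w` as `c → 0`. For `c ≠ 0` the upper transvection split
off by `elementary_mem_cell_swap` passes through `w` and stays upper triangular because `w p < w q`,
so they lie in the cell of `w * swap p q`. -/
theorem cell_subset_closure_cell_mul_swap {n : ℕ} {w : Equiv.Perm (Fin n)} {p q : Fin n}
    (h : p < q) (hw : w p < w q) : cell w ⊆ closure (cell (w * Equiv.swap p q)) := by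
  rw [cell_subset_closure_iff]
  have hlim : Tendsto (fun c : ℂ => permGL w * elementary h.ne' c) (𝓝[≠] 0) (𝓝 (permGL w)) := by
    have h1 : Continuous fun c : ℂ => permGL w * elementary h.ne' c :=
      continuous_const.mul (continuous_elementary _)
    have h2 := (h1.tendsto 0).mono_left (nhdsWithin_le_nhds (s := {0}ᶜ))
    rwa [elementary_zero, mul_one] at h2
  refine mem_closure_of_tendsto hlim ?_
  filter_upwards [self_mem_nhdsWithin] with c hc
  obtain ⟨b, hb, hE⟩ := elementary_mem_cell_swap h hc
  rw [hE, ← mul_assoc, ← mul_assoc, permGL_mul_elementary, mul_assoc (elementary _ _), ← permGL_mul]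
  exact ⟨_, elementary_mem_borel hw _, b, hb, rfl⟩

/-- The sum that measures how close a permutation is to the identity. -/
def weight {n : ℕ} (v : Equiv.Perm (Fin n)) : ℤ := ∑ j : Fin n, ((j : ℕ) : ℤ) * ((v j : ℕ) : ℤ)

theorem weight_mul_swap {n : ℕ} (v : Equiv.Perm (Fin n)) {p q : Fin n} (h : p ≠ q) :
    weight (v * Equiv.swap p q) =
      weight v + (((q : ℕ) : ℤ) - ((p : ℕ) : ℤ)) * (((v p : ℕ) : ℤ) - ((v q : ℕ) : ℤ)) := by
  have key : ∀ f : Fin n → ℤ, ∑ j, f j = f p + f q + ∑ j ∈ Finset.univ \ {p, q}, f j := by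
    intro f
    rw [← Finset.sum_pair h, add_comm, Finset.sum_sdiff (Finset.subset_univ _)]
  unfold weight
  rw [key, key fun j => ((j : ℕ) : ℤ) * ((v j : ℕ) : ℤ)]
  have : ∑ j ∈ Finset.univ \ {p, q}, ((j : ℕ) : ℤ) * (((v * Equiv.swap p q) j : ℕ) : ℤ) =
      ∑ j ∈ Finset.univ \ {p, q}, ((j : ℕ) : ℤ) * ((v j : ℕ) : ℤ) := by
    refine Finset.sum_congr rfl fun j hj => ?_
    simp only [Finset.mem_sdiff, Finset.mem_univ, true_and, Finset.mem_insert,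
      Finset.mem_singleton, not_or] at hj
    rw [Equiv.Perm.mul_apply, Equiv.swap_apply_of_ne_of_ne hj.1 hj.2]
  rw [this]
  simp only [Equiv.Perm.mul_apply, Equiv.swap_apply_left, Equiv.swap_apply_right]
  ring

theorem weight_lt_mul_swap {n : ℕ} {v : Equiv.Perm (Fin n)} {p q : Fin n} (h : p < q)
    (hv : v q < v p) : weight v < weight (v * Equiv.swap p q) := by
  rw [weight_mul_swap v h.ne]
  have h1 : (0 : ℤ) < ((q : ℕ) : ℤ) - (p : ℕ) := by have := Fin.lt_def.mp h; omega
  have h2 : (0 : ℤ) < ((v p : ℕ) : ℤ) - (v q : ℕ) := by have := Fin.lt_def.mp hv; omega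
  nlinarith [mul_pos h1 h2]

theorem mul_swap_lt_weight {n : ℕ} {v : Equiv.Perm (Fin n)} {p q : Fin n} (h : p < q)
    (hv : v p < v q) : weight (v * Equiv.swap p q) < weight v := by
  rw [weight_mul_swap v h.ne]
  have h1 : (0 : ℤ) < ((q : ℕ) : ℤ) - (p : ℕ) := by have := Fin.lt_def.mp h; omega
  have h2 : (0 : ℤ) < ((v q : ℕ) : ℤ) - (v p : ℕ) := by have := Fin.lt_def.mp hv; omega
  nlinarith [mul_pos h1 h2]

theorem eq_one_of_no_inversion {n : ℕ} {v : Equiv.Perm (Fin n)}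
    (h : ∀ p q, p < q → v p < v q) : v = 1 := by
  have h1 : StrictMono v := fun p q => h p q
  have h2 : StrictMono.orderIsoOfSurjective v h1 v.surjective = OrderIso.refl _ :=
    Subsingleton.elim _ _
  ext j
  exact congrArg Fin.val (DFunLike.congr_fun h2 j)

theorem weight_nonneg {n : ℕ} (v : Equiv.Perm (Fin n)) : 0 ≤ weight v :=
  Finset.sum_nonneg fun _ _ => by positivity

theorem exists_weight_le (n : ℕ) : ∃ N : ℤ, ∀ v : Equiv.Perm (Fin n), weight v ≤ N :=
  ⟨∑ v : Equiv.Perm (Fin n), weight v, fun v =>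
    Finset.single_le_sum (fun v _ => weight_nonneg v) (Finset.mem_univ v)⟩

/-- Induction along transpositions that remove inversions. -/
theorem perm_induction {n : ℕ} {P : Equiv.Perm (Fin n) → Prop}
    (step : ∀ v, (∀ p q, p < q → v q < v p → P (v * Equiv.swap p q)) → P v) (v) : P v := by
  obtain ⟨N, hN⟩ := exists_weight_le n
  have key : ∀ k : ℕ, ∀ v : Equiv.Perm (Fin n), (N - weight v).toNat = k → P v := by
    intro k
    induction k using Nat.strong_induction_on with
    | _ k ih =>
      intro v hv
      refine step v fun p q h hpq => ih _ ?_ _ rfl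
      have := weight_lt_mul_swap h hpq
      have := hN (v * Equiv.swap p q)
      omega
  exact key _ v rfl

/-- Every Schubert variety passes through the standard flag: removing inversions one by one stays in
the closure and ends at the identity. -/
theorem one_mem_closure_cell {n : ℕ} (w : Equiv.Perm (Fin n)) : 1 ∈ closure (cell w) := by
  induction w using perm_induction with
  | _ w ih =>
    by_cases h : ∃ p q, p < q ∧ w q < w p
    · obtain ⟨p, q, hpq, hw⟩ := h
      have h1 := cell_subset_closure_cell_mul_swap (w := w * Equiv.swap p q) hpq (by simpa)
      rw [mul_assoc, Equiv.swap_mul_self, mul_one] at h1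
      exact closure_minimal h1 isClosed_closure (ih p q hpq hw)
    · push Not at h
      have : w = 1 := eq_one_of_no_inversion fun p q hpq =>
        lt_of_le_of_ne (h p q hpq) (w.injective.ne hpq.ne)
      rw [this, ← permGL_one]
      exact subset_closure (permGL_mem_cell _)

end SchubertTangent

end

/-! ### Bruhat decomposition and the incidence conditions `Meets` -/

noncomputable section

namespace SchubertTangent

open Matrix Topology Filter

theorem exists_mem_borel {n : ℕ} {M : Matrix (Fin n) (Fin n) ℂ} (h : ∀ i j, j < i → M i j = 0)
    (hd : ∀ i, M i i ≠ 0) : ∃ b ∈ borel n, (b : Matrix (Fin n) (Fin n) ℂ) = M := by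
  have hM : M.BlockTriangular id := fun i j hij => h i j hij
  have hdet : M.det ≠ 0 := by
    rw [det_of_isUpperTriangular hM]
    exact Finset.prod_ne_zero_iff.mpr fun i _ => hd i
  exact ⟨GeneralLinearGroup.mkOfDetNeZero M hdet, mem_borel.mpr h, rfl⟩

/-- Elimination of the first `k` columns by upper-triangular row and column operations. -/
theorem exists_eliminate {n : ℕ} (g : GL (Fin n) ℂ) (k : ℕ) (hk : k ≤ n) :
    ∃ b ∈ borel n, ∃ b' ∈ borel n, ∃ σ : Fin n → Fin n, ∀ j : Fin n, (j : ℕ) < k →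
      (∀ i, (b * g * b' : GL (Fin n) ℂ) i j = if i = σ j then 1 else 0) ∧
      (∀ l, (b * g * b' : GL (Fin n) ℂ) (σ j) l = if l = j then 1 else 0) := by
  induction k with
  | zero => exact ⟨1, one_mem _, 1, one_mem _, id, by simp⟩
  | succ k ih =>
    obtain ⟨b, hb, b', hb', σ, hσ⟩ := ih (by omega)
    set h := b * g * b' with hh
    let K : Fin n := ⟨k, hk⟩
    have hne : (Finset.univ.filter fun i => h i K ≠ 0).Nonempty := by
      by_contra hcon
      rw [Finset.not_nonempty_iff_eq_empty, Finset.filter_eq_empty_iff] at hcon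
      have h0 : (h : Matrix (Fin n) (Fin n) ℂ).det = 0 :=
        det_eq_zero_of_column_eq_zero K fun i => not_not.mp (hcon (Finset.mem_univ i))
      exact h.det_ne_zero h0
    -- The pivot is the lowest nonzero entry of the column, so that clearing the entries above it is
    -- an upper-triangular row operation.
    obtain ⟨r, hr, hmax⟩ := Finset.exists_max_image _ id hne
    simp only [Finset.mem_filter, Finset.mem_univ, true_and, id] at hr hmax
    have hzero : ∀ i, r < i → h i K = 0 := fun i hi => by
      by_contra hcon
      exact absurd (hmax i hcon) (not_le.mpr hi)
    have hrσ : ∀ j : Fin n, (j : ℕ) < k → h (σ j) K = 0 ∧ σ j ≠ r := by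
      intro j hj
      have h1 : h (σ j) K = 0 := by
        rw [(hσ j hj).2]
        have : K ≠ j := by rintro rfl; exact lt_irrefl _ hj
        simp [this]
      exact ⟨h1, by rintro h2; exact hr (h2 ▸ h1)⟩
    have hrow : ∀ j : Fin n, (j : ℕ) < k → h r j = 0 := by
      intro j hj
      rw [(hσ j hj).1, if_neg (hrσ j hj).2.symm]
    -- `b1` turns column `K` into the basis vector of the pivot row `r`, and `b2` below clears that
    -- row to the right of `K`. The finished rows and columns are untouched, since row `r` vanishes
    -- in the finished columns and column `K` in the finished rows.
    obtain ⟨b1, hb1, hb1'⟩ := exists_mem_borel (n := n)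
      (M := 1 + vecMulVec (fun i => ((if i = r then 1 else 0) - h i K) / h r K) (Pi.single r 1))
      (by
        intro i j hij
        rw [Matrix.add_apply, vecMulVec_apply, one_apply_ne hij.ne', zero_add]
        rcases eq_or_ne j r with rfl | hj
        · simp [hzero i hij, hij.ne']
        · simp [hj])
      (by
        intro i
        rw [Matrix.add_apply, vecMulVec_apply, one_apply_eq]
        rcases eq_or_ne i r with rfl | hi
        · simp only [if_true, Pi.single_eq_same]
          field_simp
          simpa using hr
        · simp [hi])
    obtain ⟨b2, hb2, hb2'⟩ := exists_mem_borel (n := n)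
      (M := 1 - vecMulVec (Pi.single K 1) (fun l => if K < l then h r l / h r K else 0))
      (by
        intro i j hij
        rw [Matrix.sub_apply, vecMulVec_apply, one_apply_ne hij.ne', zero_sub]
        rcases eq_or_ne i K with rfl | hi
        · simp [hij.le]
        · simp [hi])
      (by
        intro i
        rw [Matrix.sub_apply, vecMulVec_apply, one_apply_eq]
        rcases eq_or_ne i K with rfl | hi
        · simp
        · simp [hi])
    have h1 : ∀ i l, (b1 * h : GL (Fin n) ℂ) i l =
        h i l + ((if i = r then 1 else 0) - h i K) / h r K * h r l := by
      intro i l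
      rw [Units.val_mul, hb1', add_mul, one_mul, vecMulVec_mul, Matrix.add_apply, vecMulVec_apply,
        single_one_vecMul]
      rfl
    have h2 : ∀ i l, (b1 * h * b2 : GL (Fin n) ℂ) i l =
        h i l + ((if i = r then 1 else 0) - h i K) / h r K * h r l -
          (if i = r then 1 else 0) * (if K < l then h r l / h r K else 0) := by
      intro i l
      rw [Units.val_mul, hb2', mul_sub, mul_one, mul_vecMulVec, Matrix.sub_apply, vecMulVec_apply,
        mulVec_single_one, col_apply, h1, h1]
      congr 2
      field_simp
      ring
    refine ⟨b1 * b, mul_mem hb1 hb, b' * b2, mul_mem hb' hb2, Function.update σ K r, ?_⟩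
    have h3 : b1 * b * g * (b' * b2) = b1 * h * b2 := by rw [hh]; group
    rw [h3]
    intro j hj
    rcases eq_or_ne j K with rfl | hjK
    · rw [Function.update_self]
      refine ⟨fun i => ?_, fun l => ?_⟩
      · rw [h2]
        simp only [lt_irrefl, if_false, mul_zero, sub_zero]
        field_simp
        ring
      · rw [h2]
        simp only [if_true, one_mul]
        rcases lt_trichotomy l K with hl | rfl | hl
        · rw [hrow l hl]
          simp [hl.ne]
        · simp only [lt_irrefl, if_false, if_true]
          field_simp
          ring
        · simp only [hl, hl.ne', if_false, if_true]
          field_simp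
          ring
    · have hj' : (j : ℕ) < k := by
        have : (j : ℕ) ≠ k := fun h => hjK (Fin.ext h)
        omega
      rw [Function.update_of_ne hjK]
      have hjK' : ¬ K < j := by rw [Fin.lt_def]; exact not_lt.mpr hj'.le
      refine ⟨fun i => ?_, fun l => ?_⟩
      · rw [h2, hrow j hj', (hσ j hj').1, if_neg hjK']
        ring
      · rw [h2, (hrσ j hj').1, if_neg (hrσ j hj').2, (hσ j hj').2]
        simp

/-- The Bruhat decomposition. -/
theorem exists_mem_cell {n : ℕ} (g : GL (Fin n) ℂ) : ∃ u, g ∈ cell u := by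
  obtain ⟨b, hb, b', hb', σ, hσ⟩ := exists_eliminate g n le_rfl
  have hinj : Function.Injective σ := by
    intro i j hij
    have h1 := (hσ i i.2).2 j
    rw [hij, (hσ j j.2).2 j, if_pos rfl] at h1
    by_contra hne
    simp [Ne.symm hne] at h1
  let u : Equiv.Perm (Fin n) := Equiv.ofBijective σ hinj.bijective_of_finite
  have hu : b * g * b' = permGL u := by
    refine Units.ext ?_
    ext i j
    rw [coe_permGL, permMat_apply]
    exact (hσ j j.2).1 i
  exact ⟨u, b⁻¹, inv_mem hb, b'⁻¹, inv_mem hb', by rw [← hu]; group⟩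

/-- The image under `g` of the span of the first `c` basis vectors meets the span of the first `e`
basis vectors nontrivially. -/
def Meets {n : ℕ} (c e : ℕ) (g : GL (Fin n) ℂ) : Prop :=
  ∃ v : Fin n → ℂ, v ≠ 0 ∧ (∀ k : Fin n, c ≤ k → v k = 0) ∧
    ∀ k : Fin n, e ≤ k → ((g : Matrix (Fin n) (Fin n) ℂ) *ᵥ v) k = 0

theorem mulVec_supported {n : ℕ} {b : GL (Fin n) ℂ} (hb : b ∈ borel n) {e : ℕ} {v : Fin n → ℂ}
    (hv : ∀ k : Fin n, e ≤ k → v k = 0) (k : Fin n) (hk : e ≤ k) :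
    ((b : Matrix (Fin n) (Fin n) ℂ) *ᵥ v) k = 0 := by
  rw [mulVec, dotProduct]
  refine Finset.sum_eq_zero fun j _ => ?_
  rcases lt_or_ge j k with h | h
  · rw [mem_borel.mp hb k j h, zero_mul]
  · rw [hv j (hk.trans h), mul_zero]

theorem gl_mulVec_ne_zero {n : ℕ} (g : GL (Fin n) ℂ) {v : Fin n → ℂ} (hv : v ≠ 0) :
    (g : Matrix (Fin n) (Fin n) ℂ) *ᵥ v ≠ 0 := by
  intro h
  apply hv
  have := congrArg (fun u => ((g⁻¹ : GL (Fin n) ℂ) : Matrix (Fin n) (Fin n) ℂ) *ᵥ u) h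
  simpa [mulVec_mulVec, ← Units.val_mul] using this

theorem Meets.mul {n c e : ℕ} {g b b' : GL (Fin n) ℂ} (h : Meets c e g) (hb : b ∈ borel n)
    (hb' : b' ∈ borel n) : Meets c e (b * g * b') := by
  obtain ⟨v, hv, hc, he⟩ := h
  refine ⟨((b'⁻¹ : GL (Fin n) ℂ) : Matrix (Fin n) (Fin n) ℂ) *ᵥ v, gl_mulVec_ne_zero _ hv,
    mulVec_supported (inv_mem hb') hc, ?_⟩
  have : ((b * g * b' : GL (Fin n) ℂ) : Matrix (Fin n) (Fin n) ℂ) *ᵥ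
      (((b'⁻¹ : GL (Fin n) ℂ) : Matrix (Fin n) (Fin n) ℂ) *ᵥ v) =
      (b : Matrix (Fin n) (Fin n) ℂ) *ᵥ ((g : Matrix (Fin n) (Fin n) ℂ) *ᵥ v) := by
    rw [mulVec_mulVec, mulVec_mulVec, ← Units.val_mul, ← Units.val_mul]
    simp
  rw [this]
  exact mulVec_supported hb he

theorem meets_permGL {n c e : ℕ} {u : Equiv.Perm (Fin n)} :
    Meets c e (permGL u) ↔ ∃ j : Fin n, (j : ℕ) < c ∧ (u j : ℕ) < e := by
  have key : ∀ (v : Fin n → ℂ) k, (permMat u *ᵥ v) (u k) = v k := by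
    intro v k
    rw [mulVec, dotProduct, Finset.sum_eq_single k]
    · simp [permMat_apply]
    · intro j _ hj
      simp [permMat_apply, hj.symm]
    · simp
  constructor
  · rintro ⟨v, hv, hc, he⟩
    by_contra! hcon
    refine hv (funext fun j => ?_)
    rcases lt_or_ge (j : ℕ) c with h | h
    · have := he (u j) (hcon j h)
      rwa [coe_permGL, key] at this
    · exact hc j h
  · rintro ⟨j, hj, hu⟩
    refine ⟨Pi.single j 1, by simp, fun k hk => ?_, fun k hk => ?_⟩
    · have : k ≠ j := by rintro rfl; omega
      simp [this]
    · obtain ⟨k, rfl⟩ := u.surjective k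
      rw [coe_permGL, key]
      have : k ≠ j := by rintro rfl; omega
      simp [this]

theorem meets_of_mem_cell {n c e : ℕ} {u : Equiv.Perm (Fin n)} {g : GL (Fin n) ℂ}
    (hg : g ∈ cell u) : Meets c e g ↔ ∃ j : Fin n, (j : ℕ) < c ∧ (u j : ℕ) < e := by
  rw [← meets_permGL]
  obtain ⟨b, hb, b', hb', rfl⟩ := hg
  refine ⟨fun h => ?_, fun h => h.mul hb hb'⟩
  have := h.mul (inv_mem hb) (inv_mem hb')
  simpa [mul_assoc] using this

/-- The image `g v` of a witness is a witness for the inverse. This trades a corner of size `c` for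
one of size `n - c`. -/
theorem Meets.inv {n c e : ℕ} {g : GL (Fin n) ℂ} (h : Meets c e g) : Meets e c g⁻¹ := by
  obtain ⟨v, hv, hc, he⟩ := h
  refine ⟨_, gl_mulVec_ne_zero g hv, he, ?_⟩
  rw [mulVec_mulVec, ← Units.val_mul]
  simpa using hc

theorem meets_inv {n c e : ℕ} {g : GL (Fin n) ℂ} : Meets c e g⁻¹ ↔ Meets e c g :=
  ⟨fun h => by simpa using h.inv, Meets.inv⟩

/-- The lower-left `r × c` corner of a matrix. -/
def corner {n : ℕ} {R : Type*} {r c : ℕ} (hr : r ≤ n) (hc : c ≤ n) (M : Matrix (Fin n) (Fin n) R) :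
    Matrix (Fin r) (Fin c) R :=
  M.submatrix (fun i => ⟨n - r + i, by omega⟩) (Fin.castLE hc)

/-- On vectors supported in the first `c` places only the first `c` columns act, and the requirement
concerns only the last `r` rows. -/
theorem meets_iff_corner {n r c : ℕ} (hr : r ≤ n) (hc : c ≤ n) {g : GL (Fin n) ℂ} :
    Meets c (n - r) g ↔ ∃ v : Fin c → ℂ, v ≠ 0 ∧
      corner hr hc (g : Matrix (Fin n) (Fin n) ℂ) *ᵥ v = 0 := by
  have key : ∀ (v : Fin n → ℂ), (∀ k : Fin n, c ≤ k → v k = 0) → ∀ i : Fin n,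
      ((g : Matrix (Fin n) (Fin n) ℂ) *ᵥ v) i =
        ∑ j : Fin c, (g : Matrix (Fin n) (Fin n) ℂ) i (Fin.castLE hc j) * v (Fin.castLE hc j) := by
    intro v hv i
    have hinj : Function.Injective (Fin.castLE hc) := Fin.castLE_injective hc
    rw [mulVec, dotProduct, ← Finset.sum_image (s := Finset.univ) (g := Fin.castLE hc)
      (f := fun j => (g : Matrix (Fin n) (Fin n) ℂ) i j * v j) (fun a _ b _ h => hinj h)]
    refine (Finset.sum_subset (Finset.subset_univ _) fun j _ hj => ?_).symm
    rw [hv j, mul_zero]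
    by_contra hcon
    exact hj (Finset.mem_image.mpr ⟨⟨j, by omega⟩, Finset.mem_univ _, rfl⟩)
  constructor
  · rintro ⟨v, hv, hc', he⟩
    refine ⟨fun j => v (Fin.castLE hc j), fun h => hv (funext fun k => ?_), funext fun i => ?_⟩
    · rcases lt_or_ge (k : ℕ) c with hk | hk
      · exact congrFun h ⟨k, hk⟩
      · exact hc' k hk
    · rw [Pi.zero_apply, ← he ⟨n - r + i, by omega⟩ (by simp), key v hc']
      rfl
  · rintro ⟨v, hv, h⟩
    let v' : Fin n → ℂ := fun k => if hk : (k : ℕ) < c then v ⟨k, hk⟩ else 0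
    have hv' : ∀ k : Fin n, c ≤ k → v' k = 0 := fun k hk => dif_neg (not_lt.mpr hk)
    have hv'' : ∀ j, v' (Fin.castLE hc j) = v j := fun j => dif_pos j.2
    refine ⟨v', fun h0 => hv (funext fun j => ?_), hv', fun k hk => ?_⟩
    · rw [← hv'', h0]
      rfl
    · rw [key v' hv']
      have := congrFun h ⟨k - (n - r), by omega⟩
      simp only [corner, mulVec, dotProduct, submatrix_apply, Pi.zero_apply] at this
      rw [← this]
      refine Finset.sum_congr rfl fun j _ => ?_
      rw [hv'']
      have : k = ⟨n - r + (k - (n - r)), by omega⟩ := Fin.ext (by simp only; omega)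
      rw [← this]

theorem meets_iff_det_corner {n c : ℕ} (hc : c ≤ n) {g : GL (Fin n) ℂ} :
    Meets c (n - c) g ↔ (corner hc hc (g : Matrix (Fin n) (Fin n) ℂ)).det = 0 := by
  rw [meets_iff_corner hc hc, exists_mulVec_eq_zero_iff]

end SchubertTangent

end

/-! ### Chart coordinates by LU factorization, and primality of the local ideals -/

noncomputable section

namespace SchubertTangent

open Matrix Topology Filter

/-- The leading principal submatrix on the indices up to `j`. -/
def leading {n : ℕ} {R : Type*} (M : Matrix (Fin n) (Fin n) R) (j : Fin n) :
    Matrix {k : Fin n // k ≤ j} {k : Fin n // k ≤ j} R :=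
  M.submatrix Subtype.val Subtype.val

/-- The numerators of the coordinates of the lower unitriangular factor of a matrix. -/
def luNum {n : ℕ} {R : Type*} [CommRing R] (M : Matrix (Fin n) (Fin n) R) (s : Coord n) : R :=
  ∑ k : {k : Fin n // k ≤ s.1.2},
    M s.1.1 k * (leading M s.1.2).adjugate k ⟨s.1.2, le_rfl⟩

/-- The coordinates of the lower unitriangular factor of a matrix. -/
def lu {n : ℕ} (M : Matrix (Fin n) (Fin n) ℂ) (s : Coord n) : ℂ :=
  luNum M s / (leading M s.1.2).det

theorem luNum_map {n : ℕ} {R S : Type*} [CommRing R] [CommRing S] (f : R →+* S)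
    (M : Matrix (Fin n) (Fin n) R) (s : Coord n) : luNum (M.map f) s = f (luNum M s) := by
  have h : leading (M.map f) s.1.2 = f.mapMatrix (leading M s.1.2) := rfl
  simp only [luNum, map_sum, map_mul, h, map_apply]
  rw [← RingHom.map_adjugate]
  rfl

theorem det_leading_map {n : ℕ} {R S : Type*} [CommRing R] [CommRing S] (f : R →+* S)
    (M : Matrix (Fin n) (Fin n) R) (j : Fin n) :
    (leading (M.map f) j).det = f (leading M j).det := by
  rw [RingHom.map_det]
  rfl

/-- The upper-triangular matrix that turns `M` into its lower unitriangular factor. -/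
def luUpper {n : ℕ} (M : Matrix (Fin n) (Fin n) ℂ) : Matrix (Fin n) (Fin n) ℂ :=
  of fun k j => if h : k ≤ j then
    (leading M j).adjugate ⟨k, h⟩ ⟨j, le_rfl⟩ / (leading M j).det else 0

theorem mul_luUpper {n : ℕ} {M : Matrix (Fin n) (Fin n) ℂ}
    (hM : ∀ j, (leading M j).det ≠ 0) : M * luUpper M = unipotent (lu M) := by
  have key : ∀ i j, (M * luUpper M) i j = (∑ k : {k : Fin n // k ≤ j},
      M i k * (leading M j).adjugate k ⟨j, le_rfl⟩) / (leading M j).det := by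
    intro i j
    rw [mul_apply, Finset.sum_div]
    have h1 : ∑ k ∈ Finset.univ.filter (fun k => k ≤ j), M i k * luUpper M k j =
        ∑ k : {k : Fin n // k ≤ j}, M i k * luUpper M k j :=
      Finset.sum_subtype _ (by simp) _
    rw [Finset.sum_filter_of_ne] at h1
    · rw [h1]
      refine Finset.sum_congr rfl fun k _ => ?_
      rw [luUpper, of_apply, dif_pos k.2, mul_div_assoc]
    · intro k _ hk
      by_contra hcon
      simp [luUpper, hcon] at hk
  ext i j
  rw [key]
  rcases lt_or_ge j i with h | h
  · rw [unipotent, of_apply, dif_pos h]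
    rfl
  · rw [unipotent, of_apply, dif_neg (not_lt.mpr h)]
    have h1 := congrFun (congrFun (mul_adjugate (leading M j)) ⟨i, h⟩) ⟨j, le_rfl⟩
    rw [mul_apply] at h1
    have h2 : ∀ k, leading M j ⟨i, h⟩ k = M i k := fun k => rfl
    simp only [h2] at h1
    rw [h1, Matrix.smul_apply, smul_eq_mul, mul_div_cancel_left₀ _ (hM j), Matrix.one_apply]
    simp only [Subtype.mk.injEq]

theorem uGL_lu_mem_cell {n : ℕ} {w : Equiv.Perm (Fin n)} {g : GL (Fin n) ℂ} (hg : g ∈ cell w)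
    (hM : ∀ j, (leading (g : Matrix (Fin n) (Fin n) ℂ) j).det ≠ 0) :
    uGL (lu (g : Matrix (Fin n) (Fin n) ℂ)) ∈ cell w := by
  have h := mul_luUpper hM
  have hdet : (luUpper (g : Matrix (Fin n) (Fin n) ℂ)).det ≠ 0 := by
    intro h0
    have := congrArg det h
    rw [det_mul, h0, mul_zero, det_unipotent] at this
    exact zero_ne_one this
  have h2 : uGL (lu (g : Matrix (Fin n) (Fin n) ℂ)) =
      1 * g * GeneralLinearGroup.mkOfDetNeZero (luUpper (g : Matrix (Fin n) (Fin n) ℂ)) hdet := by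
    rw [one_mul]
    exact Units.ext h.symm
  rw [h2]
  refine mul_mem_cell (one_mem _) hg (mem_borel.mpr fun i j hij => ?_)
  exact dif_neg (not_le.mpr hij)

theorem leading_unipotent_mulVec {n : ℕ} (x : Coord n → ℂ) (j : Fin n) :
    leading (unipotent x) j *ᵥ Pi.single ⟨j, le_rfl⟩ 1 = Pi.single ⟨j, le_rfl⟩ 1 := by
  ext ⟨k, hk⟩
  rw [mulVec_single_one, col_apply, leading, submatrix_apply, unipotent, of_apply,
    dif_neg (not_lt.mpr hk)]
  by_cases h : k = j
  · subst h
    simp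
  · rw [if_neg h, Pi.single_eq_of_ne]
    simpa using h

theorem det_leading_unipotent {n : ℕ} (x : Coord n → ℂ) (j : Fin n) :
    (leading (unipotent x) j).det = 1 := by
  rw [det_of_isLowerTriangular]
  · simp [unipotent, leading]
  · intro a b hab
    have h : (a : Fin n) < b := hab
    simp [unipotent, leading, h.not_gt, h.ne]

theorem lu_unipotent {n : ℕ} (x : Coord n → ℂ) : lu (unipotent x) = x := by
  ext s
  have h : (leading (unipotent x) s.1.2).adjugate *ᵥ Pi.single ⟨s.1.2, le_rfl⟩ 1 =
      Pi.single ⟨s.1.2, le_rfl⟩ 1 := by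
    conv_lhs => rw [← leading_unipotent_mulVec x]
    rw [mulVec_mulVec, adjugate_mul, det_leading_unipotent, one_smul, one_mulVec]
  rw [lu, det_leading_unipotent, div_one, luNum, Finset.sum_eq_single ⟨s.1.2, le_rfl⟩]
  · have h1 := congrFun h ⟨s.1.2, le_rfl⟩
    rw [mulVec_single_one, col_apply, Pi.single_eq_same] at h1
    rw [h1, mul_one]
    simp [unipotent, s.2]
  · intro k _ hk
    have h1 := congrFun h k
    rw [mulVec_single_one, col_apply, Pi.single_eq_of_ne hk] at h1
    rw [h1, mul_zero]
  · simp

theorem continuous_det_leading {n : ℕ} (j : Fin n) :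
    Continuous fun g : GL (Fin n) ℂ => (leading (g : Matrix (Fin n) (Fin n) ℂ) j).det :=
  (Units.continuous_val.matrix_submatrix _ _).matrix_det

theorem continuous_luNum {n : ℕ} (s : Coord n) :
    Continuous fun g : GL (Fin n) ℂ => luNum (g : Matrix (Fin n) (Fin n) ℂ) s := by
  refine continuous_finsetSum _ fun k _ => ?_
  exact (Units.continuous_val.matrix_elem _ _).mul
    ((Units.continuous_val.matrix_submatrix _ _).matrix_adjugate.matrix_elem _ _)

/-- Near a chart point `lu` is continuous and maps elements of the cell to chart points of the same
cell. A polynomial that is nonzero at a limit point is therefore nonzero at some chart point of the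
cell itself. -/
theorem mem_localIdeal_iff_cell {n : ℕ} {w : Equiv.Perm (Fin n)}
    {p : MvPolynomial (Coord n) ℂ} :
    p ∈ localIdeal w ↔ ∀ x, uGL x ∈ cell w → MvPolynomial.eval x p = 0 := by
  rw [mem_localIdeal]
  refine ⟨fun h x hx => h x (subset_closure hx), fun h x hx => ?_⟩
  by_contra hp
  have hcont : ContinuousAt (fun g : GL (Fin n) ℂ =>
      MvPolynomial.eval (lu (g : Matrix (Fin n) (Fin n) ℂ)) p) (uGL x) := by
    refine (MvPolynomial.continuous_eval p).continuousAt.comp (f := fun g : GL (Fin n) ℂ =>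
      lu (g : Matrix (Fin n) (Fin n) ℂ)) (continuousAt_pi.mpr fun s => ?_)
    refine (continuous_luNum s).continuousAt.div (continuous_det_leading _).continuousAt ?_
    rw [coe_uGL, det_leading_unipotent]
    exact one_ne_zero
  have h1 : ∀ᶠ g : GL (Fin n) ℂ in 𝓝 (uGL x),
      MvPolynomial.eval (lu (g : Matrix (Fin n) (Fin n) ℂ)) p ≠ 0 := by
    refine hcont.eventually_ne ?_
    simpa [lu_unipotent] using hp
  have h2 : ∀ᶠ g : GL (Fin n) ℂ in 𝓝 (uGL x), ∀ j, (leading (g : Matrix (Fin n) (Fin n) ℂ) j).det ≠ 0 := by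
    refine eventually_all.mpr fun j => (continuous_det_leading j).continuousAt.eventually_ne ?_
    rw [coe_uGL, det_leading_unipotent]
    exact one_ne_zero
  obtain ⟨g, hg, hg1, hg2⟩ := ((mem_closure_iff_frequently.mp hx).and_eventually (h1.and h2)).exists
  exact hg1 (h _ (uGL_lu_mem_cell hg hg2))

/-- Pulling a polynomial back along the rational map `lu` gives a genuine polynomial after
multiplication by a power of the common denominator `D`. -/
theorem exists_clear_denominators {σ τ : Type*} (num den : σ → MvPolynomial τ ℂ)
    (D : MvPolynomial τ ℂ) (hD : ∀ s, den s ∣ D) (p : MvPolynomial σ ℂ) :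
    ∃ (N : ℕ) (P : MvPolynomial τ ℂ), ∀ y, MvPolynomial.eval y D ≠ 0 →
      MvPolynomial.eval y P = MvPolynomial.eval y D ^ N *
        MvPolynomial.eval (fun s => MvPolynomial.eval y (num s) / MvPolynomial.eval y (den s)) p := by
  induction p using MvPolynomial.induction_on with
  | C a => exact ⟨0, MvPolynomial.C a, fun y _ => by simp⟩
  | add p q hp hq =>
    obtain ⟨N, P, hP⟩ := hp
    obtain ⟨M, Q, hQ⟩ := hq
    refine ⟨N + M, D ^ M * P + D ^ N * Q, fun y hy => ?_⟩
    simp only [map_add, map_mul, map_pow, hP y hy, hQ y hy]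
    ring
  | mul_X p s hp =>
    obtain ⟨N, P, hP⟩ := hp
    obtain ⟨e, he⟩ := hD s
    refine ⟨N + 1, P * num s * e, fun y hy => ?_⟩
    have h1 : MvPolynomial.eval y D = MvPolynomial.eval y (den s) * MvPolynomial.eval y e := by
      rw [he, map_mul]
    have h2 : MvPolynomial.eval y (den s) ≠ 0 := by
      intro h
      rw [h1, h, zero_mul] at hy
      exact hy rfl
    simp only [map_mul, hP y hy, MvPolynomial.eval_X, pow_succ]
    rw [h1]
    field_simp

theorem zero_mem_chartVariety {n : ℕ} (w : Equiv.Perm (Fin n)) :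
    (0 : Coord n → ℂ) ∈ chartVariety w := by
  have : uGL (0 : Coord n → ℂ) = 1 := by
    refine Units.ext ?_
    ext i j
    by_cases h : j < i <;> simp [unipotent, one_apply, h]
    exact h.ne'
  rw [chartVariety, Set.mem_ofPred_eq, this]
  exact one_mem_closure_cell w

/-- The generic matrix of the double coset `B w B`. -/
def genericCell {n : ℕ} (w : Equiv.Perm (Fin n)) :
    Matrix (Fin n) (Fin n) (MvPolynomial (Bool × Fin n × Fin n) ℂ) :=
  (of fun i j => if i ≤ j then MvPolynomial.X (false, i, j) else 0) *
    (permMat w).map MvPolynomial.C * (of fun i j => if i ≤ j then MvPolynomial.X (true, i, j) else 0)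

/-- The upper-triangular matrix with prescribed entries. -/
def upper {n : ℕ} (y : Fin n × Fin n → ℂ) : Matrix (Fin n) (Fin n) ℂ :=
  of fun i j => if i ≤ j then y (i, j) else 0

theorem genericCell_map {n : ℕ} (w : Equiv.Perm (Fin n)) (y : Bool × Fin n × Fin n → ℂ) :
    (genericCell w).map (MvPolynomial.eval y) =
      upper (fun s => y (false, s)) * permMat w * upper (fun s => y (true, s)) := by
  have h1 : ∀ b, (of fun i j : Fin n => if i ≤ j then
      (MvPolynomial.X (b, i, j) : MvPolynomial (Bool × Fin n × Fin n) ℂ) else 0).map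
        (MvPolynomial.eval y) = upper (fun s => y (b, s)) := by
    intro b
    ext i j
    simp only [map_apply, of_apply, upper]
    split_ifs <;> simp
  have h2 : ((permMat w).map MvPolynomial.C).map (MvPolynomial.eval y) = permMat w := by
    ext i j
    simp
  rw [genericCell, Matrix.map_mul, Matrix.map_mul, h1, h1, h2]

theorem genericCell_mem_cell {n : ℕ} (w : Equiv.Perm (Fin n)) (y : Bool × Fin n × Fin n → ℂ)
    (h : ((genericCell w).map (MvPolynomial.eval y)).det ≠ 0) :
    GeneralLinearGroup.mkOfDetNeZero _ h ∈ cell w := by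
  have h' := h
  rw [genericCell_map, det_mul, det_mul] at h'
  have h1 := left_ne_zero_of_mul (left_ne_zero_of_mul h')
  have h2 := right_ne_zero_of_mul h'
  have hb : ∀ (y : Fin n × Fin n → ℂ) (h : (upper y).det ≠ 0),
      GeneralLinearGroup.mkOfDetNeZero _ h ∈ borel n :=
    fun y h => mem_borel.mpr fun i j hij => if_neg (not_le.mpr hij)
  exact ⟨_, hb _ h1, _, hb _ h2, Units.ext (genericCell_map w y)⟩

theorem exists_genericCell_eq {n : ℕ} {w : Equiv.Perm (Fin n)} {g : GL (Fin n) ℂ}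
    (hg : g ∈ cell w) : ∃ y, (genericCell w).map (MvPolynomial.eval y) = g := by
  obtain ⟨b, hb, b', hb', rfl⟩ := hg
  refine ⟨fun s => if s.1 then (b' : Matrix (Fin n) (Fin n) ℂ) s.2.1 s.2.2
    else (b : Matrix (Fin n) (Fin n) ℂ) s.2.1 s.2.2, ?_⟩
  have h : ∀ b ∈ borel n, upper (fun s => (b : Matrix (Fin n) (Fin n) ℂ) s.1 s.2) = b := by
    intro b hb
    ext i j
    simp only [upper, of_apply, ite_eq_left_iff, not_le]
    exact fun hij => (mem_borel.mp hb i j hij).symm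
  rw [genericCell_map]
  simp only [if_true, Bool.false_eq_true, if_false, h b hb, h b' hb', Units.val_mul, coe_permGL]

/-- The cell is the image of an open subset of an affine space under the generic product `b w b'`.
Two polynomials that do not vanish identically on it pull back to nonzero polynomials, whose product
is nonzero because a polynomial ring is a domain. -/
instance localIdeal_isPrime {n : ℕ} (w : Equiv.Perm (Fin n)) : (localIdeal w).IsPrime := by
  rw [Ideal.isPrime_iff]
  constructor
  · rw [Ideal.ne_top_iff_one, mem_localIdeal]
    intro h
    simpa using h 0 (zero_mem_chartVariety w)
  · intro p q hpq
    by_contra! hcon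
    obtain ⟨hp, hq⟩ := hcon
    rw [mem_localIdeal_iff_cell] at hp hq
    push Not at hp hq
    obtain ⟨x, hx, hpx⟩ := hp
    obtain ⟨x', hx', hqx⟩ := hq
    let D : MvPolynomial (Bool × Fin n × Fin n) ℂ := ∏ j, (leading (genericCell w) j).det
    have hD : ∀ y, MvPolynomial.eval y D =
        ∏ j, (leading ((genericCell w).map (MvPolynomial.eval y)) j).det := by
      intro y
      rw [map_prod]
      exact Finset.prod_congr rfl fun j _ => (det_leading_map _ _ _).symm
    have hlu : ∀ y, lu ((genericCell w).map (MvPolynomial.eval y)) = fun s =>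
        MvPolynomial.eval y (luNum (genericCell w) s) /
          MvPolynomial.eval y (leading (genericCell w) s.1.2).det := by
      intro y
      ext s
      rw [lu, luNum_map, det_leading_map]
    have hdvd : ∀ s : Coord n, (leading (genericCell w) s.1.2).det ∣ D :=
      fun s => Finset.dvd_prod_of_mem _ (Finset.mem_univ _)
    obtain ⟨N, P, hP⟩ := exists_clear_denominators (luNum (genericCell w)) _ D hdvd p
    obtain ⟨M, Q, hQ⟩ := exists_clear_denominators (luNum (genericCell w)) _ D hdvd q
    obtain ⟨y, hy⟩ := exists_genericCell_eq hx
    obtain ⟨y', hy'⟩ := exists_genericCell_eq hx'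
    have hDy : MvPolynomial.eval y D = 1 := by
      rw [hD, hy]
      exact Finset.prod_eq_one fun j _ => det_leading_unipotent x j
    have hDy' : MvPolynomial.eval y' D = 1 := by
      rw [hD, hy']
      exact Finset.prod_eq_one fun j _ => det_leading_unipotent x' j
    have hPy : MvPolynomial.eval y P ≠ 0 := by
      rw [hP y (by simp [hDy]), hDy, ← hlu, hy, coe_uGL, lu_unipotent]
      simpa using hpx
    have hQy : MvPolynomial.eval y' Q ≠ 0 := by
      rw [hQ y' (by simp [hDy']), hDy', ← hlu, hy', coe_uGL, lu_unipotent]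
      simpa using hqx
    have hdet : ∀ y, MvPolynomial.eval y (genericCell w).det =
        ((genericCell w).map (MvPolynomial.eval y)).det := fun y => RingHom.map_det _ _
    -- The factors `D` and `det` are included so that the point where the product is nonzero gives
    -- an invertible matrix with an LU factorization.
    have hprod : P * Q * D * (genericCell w).det ≠ 0 := by
      refine mul_ne_zero (mul_ne_zero (mul_ne_zero ?_ ?_) ?_) ?_
      · rintro rfl; simp at hPy
      · rintro rfl; simp at hQy
      · intro h; simp [h] at hDy
      · intro h
        have := hdet y
        rw [h, hy, coe_uGL, det_unipotent, map_zero] at this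
        exact zero_ne_one this
    obtain ⟨z, hz⟩ : ∃ z, MvPolynomial.eval z (P * Q * D * (genericCell w).det) ≠ 0 := by
      by_contra! h
      exact hprod (MvPolynomial.funext fun z => by rw [h z, map_zero])
    simp only [map_mul] at hz
    have hz4 := right_ne_zero_of_mul hz
    have hz3 := right_ne_zero_of_mul (left_ne_zero_of_mul hz)
    have hz2 := right_ne_zero_of_mul (left_ne_zero_of_mul (left_ne_zero_of_mul hz))
    have hz1 := left_ne_zero_of_mul (left_ne_zero_of_mul (left_ne_zero_of_mul hz))
    rw [hP z hz3, ← hlu] at hz1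
    rw [hQ z hz3, ← hlu] at hz2
    rw [hdet] at hz4
    rw [hD, Finset.prod_ne_zero_iff] at hz3
    have hmem := uGL_lu_mem_cell (genericCell_mem_cell w z hz4) (fun j => hz3 j (Finset.mem_univ j))
    have := mem_localIdeal_iff_cell.mp hpq _ hmem
    rw [map_mul] at this
    exact mul_ne_zero (right_ne_zero_of_mul hz1) (right_ne_zero_of_mul hz2) this

end SchubertTangent

end

/-! ### Codimension equals the number of ascents -/

noncomputable section

namespace SchubertTangent

open Matrix Topology Filter

theorem exists_linearIndependent_rows {m n : Type*} [Fintype m] [Fintype n]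
    (A : Matrix m n ℂ) {r : ℕ} (hr : A.rank = r) :
    ∃ f : Fin r → m, LinearIndependent ℂ (A.submatrix f id).row := by
  subst hr
  rw [rank_eq_finrank_span_row]
  obtain ⟨f, hf, -, hli⟩ := Submodule.exists_fun_fin_finrank_span_eq ℂ (Set.range A.row)
  choose g hg using hf
  refine ⟨g, ?_⟩
  have h : (A.submatrix g id).row = f := funext fun i => hg i
  rw [h]
  exact hli

theorem exists_minor_ne_zero {m n : Type*} [Fintype m] [Fintype n] (A : Matrix m n ℂ) {r : ℕ}
    (hr : A.rank = r) : ∃ (f : Fin r → m) (g : Fin r → n), (A.submatrix f g).det ≠ 0 := by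
  obtain ⟨f, hf⟩ := exists_linearIndependent_rows A hr
  have h1 : (A.submatrix f id)ᵀ.rank = r := by
    rw [rank_transpose, hf.rank_matrix, Fintype.card_fin]
  obtain ⟨g, hg⟩ := exists_linearIndependent_rows _ h1
  refine ⟨f, g, ?_⟩
  have h2 := (linearIndependent_rows_iff_isUnit.mp hg)
  rw [isUnit_iff_isUnit_det, ← det_transpose] at h2
  exact h2.ne_zero

theorem le_rank_of_minor_ne_zero {m n : Type*} [Fintype m] [Fintype n] (A : Matrix m n ℂ) {r : ℕ}
    (f : Fin r → m) (g : Fin r → n) (h : (A.submatrix f g).det ≠ 0) : r ≤ A.rank := by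
  have h1 := rank_of_isUnit (A.submatrix f g) ((isUnit_iff_isUnit_det _).mpr h.isUnit)
  rw [Fintype.card_fin] at h1
  rw [← h1]
  exact rank_submatrix_le _ _ _

/-- The generic lower unitriangular matrix. -/
def genericUnipotent (n : ℕ) : Matrix (Fin n) (Fin n) (MvPolynomial (Coord n) ℂ) :=
  of fun i j => if h : j < i then MvPolynomial.X ⟨(i, j), h⟩ else if i = j then 1 else 0

theorem genericUnipotent_map {n : ℕ} (x : Coord n → ℂ) :
    (genericUnipotent n).map (MvPolynomial.eval x) = unipotent x := by
  ext i j
  simp only [genericUnipotent, unipotent, map_apply, of_apply]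
  split_ifs <;> simp

theorem eval_det_submatrix {n : ℕ} {ι : Type*} [Fintype ι] [DecidableEq ι] (f g : ι → Fin n)
    (x : Coord n → ℂ) : MvPolynomial.eval x ((genericUnipotent n).submatrix f g).det =
      ((unipotent x).submatrix f g).det := by
  rw [RingHom.map_det, ← genericUnipotent_map]
  rfl

/-- The lower-left block of the rows from `r` on and the columns up to `c`. -/
def lowerLeft {n : ℕ} (r c : Fin n) (M : Matrix (Fin n) (Fin n) ℂ) :
    Matrix {i : Fin n // r ≤ i} {j : Fin n // j ≤ c} ℂ :=
  M.submatrix Subtype.val Subtype.val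

theorem sum_eq_sum_subtype {ι : Type*} [Fintype ι] (P : ι → Prop) [DecidablePred P] {f : ι → ℂ}
    (h : ∀ k, ¬ P k → f k = 0) : ∑ k, f k = ∑ k : {k // P k}, f k := by
  have h1 : ∑ k ∈ Finset.univ.filter P, f k = ∑ k : {k // P k}, f k :=
    Finset.sum_subtype _ (by simp) _
  rw [← h1, Finset.sum_filter_of_ne]
  intro k _ hk
  by_contra hcon
  exact hk (h k hcon)

theorem rank_lowerLeft_le {n : ℕ} (r c : Fin n) {b b' : GL (Fin n) ℂ} (hb : b ∈ borel n)
    (hb' : b' ∈ borel n) (g : GL (Fin n) ℂ) :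
    (lowerLeft r c (b * g * b' : GL (Fin n) ℂ)).rank ≤
      (lowerLeft r c (g : Matrix (Fin n) (Fin n) ℂ)).rank := by
  have h1 : lowerLeft r c (b * g * b' : GL (Fin n) ℂ) =
      (b : Matrix (Fin n) (Fin n) ℂ).submatrix (Subtype.val : {i : Fin n // r ≤ i} → Fin n)
        (Subtype.val : {i : Fin n // r ≤ i} → Fin n) * lowerLeft r c g *
      (b' : Matrix (Fin n) (Fin n) ℂ).submatrix (Subtype.val : {i : Fin n // i ≤ c} → Fin n)
        (Subtype.val : {i : Fin n // i ≤ c} → Fin n) := by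
    ext i j
    rw [lowerLeft, submatrix_apply, Units.val_mul, mul_apply, mul_apply,
      sum_eq_sum_subtype fun k => k ≤ c]
    · refine Finset.sum_congr rfl fun k _ => ?_
      rw [Units.val_mul, mul_apply, mul_apply, sum_eq_sum_subtype fun k => r ≤ k]
      · rfl
      · intro l hl
        rw [mem_borel.mp hb _ _ ((not_le.mp hl).trans_le i.2), zero_mul]
    · intro l hl
      rw [mem_borel.mp hb' _ _ (j.2.trans_lt (not_le.mp hl)), mul_zero]
  rw [h1]
  exact (rank_mul_le_left _ _).trans (rank_mul_le_right _ _)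

/-- Lower-left ranks are constant on double cosets, so their minors can tell cells apart. -/
theorem rank_lowerLeft_of_mem_cell {n : ℕ} (r c : Fin n) {w : Equiv.Perm (Fin n)}
    {g : GL (Fin n) ℂ} (hg : g ∈ cell w) :
    (lowerLeft r c (g : Matrix (Fin n) (Fin n) ℂ)).rank = (lowerLeft r c (permMat w)).rank := by
  obtain ⟨b, hb, b', hb', rfl⟩ := hg
  refine le_antisymm (rank_lowerLeft_le r c hb hb' _) ?_
  have := rank_lowerLeft_le r c (inv_mem hb) (inv_mem hb') (b * permGL w * b')
  have h2 : b⁻¹ * (b * permGL w * b') * b'⁻¹ = permGL w := by group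
  rwa [h2] at this

/-- The number of pairs that a permutation leaves in order. -/
def ascents {n : ℕ} (w : Equiv.Perm (Fin n)) : Finset (Fin n × Fin n) :=
  Finset.univ.filter fun s => s.1 < s.2 ∧ w s.1 < w s.2

theorem mem_ascents {n : ℕ} {w : Equiv.Perm (Fin n)} {s : Fin n × Fin n} :
    s ∈ ascents w ↔ s.1 < s.2 ∧ w s.1 < w s.2 := by
  simp [ascents]

/-- The swap adds a single 1 to the block, at a place whose row and column in the block were zero.
The range thus gains a new basis vector. -/
theorem rank_lowerLeft_permMat_lt {n : ℕ} {w : Equiv.Perm (Fin n)} {p q : Fin n}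
    (hpq : (p : ℕ) + 1 = q) (hw : w p < w q) :
    (lowerLeft (w q) p (permMat w)).rank <
      (lowerLeft (w q) p (permMat (w * Equiv.swap p q))).rank := by
  set M := lowerLeft (w q) p (permMat w) with hM
  set M' := lowerLeft (w q) p (permMat (w * Equiv.swap p q)) with hM'
  have hlt : p < q := by rw [Fin.lt_def]; omega
  let P : {j : Fin n // j ≤ p} := ⟨p, le_rfl⟩
  let Q : {i : Fin n // w q ≤ i} := ⟨w q, le_rfl⟩
  have hrow : ∀ j, M Q j = 0 := by
    intro j
    rw [hM, lowerLeft, submatrix_apply, permMat_apply, if_neg]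
    intro h
    have := w.injective h
    exact absurd j.2 (not_le.mpr (this ▸ hlt))
  have hcol : ∀ i, M i P = 0 := by
    intro i
    rw [hM, lowerLeft, submatrix_apply, permMat_apply, if_neg]
    intro h
    exact absurd i.2 (not_le.mpr (h ▸ hw))
  have hM2 : M' = M + single Q P 1 := by
    ext i j
    rw [Matrix.add_apply, single_apply, hM', lowerLeft, submatrix_apply, permMat_apply,
      Equiv.Perm.mul_apply]
    rcases eq_or_ne j P with rfl | hj
    · rw [hcol, zero_add, Equiv.swap_apply_left]
      simp [Q, Subtype.ext_iff, eq_comm]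
    · have h1 : (j : Fin n) ≠ p := fun h => hj (Subtype.ext h)
      have h2 : (j : Fin n) ≠ q := fun h => absurd j.2 (not_le.mpr (h ▸ hlt))
      rw [Equiv.swap_apply_of_ne_of_ne h1 h2, if_neg (fun h : Q = i ∧ P = j => hj h.2.symm),
        add_zero, hM, lowerLeft, submatrix_apply, permMat_apply]
  have hrowv : ∀ v, (M *ᵥ v) Q = 0 := by
    intro v
    rw [mulVec, dotProduct]
    exact Finset.sum_eq_zero fun j _ => by rw [hrow, zero_mul]
  have hP : M *ᵥ Pi.single P 1 = 0 := by
    rw [mulVec_single_one]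
    exact funext hcol
  have hsing : ∀ v, single Q P (1 : ℂ) *ᵥ v = v P • Pi.single Q 1 := by
    intro v
    ext i
    rw [mulVec, dotProduct, Finset.sum_eq_single P]
    · rw [single_apply, Pi.smul_apply, Pi.single_apply]
      by_cases h : Q = i
      · simp [h]
      · simp [h, Ne.symm h]
    · intro j _ hj
      simp [hj.symm]
    · simp
  refine Submodule.finrank_lt_finrank_of_lt (lt_of_le_of_ne ?_ ?_)
  · rintro _ ⟨v, rfl⟩
    refine ⟨v - v P • Pi.single P 1, ?_⟩
    rw [mulVecLin_apply, mulVecLin_apply, hM2, add_mulVec, hsing, mulVec_sub, mulVec_smul, hP]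
    simp
  · intro h
    have h1 : M' *ᵥ Pi.single P 1 ∈ LinearMap.range M'.mulVecLin := ⟨_, rfl⟩
    rw [← h] at h1
    obtain ⟨v, hv⟩ := h1
    have h2 := congrFun hv Q
    rw [mulVecLin_apply, hrowv, hM2, add_mulVec, hP, hsing] at h2
    simp at h2

theorem chartVariety_subset_mul_swap {n : ℕ} {w : Equiv.Perm (Fin n)} {p q : Fin n}
    (h : p < q) (hw : w p < w q) : chartVariety w ⊆ chartVariety (w * Equiv.swap p q) :=
  fun _ hx => closure_minimal (cell_subset_closure_cell_mul_swap h hw) isClosed_closure hx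

theorem exists_mem_cell_inter_chart {n : ℕ} (w : Equiv.Perm (Fin n)) :
    ∃ x, uGL x ∈ cell w := by
  by_contra! h
  have h1 : (1 : MvPolynomial (Coord n) ℂ) ∈ localIdeal w :=
    mem_localIdeal_iff_cell.mpr fun x hx => absurd hx (h x)
  exact (localIdeal_isPrime w).ne_top ((Ideal.eq_top_iff_one _).mpr h1)

theorem localIdeal_mul_swap_lt {n : ℕ} {w : Equiv.Perm (Fin n)} {p q : Fin n}
    (hpq : (p : ℕ) + 1 = q) (hw : w p < w q) :
    localIdeal (w * Equiv.swap p q) < localIdeal w := by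
  refine lt_of_le_of_ne (fun f hf => ?_) fun heq => ?_
  · rw [mem_localIdeal] at hf ⊢
    exact fun x hx => hf x (chartVariety_subset_mul_swap (by rw [Fin.lt_def]; omega) hw hx)
  -- The inclusion is strict because of a minor: one of the size of the larger rank is nonzero at a
  -- point of the bigger cell and vanishes on the whole smaller one.
  · obtain ⟨x, hx⟩ := exists_mem_cell_inter_chart (w * Equiv.swap p q)
    have h1 := rank_lowerLeft_of_mem_cell (w q) p hx
    obtain ⟨f, g, hfg⟩ := exists_minor_ne_zero _ h1
    have h2 : ((genericUnipotent n).submatrix (fun i => (f i : Fin n)) fun i => (g i : Fin n)).det ∈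
        localIdeal w := by
      rw [mem_localIdeal_iff_cell]
      intro y hy
      rw [eval_det_submatrix]
      by_contra hcon
      have h3 := le_rank_of_minor_ne_zero (lowerLeft (w q) p (unipotent y)) f g hcon
      have h4 := rank_lowerLeft_of_mem_cell (w q) p hy
      rw [coe_uGL] at h4
      have := rank_lowerLeft_permMat_lt hpq hw
      omega
    rw [← heq, mem_localIdeal_iff_cell] at h2
    have := h2 x hx
    rw [eval_det_submatrix] at this
    exact hfg this

theorem swap_lt_swap_iff {n : ℕ} {p q a b : Fin n} (hpq : (p : ℕ) + 1 = q)
    (h1 : ¬(a = p ∧ b = q)) (h2 : ¬(a = q ∧ b = p)) :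
    Equiv.swap p q a < Equiv.swap p q b ↔ a < b := by
  simp only [Equiv.swap_apply_def, Fin.ext_iff] at *
  simp only [Fin.lt_def]
  split_ifs <;> omega

theorem card_ascents_mul_swap {n : ℕ} {w : Equiv.Perm (Fin n)} {p q : Fin n}
    (hpq : (p : ℕ) + 1 = q) (hw : w p < w q) :
    (ascents (w * Equiv.swap p q)).card + 1 = (ascents w).card := by
  have hlt : p < q := by rw [Fin.lt_def]; omega
  have hinj : Function.Injective (Prod.map (Equiv.swap p q) (Equiv.swap p q)) :=
    (Equiv.swap p q).injective.prodMap (Equiv.swap p q).injective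
  have hS : ascents w = insert (p, q)
      ((ascents (w * Equiv.swap p q)).image (Prod.map (Equiv.swap p q) (Equiv.swap p q))) := by
    ext ⟨a, b⟩
    simp only [mem_ascents, Finset.mem_insert, Finset.mem_image, Prod.mk.injEq,
      Equiv.Perm.mul_apply]
    have h : (∃ s : Fin n × Fin n, (s.1 < s.2 ∧ w (Equiv.swap p q s.1) < w (Equiv.swap p q s.2)) ∧
        Prod.map (Equiv.swap p q) (Equiv.swap p q) s = (a, b)) ↔
        Equiv.swap p q a < Equiv.swap p q b ∧ w a < w b := by
      constructor
      · rintro ⟨⟨c, d⟩, ⟨h1, h2⟩, h3⟩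
        simp only [Prod.map_apply, Prod.mk.injEq] at h3
        obtain ⟨rfl, rfl⟩ := h3
        simpa using ⟨h1, h2⟩
      · rintro ⟨h1, h2⟩
        exact ⟨(Equiv.swap p q a, Equiv.swap p q b), by simpa using ⟨h1, h2⟩, by simp⟩
    rw [h]
    by_cases h1 : a = p ∧ b = q
    · obtain ⟨rfl, rfl⟩ := h1
      simp [hlt, hw]
    · by_cases h2 : a = q ∧ b = p
      · obtain ⟨rfl, rfl⟩ := h2
        simp [hw.le, hlt.ne']
      · rw [swap_lt_swap_iff hpq h1 h2]
        simp [h1]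
  rw [hS, Finset.card_insert_of_notMem, Finset.card_image_of_injective _ hinj]
  simp only [Finset.mem_image, not_exists, not_and]
  rintro ⟨a, b⟩ hab h
  simp only [Prod.map_apply, Prod.mk.injEq] at h
  rw [mem_ascents] at hab
  simp only [Equiv.Perm.mul_apply, h] at hab
  have ha : a = q := by
    have := congrArg (Equiv.swap p q) h.1
    simpa using this
  have hb : b = p := by
    have := congrArg (Equiv.swap p q) h.2
    simpa using this
  rw [ha, hb] at hab
  exact lt_asymm hab.1 hlt

theorem exists_adjacent_lt {n : ℕ} (f : Fin n → ℤ) {p q : Fin n} (h : p < q) (hf : f p < f q) :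
    ∃ a b : Fin n, (a : ℕ) + 1 = b ∧ f a < f b := by
  obtain ⟨k, hk⟩ : ∃ k : ℕ, (q : ℕ) - p = k := ⟨_, rfl⟩
  induction k using Nat.strong_induction_on generalizing p q with
  | _ k ih =>
    have h' := Fin.lt_def.mp h
    by_cases h1 : (p : ℕ) + 1 = q
    · exact ⟨p, q, h1, hf⟩
    · let r : Fin n := ⟨p + 1, by omega⟩
      have hr : (r : ℕ) = p + 1 := rfl
      rcases lt_or_ge (f p) (f r) with h2 | h2
      · exact ⟨p, r, rfl, h2⟩
      · exact ih (q - r) (by omega) (p := r) (q := q) (by rw [Fin.lt_def]; omega) (by omega) rfl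

theorem exists_adjacent_ascent {n : ℕ} {w : Equiv.Perm (Fin n)} (h : (ascents w).card ≠ 0) :
    ∃ p q : Fin n, (p : ℕ) + 1 = q ∧ w p < w q := by
  obtain ⟨⟨p, q⟩, hpq⟩ := Finset.card_pos.mp (Nat.pos_of_ne_zero h)
  rw [mem_ascents] at hpq
  obtain ⟨a, b, hab, hw⟩ := exists_adjacent_lt (fun i => ((w i : ℕ) : ℤ)) hpq.1
    (by have := Fin.lt_def.mp hpq.2; simpa using this)
  exact ⟨a, b, hab, by simpa using hw⟩

theorem exists_adjacent_descent {n : ℕ} {w : Equiv.Perm (Fin n)} (h : w ≠ 1) :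
    ∃ p q : Fin n, (p : ℕ) + 1 = q ∧ w q < w p := by
  have h1 : ∃ p q, p < q ∧ w q < w p := by
    by_contra! hcon
    exact h (eq_one_of_no_inversion fun p q hpq =>
      lt_of_le_of_ne (hcon p q hpq) (w.injective.ne hpq.ne))
  obtain ⟨p, q, hpq, hw⟩ := h1
  obtain ⟨a, b, hab, hw⟩ := exists_adjacent_lt (fun i => -((w i : ℕ) : ℤ)) hpq
    (by have := Fin.lt_def.mp hw; simpa using this)
  exact ⟨a, b, hab, by simpa using hw⟩

theorem card_ascents_one (n : ℕ) :
    (ascents (1 : Equiv.Perm (Fin n))).card = Fintype.card (Coord n) := by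
  rw [Fintype.card_subtype]
  refine Finset.card_bij (fun s _ => s.swap) ?_ ?_ ?_
  · simp [ascents]
  · rintro ⟨a, b⟩ - ⟨c, d⟩ - h
    simpa [and_comm] using h
  · rintro ⟨a, b⟩ h
    exact ⟨(b, a), by simpa [ascents] using h, rfl⟩

/-- Removing adjacent ascents one at a time yields a strictly descending chain of prime ideals of
that length. -/
theorem card_ascents_le_codim {n : ℕ} (w : Equiv.Perm (Fin n)) :
    ((ascents w).card : ℕ∞) ≤ codim w := by
  obtain ⟨k, hk⟩ : ∃ k, (ascents w).card = k := ⟨_, rfl⟩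
  induction k generalizing w with
  | zero => simp [hk]
  | succ k ih =>
    obtain ⟨p, q, hpq, hw⟩ := exists_adjacent_ascent (w := w) (by omega)
    have h1 := card_ascents_mul_swap hpq hw
    have h2 := ih (w * Equiv.swap p q) (by omega)
    rw [← h1]
    push_cast
    exact (add_le_add_left h2 1).trans
      (Ideal.height_add_one_le_of_lt_of_isPrime (localIdeal_mul_swap_lt hpq hw))

/-- The complementary chain runs up to the ideal of the identity, whose height is at most the
dimension of the chart. The two chains together leave no slack. -/
theorem codim_le_card_ascents {n : ℕ} (w : Equiv.Perm (Fin n)) :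
    codim w ≤ ((ascents w).card : ℕ∞) := by
  obtain ⟨k, hk⟩ : ∃ k, Fintype.card (Coord n) - (ascents w).card = k := ⟨_, rfl⟩
  induction k using Nat.strong_induction_on generalizing w with
  | _ k ih =>
    by_cases hw : w = 1
    · subst hw
      rw [card_ascents_one]
      have h1 := Ideal.height_le_ringKrullDim_of_isPrime (I := localIdeal (1 : Equiv.Perm (Fin n)))
      rw [MvPolynomial.ringKrullDim_of_isNoetherianRing, ringKrullDim_eq_zero_of_field, zero_add,
        Nat.card_eq_fintype_card] at h1
      exact_mod_cast h1
    · obtain ⟨p, q, hpq, hpq'⟩ := exists_adjacent_descent hw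
      have h0 : (w * Equiv.swap p q) p < (w * Equiv.swap p q) q := by simpa using hpq'
      have h1 := card_ascents_mul_swap hpq h0
      have h2 := localIdeal_mul_swap_lt hpq h0
      rw [mul_assoc, Equiv.swap_mul_self, mul_one] at h1 h2
      have hle : (ascents (w * Equiv.swap p q)).card ≤ Fintype.card (Coord n) := by
        rw [← card_ascents_one]
        refine Finset.card_le_card fun s hs => ?_
        rw [mem_ascents] at hs ⊢
        exact ⟨hs.1, hs.1⟩
      have h3 := ih _ (by omega) (w * Equiv.swap p q) rfl
      have h4 := (Ideal.height_add_one_le_of_lt_of_isPrime h2).trans h3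
      rw [← h1] at h4
      push_cast at h4
      exact (ENat.add_le_add_iff_right ENat.one_ne_top).mp h4

theorem codim_eq_card_ascents {n : ℕ} (w : Equiv.Perm (Fin n)) :
    codim w = (ascents w).card :=
  le_antisymm (codim_le_card_ascents w) (card_ascents_le_codim w)

end SchubertTangent

end

/-! ### Codimension two: the permutations and their rank conditions -/

noncomputable section

namespace SchubertTangent

open Matrix Topology Filter

/-- The transposition of the `i`-th and the `(i + 1)`-st element, counted from one. -/
def simple (n i : ℕ) : Equiv.Perm (Fin n) :=
  if h : 0 < i ∧ i < n then Equiv.swap ⟨i - 1, by omega⟩ ⟨i, h.2⟩ else 1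

theorem val_simple {n i : ℕ} (h0 : 0 < i) (hn : i < n) (j : Fin n) :
    (simple n i j : ℕ) = if (j : ℕ) + 1 = i then i else if (j : ℕ) = i then i - 1 else j := by
  rw [simple, dif_pos ⟨h0, hn⟩, Equiv.swap_apply_def]
  simp only [Fin.ext_iff]
  split_ifs <;> first | rfl | omega

/-- The permutation `w₀ s_i s_k`. -/
def tau (n i k : ℕ) : Equiv.Perm (Fin n) := Fin.revPerm * simple n i * simple n k

theorem val_tau {n : ℕ} (i k : ℕ) (j : Fin n) :
    (tau n i k j : ℕ) = n - 1 - (simple n i (simple n k j) : ℕ) := by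
  simp only [tau, Equiv.Perm.mul_apply, Fin.revPerm_apply, Fin.val_rev]
  omega

theorem simple_mul_self (n i : ℕ) : simple n i * simple n i = 1 := by
  rw [simple]
  split_ifs <;> simp

theorem simple_inv (n i : ℕ) : (simple n i)⁻¹ = simple n i :=
  inv_eq_of_mul_eq_one_left (simple_mul_self n i)

theorem tau_comm {n i k : ℕ} (hi : 0 < i) (hi' : i < n) (hk : 0 < k) (hk' : k < n)
    (h : i + 2 ≤ k) : tau n i k = tau n k i := by
  rw [tau, tau, mul_assoc, mul_assoc]
  congr 1
  ext j
  simp only [Equiv.Perm.mul_apply, val_simple hi hi', val_simple hk hk']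
  split_ifs <;> omega

theorem rev_mul_simple_mul_rev {n i : ℕ} (hi : 0 < i) (hi' : i < n) :
    Fin.revPerm * simple n i * Fin.revPerm = simple n (n - i) := by
  ext j
  simp only [Equiv.Perm.mul_apply, Fin.revPerm_apply, Fin.val_rev, val_simple hi hi',
    val_simple (show 0 < n - i by omega) (show n - i < n by omega)]
  have := j.2
  split_ifs <;> omega

theorem revPerm_mul_self (n : ℕ) : (Fin.revPerm : Equiv.Perm (Fin n)) * Fin.revPerm = 1 := by
  ext j
  simp

theorem revPerm_inv (n : ℕ) : (Fin.revPerm : Equiv.Perm (Fin n))⁻¹ = Fin.revPerm :=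
  inv_eq_of_mul_eq_one_left (revPerm_mul_self n)

theorem tau_inv {n i k : ℕ} (hi : 0 < i) (hi' : i < n) (hk : 0 < k) (hk' : k < n) :
    (tau n i k)⁻¹ = tau n (n - k) (n - i) := by
  rw [tau, tau, ← rev_mul_simple_mul_rev hi hi', ← rev_mul_simple_mul_rev hk hk', _root_.mul_inv_rev,
    _root_.mul_inv_rev, simple_inv, simple_inv, revPerm_inv]
  simp only [← mul_assoc, revPerm_mul_self, one_mul]
  rw [mul_assoc (simple n k) Fin.revPerm, revPerm_mul_self, mul_one]

theorem eq_revPerm_of_ascents_eq_empty {n : ℕ} {w : Equiv.Perm (Fin n)}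
    (h : (ascents w).card = 0) : w = Fin.revPerm := by
  have h1 : Fin.revPerm * w = 1 := by
    refine eq_one_of_no_inversion fun p q hpq => ?_
    rw [Equiv.Perm.mul_apply, Equiv.Perm.mul_apply, Fin.revPerm_apply, Fin.revPerm_apply,
      Fin.rev_lt_rev]
    by_contra hcon
    have h2 : (p, q) ∈ ascents w :=
      mem_ascents.mpr ⟨hpq, lt_of_le_of_ne (not_lt.mp hcon) (w.injective.ne hpq.ne)⟩
    rw [Finset.card_eq_zero] at h
    simp [h] at h2
  rw [← revPerm_inv]
  exact eq_inv_of_mul_eq_one_right h1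

theorem card_ascents_revPerm (n : ℕ) : (ascents (Fin.revPerm : Equiv.Perm (Fin n))).card = 0 := by
  rw [Finset.card_eq_zero, Finset.eq_empty_iff_forall_notMem]
  intro s hs
  rw [mem_ascents] at hs
  exact lt_asymm hs.1 (Fin.rev_lt_rev.mp hs.2)

theorem card_ascents_mul_simple {n k : ℕ} {w : Equiv.Perm (Fin n)} (hk : 0 < k) (hk' : k < n)
    (hw : w ⟨k, hk'⟩ < w ⟨k - 1, by omega⟩) :
    (ascents (w * simple n k)).card = (ascents w).card + 1 := by
  have h : simple n k = Equiv.swap ⟨k - 1, by omega⟩ ⟨k, hk'⟩ := dif_pos ⟨hk, hk'⟩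
  rw [h]
  have h1 := card_ascents_mul_swap (w := w * Equiv.swap ⟨k - 1, by omega⟩ ⟨k, hk'⟩)
    (p := ⟨k - 1, by omega⟩) (q := ⟨k, hk'⟩) (by simp only; omega) (by simpa)
  rw [mul_assoc, Equiv.swap_mul_self, mul_one] at h1
  exact h1.symm

theorem exists_eq_mul_simple {n : ℕ} {w : Equiv.Perm (Fin n)} (h : (ascents w).card ≠ 0) :
    ∃ k v, 0 < k ∧ k < n ∧ w = v * simple n k ∧ (ascents v).card + 1 = (ascents w).card := by
  obtain ⟨p, q, hpq, hw⟩ := exists_adjacent_ascent h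
  have h1 : simple n q = Equiv.swap p q := by
    rw [simple, dif_pos ⟨by omega, q.2⟩]
    congr 1
    exact Fin.ext (by simp only; omega)
  refine ⟨q, w * Equiv.swap p q, by omega, q.2, ?_, card_ascents_mul_swap hpq hw⟩
  rw [h1, mul_assoc, Equiv.swap_mul_self, mul_one]

theorem card_ascents_tau {n i k : ℕ} (hi : 0 < i) (hi' : i < n) (hk : 0 < k) (hk' : k < n)
    (h : i ≠ k) : (ascents (tau n i k)).card = 2 := by
  rw [tau, card_ascents_mul_simple hk hk', card_ascents_mul_simple hi hi', card_ascents_revPerm]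
  · rw [Fin.revPerm_apply, Fin.revPerm_apply, Fin.rev_lt_rev, Fin.lt_def]
    simp only
    omega
  · rw [Equiv.Perm.mul_apply, Equiv.Perm.mul_apply, Fin.revPerm_apply, Fin.revPerm_apply,
      Fin.rev_lt_rev, Fin.lt_def, val_simple hi hi', val_simple hi hi']
    simp only
    split_ifs <;> omega

theorem eq_of_card_ascents_le_two {n : ℕ} {w : Equiv.Perm (Fin n)} (h : (ascents w).card ≤ 2) :
    w = Fin.revPerm ∨ (∃ k, 0 < k ∧ k < n ∧ w = Fin.revPerm * simple n k) ∨
      ∃ i k, 0 < i ∧ i < n ∧ 0 < k ∧ k < n ∧ i ≠ k ∧ w = tau n i k := by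
  by_cases h0 : (ascents w).card = 0
  · exact Or.inl (eq_revPerm_of_ascents_eq_empty h0)
  obtain ⟨k, v, hk, hk', rfl, hv⟩ := exists_eq_mul_simple h0
  by_cases h1 : (ascents v).card = 0
  · rw [eq_revPerm_of_ascents_eq_empty h1]
    exact Or.inr (Or.inl ⟨k, hk, hk', rfl⟩)
  obtain ⟨i, u, hi, hi', rfl, hu⟩ := exists_eq_mul_simple h1
  have h2 : u = Fin.revPerm := eq_revPerm_of_ascents_eq_empty (by omega)
  subst h2
  refine Or.inr (Or.inr ⟨i, k, hi, hi', hk, hk', ?_, rfl⟩)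
  rintro rfl
  rw [mul_assoc, simple_mul_self, mul_one, card_ascents_revPerm] at hv
  omega

theorem codim_eq_two_iff {n : ℕ} {w : Equiv.Perm (Fin n)} :
    codim w = 2 ↔ ∃ i k, 0 < i ∧ i < n ∧ 0 < k ∧ k < n ∧ i ≠ k ∧ w = tau n i k := by
  rw [codim_eq_card_ascents]
  constructor
  · intro h
    have h' : (ascents w).card = 2 := by exact_mod_cast h
    rcases eq_of_card_ascents_le_two h'.le with rfl | ⟨k, hk, hk', rfl⟩ | h1
    · rw [card_ascents_revPerm] at h'
      omega
    · rw [card_ascents_mul_simple hk hk', card_ascents_revPerm] at h'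
      · omega
      · rw [Fin.revPerm_apply, Fin.revPerm_apply, Fin.rev_lt_rev, Fin.lt_def]
        simp only
        omega
    · exact h1
  · rintro ⟨i, k, hi, hi', hk, hk', hne, rfl⟩
    rw [card_ascents_tau hi hi' hk hk' hne]
    rfl

/-- The condition on `w` for `Meets c e` to hold on the double coset of `w`. -/
def PermMeets {n : ℕ} (c e : ℕ) (w : Equiv.Perm (Fin n)) : Prop :=
  ∃ j : Fin n, (j : ℕ) < c ∧ (w j : ℕ) < e

open Classical in
/-- The ascents of `w` whose removal destroys `PermMeets c e`. -/
def essential {n : ℕ} (c e : ℕ) (w : Equiv.Perm (Fin n)) : Finset (Fin n × Fin n) :=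
  (ascents w).filter fun s => ¬ PermMeets c e (w * Equiv.swap s.1 s.2)

/-- Removing an ascent can destroy the condition only if its lower position is the sole witness and
the other end lies outside in both position and value. -/
theorem essential_spec {n c e : ℕ} {w : Equiv.Perm (Fin n)} (h : PermMeets c e w)
    {p q : Fin n} (hpq : (p, q) ∈ essential c e w) :
    (∀ j : Fin n, (j : ℕ) < c → ((w j : ℕ) < e ↔ j = p)) ∧ (p : ℕ) < c ∧ c ≤ q ∧ e ≤ w q := by
  simp only [essential, Finset.mem_filter, mem_ascents, PermMeets, not_exists, not_and,
    not_lt] at hpq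
  obtain ⟨⟨hlt, hw⟩, hess⟩ := hpq
  rw [Fin.lt_def] at hlt hw
  have h1 : ∀ j : Fin n, (j : ℕ) < c → (w j : ℕ) < e → j = p := by
    intro j hj hwj
    by_contra hjp
    by_cases hjq : j = q
    · subst hjq
      have := hess p (by omega)
      rw [Equiv.Perm.mul_apply, Equiv.swap_apply_left] at this
      omega
    · have := hess j hj
      rw [Equiv.Perm.mul_apply, Equiv.swap_apply_of_ne_of_ne hjp hjq] at this
      omega
  obtain ⟨j, hj, hwj⟩ := h
  obtain rfl := h1 j hj hwj
  refine ⟨fun i hi => ⟨h1 i hi, fun h => h ▸ hwj⟩, hj, ?_, ?_⟩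
  · by_contra hcon
    have := hess q (by omega)
    rw [Equiv.Perm.mul_apply, Equiv.swap_apply_right] at this
    omega
  · have := hess j hj
    rwa [Equiv.Perm.mul_apply, Equiv.swap_apply_left] at this

theorem card_filter_val_lt {n c : ℕ} (hc : c ≤ n) :
    (Finset.univ.filter fun j : Fin n => (j : ℕ) < c).card = c := by
  rw [Fin.card_filter_val_lt]
  omega

/-- All essential ascents share their first position `p`, the unique witness. Their second positions
carry one of the `n - e` values that are at least `e`, and `c - 1` of these values are used up at
the positions below `c` other than `p`. -/
theorem card_essential {n c e : ℕ} (hc : c ≤ n) (he : e ≤ n) (hce : c + e ≤ n + 1)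
    {w : Equiv.Perm (Fin n)} (h : PermMeets c e w) :
    (essential c e w).card + c + e ≤ n + 1 := by
  rcases Finset.eq_empty_or_nonempty (essential c e w) with h0 | ⟨⟨p, q⟩, hpq⟩
  · rw [h0, Finset.card_empty]
    omega
  obtain ⟨hp, hpc, -, -⟩ := essential_spec h hpq
  have hsub : essential c e w ⊆
      {p} ×ˢ Finset.univ.filter fun j : Fin n => ¬ (w j : ℕ) < e ∧ ¬ (j : ℕ) < c := by
    rintro ⟨a, b⟩ hab
    obtain ⟨ha, hac, hb, hb'⟩ := essential_spec h hab
    have hap : a = p := (hp a hac).mp ((ha a hac).mpr rfl)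
    simp only [Finset.mem_product, Finset.mem_singleton, Finset.mem_filter, Finset.mem_univ,
      true_and, not_lt]
    exact ⟨hap, hb', hb⟩
  have h1 := Finset.card_le_card hsub
  rw [Finset.card_product, Finset.card_singleton, one_mul] at h1
  have h2 : (Finset.univ.filter fun j : Fin n => (w j : ℕ) < e).card = e := by
    refine Eq.trans ?_ (card_filter_val_lt he)
    refine Finset.card_bij (fun j _ => w j) ?_ (fun a _ b _ hab => w.injective hab) ?_
    · simp
    · intro b hb
      exact ⟨w⁻¹ b, by simpa using hb, by simp⟩
  have h3 := Finset.card_filter_add_card_filter_not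
    (s := (Finset.univ : Finset (Fin n))) fun j => (w j : ℕ) < e
  have h4 := Finset.card_filter_add_card_filter_not
    (s := Finset.univ.filter fun j : Fin n => ¬ (w j : ℕ) < e) fun j => (j : ℕ) < c
  rw [Finset.filter_filter, Finset.filter_filter] at h4
  have h5 : (Finset.univ.filter fun j : Fin n => ¬ (w j : ℕ) < e ∧ (j : ℕ) < c) =
      (Finset.univ.filter fun j : Fin n => (j : ℕ) < c).erase p := by
    ext j
    simp only [Finset.mem_filter, Finset.mem_univ, true_and, Finset.mem_erase]
    constructor
    · rintro ⟨h1, h2⟩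
      exact ⟨fun h => h1 ((hp j h2).mpr h), h2⟩
    · rintro ⟨h1, h2⟩
      exact ⟨fun h => h1 ((hp j h2).mp h), h2⟩
  have h6 : ((Finset.univ.filter fun j : Fin n => (j : ℕ) < c).erase p).card = c - 1 := by
    rw [Finset.card_erase_of_mem (by simpa using hpc), card_filter_val_lt hc]
  rw [Finset.card_univ, Fintype.card_fin] at h3
  rw [h5, h6] at h4
  omega

/-- Moving up in the Bruhat order within a set of permutations towards its unique element with at
most two ascents. -/
theorem cell_subset_closure_of_step {n : ℕ} {Q : Equiv.Perm (Fin n) → Prop}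
    {w₀ : Equiv.Perm (Fin n)} (hbase : ∀ w, Q w → (ascents w).card ≤ 2 → w = w₀)
    (hstep : ∀ w, Q w → 2 < (ascents w).card →
      ∃ p q, p < q ∧ w p < w q ∧ Q (w * Equiv.swap p q))
    (w : Equiv.Perm (Fin n)) (hw : Q w) : cell w ⊆ closure (cell w₀) := by
  obtain ⟨k, hk⟩ : ∃ k, (weight w).toNat = k := ⟨_, rfl⟩
  induction k using Nat.strong_induction_on generalizing w with
  | _ k ih =>
    by_cases h : (ascents w).card ≤ 2
    · rw [hbase w hw h]
      exact subset_closure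
    · obtain ⟨p, q, hpq, hlt, hQ⟩ := hstep w hw (by omega)
      have h1 := mul_swap_lt_weight hpq hlt
      have h2 := weight_nonneg (w * Equiv.swap p q)
      have h3 := ih _ (by omega) _ hQ rfl
      exact (cell_subset_closure_cell_mul_swap hpq hlt).trans
        (closure_minimal h3 isClosed_closure)

theorem permMeets_tau {n i k c : ℕ} (hi : 0 < i) (hi' : i < n) (hk : 0 < k) (hk' : k < n)
    (hik : i ≠ k) (hc : 0 < c) (hc' : c < n) :
    PermMeets c (n - c) (tau n i k) ↔ c = i ∨ c = k := by
  constructor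
  · rintro ⟨j, hj, hw⟩
    rw [val_tau, val_simple hi hi', val_simple hk hk'] at hw
    split_ifs at hw <;> omega
  · rintro (rfl | rfl)
    -- The usual witness is the zero-based position `c - 1`. If `k + 1 = c`, then `s_k` exchanges it
    -- with `c - 2`, so the witness shifts.
    · by_cases h : k + 1 = c
      · refine ⟨⟨c - 2, by omega⟩, by simp only; omega, ?_⟩
        rw [val_tau, val_simple hi hi', val_simple hk hk']
        simp only
        split_ifs <;> omega
      · refine ⟨⟨c - 1, by omega⟩, by simp only; omega, ?_⟩
        rw [val_tau, val_simple hi hi', val_simple hk hk']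
        simp only
        split_ifs <;> omega
    · refine ⟨⟨c - 1, by omega⟩, by simp only; omega, ?_⟩
      rw [val_tau, val_simple hi hi', val_simple hk hk']
      simp only
      split_ifs <;> omega

theorem permMeets_simple {n k c : ℕ} (hk : 0 < k) (hk' : k < n) {e : ℕ} (he : c + e ≤ n)
    (h : PermMeets c e (Fin.revPerm * simple n k)) : c = k ∧ e = n - c := by
  obtain ⟨j, hj, hw⟩ := h
  rw [Equiv.Perm.mul_apply, Fin.revPerm_apply, Fin.val_rev, val_simple hk hk'] at hw
  split_ifs at hw <;> omega

theorem not_permMeets_revPerm {n c e : ℕ} (he : c + e ≤ n) :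
    ¬ PermMeets c e (Fin.revPerm : Equiv.Perm (Fin n)) := by
  rintro ⟨j, hj, hw⟩
  rw [Fin.revPerm_apply, Fin.val_rev] at hw
  omega

/-- Each of the two conditions has at most one essential ascent, since `c + e = n`. With more than
two ascents one can be removed while both conditions persist, and `tau n i k` is the only
permutation with at most two ascents that satisfies both. -/
theorem mem_closure_cell_tau {n i k : ℕ} (hi : 0 < i) (hk : k < n) (hik : i + 2 ≤ k)
    {g : GL (Fin n) ℂ} (h1 : Meets i (n - i) g) (h2 : Meets k (n - k) g) :
    g ∈ closure (cell (tau n i k)) := by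
  obtain ⟨u, hu⟩ := exists_mem_cell g
  refine cell_subset_closure_of_step (Q := fun w => PermMeets i (n - i) w ∧ PermMeets k (n - k) w)
    ?_ ?_ u ⟨(meets_of_mem_cell hu).mp h1, (meets_of_mem_cell hu).mp h2⟩ hu
  · rintro w ⟨hw1, hw2⟩ hcard
    rcases eq_of_card_ascents_le_two hcard with rfl | ⟨d, hd, hd', rfl⟩ |
      ⟨c, d, hc, hc', hd, hd', hcd, rfl⟩
    · exact absurd hw1 (not_permMeets_revPerm (by omega))
    · have := permMeets_simple hd hd' (by omega) hw1
      have := permMeets_simple hd hd' (by omega) hw2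
      omega
    · rw [permMeets_tau hc hc' hd hd' hcd (by omega) (by omega)] at hw1 hw2
      by_cases h : i = c
      · obtain rfl : k = d := by omega
        rw [h]
      · obtain rfl : i = d := by omega
        obtain rfl : k = c := by omega
        exact (tau_comm (by omega) (by omega) (by omega) (by omega) hik).symm
  · rintro w ⟨hw1, hw2⟩ hcard
    have h1 := card_essential (by omega) (by omega) (by omega) hw1
    have h2 := card_essential (by omega) (by omega) (by omega) hw2
    have h3 := Finset.card_union_le (essential i (n - i) w) (essential k (n - k) w)
    obtain ⟨⟨p, q⟩, hpq, hne⟩ := Finset.exists_mem_notMem_of_card_lt_card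
      (s := essential i (n - i) w ∪ essential k (n - k) w) (t := ascents w) (by omega)
    simp only [essential, Finset.mem_union, Finset.mem_filter, hpq, true_and, not_or,
      not_not] at hne
    rw [mem_ascents] at hpq
    exact ⟨p, q, hpq.1, hpq.2, hne⟩

/-- Here `c + e = n - 1`, so the single condition has at most two essential ascents and the same
climb works. -/
theorem mem_closure_cell_tau_succ {n a : ℕ} (ha : 0 < a) (ha' : a + 1 < n)
    {g : GL (Fin n) ℂ} (h : Meets a (n - (a + 1)) g) :
    g ∈ closure (cell (tau n (a + 1) a)) := by
  obtain ⟨u, hu⟩ := exists_mem_cell g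
  refine cell_subset_closure_of_step (Q := fun w => PermMeets a (n - (a + 1)) w)
    ?_ ?_ u ((meets_of_mem_cell hu).mp h) hu
  · rintro w hw hcard
    rcases eq_of_card_ascents_le_two hcard with rfl | ⟨d, hd, hd', rfl⟩ |
      ⟨c, d, hc, hc', hd, hd', hcd, rfl⟩
    · exact absurd hw (not_permMeets_revPerm (by omega))
    · have := permMeets_simple hd hd' (by omega) hw
      omega
    · obtain ⟨j, hj, hw⟩ := hw
      rw [val_tau, val_simple hc hc', val_simple hd hd'] at hw
      have : c = a + 1 ∧ d = a := by split_ifs at hw <;> omega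
      rw [this.1, this.2]
  · rintro w hw hcard
    have h1 := card_essential (by omega) (by omega) (by omega) hw
    obtain ⟨⟨p, q⟩, hpq, hne⟩ := Finset.exists_mem_notMem_of_card_lt_card
      (s := essential a (n - (a + 1)) w) (t := ascents w) (by omega)
    simp only [essential, Finset.mem_filter, hpq, true_and, not_not] at hne
    rw [mem_ascents] at hpq
    exact ⟨p, q, hpq.1, hpq.2, hne⟩

/-- Expressing the condition by maximal minors makes it polynomial, so that it passes to closures
and to tangent cones. -/
theorem not_meets_iff {n r c : ℕ} (hr : r ≤ n) (hc : c ≤ n) {g : GL (Fin n) ℂ} :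
    ¬ Meets c (n - r) g ↔ ∃ f : Fin c → Fin r,
      ((corner hr hc (g : Matrix (Fin n) (Fin n) ℂ)).submatrix f id).det ≠ 0 := by
  rw [meets_iff_corner hr hc]
  set A := corner hr hc (g : Matrix (Fin n) (Fin n) ℂ)
  constructor
  · intro h
    push Not at h
    have hinj : Function.Injective A.mulVecLin := by
      rw [← LinearMap.ker_eq_bot, LinearMap.ker_eq_bot']
      intro v hv
      by_contra hne
      exact h v hne hv
    have hrank : A.rank = c := by
      rw [rank, LinearMap.finrank_range_of_inj hinj, Module.finrank_fin_fun]
    obtain ⟨f, hf⟩ := exists_linearIndependent_rows A hrank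
    have h2 := (linearIndependent_rows_iff_isUnit.mp hf)
    rw [isUnit_iff_isUnit_det] at h2
    exact ⟨f, h2.ne_zero⟩
  · rintro ⟨f, hf⟩ ⟨v, hv, h⟩
    refine hf (exists_mulVec_eq_zero_iff.mp ⟨v, hv, ?_⟩)
    exact funext fun i => congrFun h (f i)

/-- The minor of the generic unipotent matrix in the first `c` columns and in rows chosen among
the last `r`. -/
def columnMinor {n r c : ℕ} (hr : r ≤ n) (hc : c ≤ n) (f : Fin c → Fin r) :
    MvPolynomial (Coord n) ℂ :=
  ((corner hr hc (genericUnipotent n)).submatrix f id).det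

theorem eval_columnMinor {n r c : ℕ} (hr : r ≤ n) (hc : c ≤ n) (f : Fin c → Fin r)
    (x : Coord n → ℂ) : MvPolynomial.eval x (columnMinor hr hc f) =
      ((corner hr hc (unipotent x)).submatrix f id).det := by
  rw [columnMinor, RingHom.map_det, ← genericUnipotent_map]
  rfl

theorem columnMinor_mem_localIdeal {n r c : ℕ} (hr : r ≤ n) (hc : c ≤ n) (f : Fin c → Fin r)
    {w : Equiv.Perm (Fin n)} (hw : PermMeets c (n - r) w) :
    columnMinor hr hc f ∈ localIdeal w := by
  rw [mem_localIdeal_iff_cell]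
  intro x hx
  rw [eval_columnMinor]
  by_contra h
  exact (not_meets_iff hr hc (g := uGL x)).mpr ⟨f, h⟩ ((meets_of_mem_cell hx).mpr hw)

theorem meets_of_mem_chartVariety {n r c : ℕ} (hr : r ≤ n) (hc : c ≤ n)
    {w : Equiv.Perm (Fin n)} (hw : PermMeets c (n - r) w) {x : Coord n → ℂ}
    (hx : x ∈ chartVariety w) : Meets c (n - r) (uGL x) := by
  by_contra h
  obtain ⟨f, hf⟩ := (not_meets_iff hr hc).mp h
  have := mem_localIdeal.mp (columnMinor_mem_localIdeal hr hc f hw) x hx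
  rw [eval_columnMinor] at this
  exact hf this

theorem mem_chartVariety_tau {n i k : ℕ} (hi : 0 < i) (hk : k < n) (hik : i + 2 ≤ k)
    {x : Coord n → ℂ} : x ∈ chartVariety (tau n i k) ↔
      Meets i (n - i) (uGL x) ∧ Meets k (n - k) (uGL x) := by
  have h : ∀ c, 0 < c → c < n → (PermMeets c (n - c) (tau n i k) ↔ c = i ∨ c = k) := fun c =>
    permMeets_tau hi (by omega) (by omega) hk (by omega)
  refine ⟨fun hx => ⟨?_, ?_⟩, fun hx => mem_closure_cell_tau hi hk hik hx.1 hx.2⟩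
  · exact meets_of_mem_chartVariety (by omega) (by omega)
      ((h i hi (by omega)).mpr (Or.inl rfl)) hx
  · exact meets_of_mem_chartVariety (by omega) (by omega)
      ((h k (by omega) hk).mpr (Or.inr rfl)) hx

theorem permMeets_tau_succ {n a : ℕ} (ha : 0 < a) (ha' : a + 1 < n) :
    PermMeets a (n - (a + 1)) (tau n (a + 1) a) := by
  refine ⟨⟨a - 1, by omega⟩, by simp only; omega, ?_⟩
  rw [val_tau, val_simple (by omega) (by omega), val_simple (by omega) (by omega)]
  simp only
  split_ifs <;> omega

theorem not_permMeets_tau_succ {n a : ℕ} (ha : 0 < a) (ha' : a + 1 < n) :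
    ¬ PermMeets a (n - (a + 1)) (tau n a (a + 1)) := by
  rintro ⟨j, hj, hw⟩
  rw [val_tau, val_simple (by omega) (by omega), val_simple (by omega) (by omega)] at hw
  split_ifs at hw <;> omega

theorem mem_chartVariety_tau_succ {n a : ℕ} (ha : 0 < a) (ha' : a + 1 < n)
    {x : Coord n → ℂ} : x ∈ chartVariety (tau n (a + 1) a) ↔ Meets a (n - (a + 1)) (uGL x) :=
  ⟨meets_of_mem_chartVariety (by omega) (by omega) (permMeets_tau_succ ha ha'),
    mem_closure_cell_tau_succ ha ha'⟩

end SchubertTangent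

end

/-! ### Tangent cones: limits, functoriality and the two symmetries -/

noncomputable section

namespace SchubertTangent

open Matrix Topology Filter MvPolynomial

theorem eval_smul_of_isHomogeneous {σ : Type*} {p : MvPolynomial σ ℂ} {d : ℕ}
    (hp : p.IsHomogeneous d) (t : ℂ) (y : σ → ℂ) : eval (t • y) p = t ^ d * eval y p := by
  rw [eval_eq, eval_eq, Finset.mul_sum]
  refine Finset.sum_congr rfl fun m hm => ?_
  rw [hp.degree_eq_sum_deg_support hm]
  simp only [Pi.smul_apply, smul_eq_mul, mul_pow, Finset.prod_mul_distrib, Finset.prod_pow_eq_pow_sum]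
  ring

/-- The degree-`d` part of a polynomial of order at least `d` is its rescaled limit at the origin,
even along a varying direction `y` that tends to `v`. -/
theorem tendsto_eval_smul_div_pow {σ α : Type*} {l : Filter α}
    {t : α → ℂ} {y : α → σ → ℂ} {v : σ → ℂ} (ht : Tendsto t l (𝓝 0)) (ht0 : ∀ᶠ a in l, t a ≠ 0)
    (hy : Tendsto y l (𝓝 v)) {p : MvPolynomial σ ℂ} {d : ℕ}
    (hp : ∀ e < d, homogeneousComponent e p = 0) :
    Tendsto (fun a => eval (t a • y a) p / t a ^ d) l (𝓝 (eval v (homogeneousComponent d p))) := by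
  have h1 : ∀ᶠ a in l, ∑ e ∈ Finset.range (p.totalDegree + 1),
      (if e < d then 0 else t a ^ (e - d) * eval (y a) (homogeneousComponent e p)) =
      eval (t a • y a) p / t a ^ d := by
    filter_upwards [ht0] with a ha
    conv_rhs => rw [← sum_homogeneousComponent p, map_sum, Finset.sum_div]
    refine Finset.sum_congr rfl fun e _ => ?_
    rw [eval_smul_of_isHomogeneous (homogeneousComponent_isHomogeneous e p)]
    split_ifs with h
    · simp [hp e h]
    · have h2 : t a ^ e = t a ^ (e - d) * t a ^ d := by
        rw [← pow_add, Nat.sub_add_cancel (not_lt.mp h)]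
      rw [h2]
      field_simp
  refine Tendsto.congr' h1 ?_
  have h3 : eval v (homogeneousComponent d p) = ∑ e ∈ Finset.range (p.totalDegree + 1),
      if e = d then eval v (homogeneousComponent d p) else 0 := by
    rw [Finset.sum_ite_eq']
    split_ifs with h
    · rfl
    · rw [homogeneousComponent_eq_zero _ _ (by simpa using h), map_zero]
  rw [h3]
  refine tendsto_finsetSum _ fun e _ => ?_
  rcases lt_trichotomy e d with h | rfl | h
  · simp only [h, h.ne, if_true, if_false]
    exact tendsto_const_nhds
  · simpa [Function.comp_def] using ((continuous_eval (homogeneousComponent e p)).tendsto v).comp hy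
  · rw [if_neg h.ne']
    simp only [if_neg h.not_gt]
    have h4 := (ht.pow (e - d)).mul (((continuous_eval (homogeneousComponent e p)).tendsto v).comp hy)
    rwa [zero_pow (by omega), zero_mul] at h4

/-- Limits of rescaled points of the variety are tangent directions; this is how membership in a
tangent cone is produced from points. -/
theorem mem_tangentCone_of_tendsto {n : ℕ} {w : Equiv.Perm (Fin n)} {α : Type*} {l : Filter α}
    [l.NeBot] {t : α → ℂ} {y : α → Coord n → ℂ} {v : Coord n → ℂ} (ht : Tendsto t l (𝓝 0))
    (ht0 : ∀ᶠ a in l, t a ≠ 0) (hy : Tendsto y l (𝓝 v))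
    (hmem : ∀ᶠ a in l, t a • y a ∈ chartVariety w) : v ∈ tangentCone w := by
  intro p hp d hd
  have h1 := tendsto_eval_smul_div_pow ht ht0 hy hd
  refine tendsto_nhds_unique h1 (tendsto_const_nhds.congr' ?_)
  filter_upwards [hmem] with a ha
  rw [mem_localIdeal.mp hp _ ha, zero_div]

theorem tendsto_id_punctured : Tendsto (fun t : ℂ => t) (𝓝[≠] 0) (𝓝 0) :=
  tendsto_id.mono_left nhdsWithin_le_nhds

theorem chartVariety_subset_tangentCone {n : ℕ} {w : Equiv.Perm (Fin n)}
    (h : ∀ x ∈ chartVariety w, ∀ t : ℂ, t • x ∈ chartVariety w) :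
    chartVariety w ⊆ tangentCone w := fun x hx =>
  mem_tangentCone_of_tendsto tendsto_id_punctured self_mem_nhdsWithin tendsto_const_nhds
    (Eventually.of_forall fun t => h x hx t)

theorem eval_eq_zero_of_mem_tangentCone {n : ℕ} {w : Equiv.Perm (Fin n)}
    {p : MvPolynomial (Coord n) ℂ} (hp : p ∈ localIdeal w) {d : ℕ} (hd : p.IsHomogeneous d)
    {v : Coord n → ℂ} (hv : v ∈ tangentCone w) : eval v p = 0 := by
  have h := hv p hp d fun e he => by
    rw [homogeneousComponent_of_mem hd, if_neg he.ne]
  rwa [homogeneousComponent_eq_self hd] at h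

/-- A polynomial map whose first-order term at the origin is `L` carries tangent cones to tangent
cones. Pulling back `p` of order at least `d` gives a polynomial of order at least `d` whose
degree-`d` part is that of `p` composed with `L`. -/
theorem map_mem_tangentCone {n : ℕ} {w w' : Equiv.Perm (Fin n)}
    (P : Coord n → MvPolynomial (Coord n) ℂ) (L : (Coord n → ℂ) → Coord n → ℂ)
    (hL : ∀ v, Tendsto (fun t : ℂ => t⁻¹ • fun s => eval (t • v) (P s)) (𝓝[≠] 0) (𝓝 (L v)))
    (hP : ∀ x ∈ chartVariety w, (fun s => eval x (P s)) ∈ chartVariety w')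
    {v : Coord n → ℂ} (hv : v ∈ tangentCone w) : L v ∈ tangentCone w' := by
  intro p hp d hd
  have heval : ∀ x, eval x (bind₁ P p) = eval (fun s => eval x (P s)) p := fun x => by
    rw [bind₁, ← coe_aeval_eq_eval, ← coe_aeval_eq_eval, RingHom.coe_coe, RingHom.coe_coe,
      ← comp_aeval_apply]
  have hF : bind₁ P p ∈ localIdeal w := mem_localIdeal.mpr fun x hx => by
    rw [heval]
    exact mem_localIdeal.mp hp _ (hP x hx)
  have hlim : ∀ u, Tendsto (fun t : ℂ => eval (t • u) (bind₁ P p) / t ^ d) (𝓝[≠] 0)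
      (𝓝 (eval (L u) (homogeneousComponent d p))) := by
    intro u
    refine (tendsto_eval_smul_div_pow tendsto_id_punctured self_mem_nhdsWithin (hL u) hd).congr' ?_
    filter_upwards [self_mem_nhdsWithin] with t ht
    rw [heval, smul_inv_smul₀ ht]
  -- The pullback is `O(t ^ d)` along every line, so its parts of degree below `d` vanish one after
  -- another.
  have hlow : ∀ e < d, homogeneousComponent e (bind₁ P p) = 0 := by
    intro e
    induction e using Nat.strong_induction_on with
    | _ e ih =>
      intro he
      refine MvPolynomial.funext fun u => ?_
      rw [map_zero]
      have h1 := tendsto_eval_smul_div_pow (y := fun _ => u) tendsto_id_punctured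
        self_mem_nhdsWithin tendsto_const_nhds (fun e' he' => ih e' he' (he'.trans he))
      have h2 : Tendsto (fun t : ℂ => t ^ (d - e)) (𝓝[≠] 0) (𝓝 0) := by
        have := tendsto_id_punctured.pow (d - e)
        rwa [zero_pow (by omega)] at this
      have h3 := h2.mul (hlim u)
      rw [zero_mul] at h3
      refine tendsto_nhds_unique h1 (h3.congr' ?_)
      filter_upwards [self_mem_nhdsWithin] with t ht
      have ht' : t ≠ 0 := ht
      have h4 : t ^ d = t ^ (d - e) * t ^ e := by
        rw [← pow_add, Nat.sub_add_cancel he.le]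
      rw [h4]
      field_simp
  have h1 := tendsto_eval_smul_div_pow (y := fun _ => v) tendsto_id_punctured
    self_mem_nhdsWithin tendsto_const_nhds hlow
  rw [hv _ hF d hlow] at h1
  exact tendsto_nhds_unique (hlim v) h1

theorem smul_mem_tangentCone {n : ℕ} {w : Equiv.Perm (Fin n)} {v : Coord n → ℂ}
    (hv : v ∈ tangentCone w) (t : ℂ) : t • v ∈ tangentCone w := by
  intro p hp d hd
  rw [eval_smul_of_isHomogeneous (homogeneousComponent_isHomogeneous d p), hv p hp d hd, mul_zero]

/-! ### Inversion -/

/-- The coordinates of the inverse of the generic unipotent matrix. -/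
def invCoord {n : ℕ} (s : Coord n) : MvPolynomial (Coord n) ℂ :=
  (genericUnipotent n).adjugate s.1.1 s.1.2

theorem coe_uGL_inv {n : ℕ} (x : Coord n → ℂ) :
    ((uGL x)⁻¹ : GL (Fin n) ℂ) = (unipotent x).adjugate := by
  have h : unipotent x * (unipotent x).adjugate = 1 := by
    rw [mul_adjugate, det_unipotent, one_smul]
  exact Units.inv_eq_of_mul_eq_one_right h

theorem eval_invCoord {n : ℕ} (x : Coord n → ℂ) (s : Coord n) :
    eval x (invCoord s) = (unipotent x).adjugate s.1.1 s.1.2 := by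
  rw [invCoord, ← genericUnipotent_map]
  have := RingHom.map_adjugate (eval x) (genericUnipotent n)
  exact congrFun (congrFun this s.1.1) s.1.2

theorem uGL_inv_apply_of_lt {n : ℕ} (x : Coord n → ℂ) {i j : Fin n} (h : i < j) :
    ((uGL x)⁻¹ : GL (Fin n) ℂ) i j = 0 := by
  have h1 : (unipotent x).BlockTriangular OrderDual.toDual := by
    intro i j hij
    have h : i < j := hij
    simp [unipotent, h.not_gt, h.ne]
  have : Invertible (unipotent x) := (uGL x).invertible
  have h2 := blockTriangular_inv_of_blockTriangular h1
  have h3 : ((uGL x)⁻¹ : GL (Fin n) ℂ) = (unipotent x)⁻¹ := by simp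
  rw [h3]
  exact h2 h

theorem uGL_inv_apply_self {n : ℕ} (x : Coord n → ℂ) (i : Fin n) :
    ((uGL x)⁻¹ : GL (Fin n) ℂ) i i = 1 := by
  have h : ((uGL x * (uGL x)⁻¹ : GL (Fin n) ℂ) : Matrix (Fin n) (Fin n) ℂ) i i = 1 := by simp
  rw [Units.val_mul, mul_apply, Finset.sum_eq_single i] at h
  · simpa [unipotent] using h
  · intro k _ hk
    rcases lt_or_gt_of_ne hk with h' | h'
    · rw [uGL_inv_apply_of_lt x h', mul_zero]
    · simp [unipotent, h'.not_gt, h'.ne]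
  · simp

theorem uGL_invCoord {n : ℕ} (x : Coord n → ℂ) :
    uGL (fun s => eval x (invCoord s)) = (uGL x)⁻¹ := by
  refine Units.ext ?_
  ext i j
  rw [coe_uGL, unipotent, of_apply]
  split_ifs with h h'
  · rw [eval_invCoord, coe_uGL_inv]
  · rw [h', uGL_inv_apply_self]
  · exact (uGL_inv_apply_of_lt x (lt_of_le_of_ne (not_lt.mp h) h')).symm

theorem inv_mem_cell {n : ℕ} {w : Equiv.Perm (Fin n)} {g : GL (Fin n) ℂ} (hg : g ∈ cell w) :
    g⁻¹ ∈ cell w⁻¹ := by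
  obtain ⟨b, hb, b', hb', rfl⟩ := hg
  exact ⟨b'⁻¹, inv_mem hb', b⁻¹, inv_mem hb, by rw [permGL_inv]; group⟩

/-- The strictly lower-triangular matrix with given coordinates. -/
def nilpotent {n : ℕ} (x : Coord n → ℂ) : Matrix (Fin n) (Fin n) ℂ :=
  of fun i j => if h : j < i then x ⟨(i, j), h⟩ else 0

theorem unipotent_smul {n : ℕ} (t : ℂ) (x : Coord n → ℂ) :
    unipotent (t • x) = 1 + t • nilpotent x := by
  ext i j
  rw [Matrix.add_apply, Matrix.smul_apply, unipotent, nilpotent, of_apply, of_apply]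
  split_ifs with h h'
  · simp [one_apply, h.ne']
  · subst h'
    simp
  · simp [one_apply, h']

theorem uGL_smul_inv {n : ℕ} (t : ℂ) (x : Coord n → ℂ) :
    ((uGL (t • x))⁻¹ : GL (Fin n) ℂ) =
      1 - t • (nilpotent x * ((uGL (t • x))⁻¹ : GL (Fin n) ℂ)) := by
  have h : ((uGL (t • x) * (uGL (t • x))⁻¹ : GL (Fin n) ℂ) : Matrix (Fin n) (Fin n) ℂ) = 1 := by
    simp
  rw [Units.val_mul, coe_uGL, unipotent_smul, add_mul, one_mul, smul_mul_assoc] at h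
  exact eq_sub_of_add_eq h

theorem continuous_unipotent {n : ℕ} : Continuous (unipotent : (Coord n → ℂ) → _) := by
  refine continuous_matrix fun i j => ?_
  simp only [unipotent, of_apply]
  split_ifs <;> fun_prop

theorem unipotent_zero {n : ℕ} : unipotent (0 : Coord n → ℂ) = 1 := by
  have := unipotent_smul (n := n) 0 0
  rwa [zero_smul, zero_smul, add_zero] at this

theorem tendsto_uGL_smul_inv {n : ℕ} (x : Coord n → ℂ) :
    Tendsto (fun t : ℂ => (((uGL (t • x))⁻¹ : GL (Fin n) ℂ) : Matrix (Fin n) (Fin n) ℂ))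
      (𝓝[≠] 0) (𝓝 1) := by
  have h1 : Continuous fun t : ℂ => (unipotent (t • x)).adjugate :=
    (continuous_unipotent.comp (continuous_id.smul continuous_const)).matrix_adjugate
  have h2 := (h1.tendsto 0).mono_left (nhdsWithin_le_nhds (s := {0}ᶜ))
  rw [zero_smul, unipotent_zero, adjugate_one] at h2
  exact h2.congr fun t => (coe_uGL_inv _).symm

/-- Inversion maps the variety of `w` to that of `w⁻¹` and has differential `-1` at the identity.
The sign is harmless because tangent cones are stable under scaling. -/
theorem tangentCone_inv_subset {n : ℕ} (w : Equiv.Perm (Fin n)) :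
    tangentCone w ⊆ tangentCone w⁻¹ := by
  intro v hv
  have h := map_mem_tangentCone (w := w) (w' := w⁻¹) invCoord (fun v => -v) ?_ ?_ hv
  · simpa using smul_mem_tangentCone h (-1)
  · intro v
    refine tendsto_pi_nhds.mpr fun s => ?_
    have h1 : Tendsto (fun t : ℂ => -(nilpotent v * ((uGL (t • v))⁻¹ : GL (Fin n) ℂ)))
        (𝓝[≠] 0) (𝓝 (-nilpotent v)) := by
      have := (tendsto_const_nhds (x := nilpotent v)).mul (tendsto_uGL_smul_inv v)
      rw [mul_one] at this
      exact this.neg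
    have h2 := tendsto_pi_nhds.mp (tendsto_pi_nhds.mp h1 s.1.1) s.1.2
    have h3 : (-nilpotent v) s.1.1 s.1.2 = (-v) s := by
      simp [nilpotent, s.2]
    rw [h3] at h2
    refine h2.congr' ?_
    filter_upwards [self_mem_nhdsWithin] with t ht
    have ht' : t ≠ 0 := ht
    rw [Pi.smul_apply, eval_invCoord, ← coe_uGL_inv]
    conv_rhs => rw [uGL_smul_inv]
    rw [Matrix.sub_apply, Matrix.smul_apply, one_apply_ne s.2.ne', Matrix.neg_apply, zero_sub,
      smul_eq_mul, smul_eq_mul]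
    field_simp
  · intro x hx
    rw [chartVariety, Set.mem_ofPred_eq, uGL_invCoord]
    exact map_mem_closure continuous_inv hx fun g hg => inv_mem_cell hg

theorem tangentCone_inv {n : ℕ} (w : Equiv.Perm (Fin n)) : tangentCone w⁻¹ = tangentCone w := by
  refine (tangentCone_inv_subset w).antisymm' ?_
  have := tangentCone_inv_subset w⁻¹
  rwa [inv_inv] at this

theorem tangentCone_tau_inv {n i k : ℕ} (hi : 0 < i) (hi' : i < n) (hk : 0 < k) (hk' : k < n) :
    tangentCone (tau n i k) = tangentCone (tau n (n - k) (n - i)) := by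
  rw [← tau_inv hi hi' hk hk', tangentCone_inv]

/-! ### Reflection in the antidiagonal -/

/-- The reflection of a matrix in its antidiagonal. -/
def antiMatrix {n : ℕ} (M : Matrix (Fin n) (Fin n) ℂ) : Matrix (Fin n) (Fin n) ℂ :=
  of fun i j => M j.rev i.rev

theorem antiMatrix_mul {n : ℕ} (M N : Matrix (Fin n) (Fin n) ℂ) :
    antiMatrix (M * N) = antiMatrix N * antiMatrix M := by
  ext i j
  simp only [antiMatrix, of_apply, mul_apply]
  rw [← Equiv.sum_comp Fin.revPerm]
  exact Finset.sum_congr rfl fun k _ => by simp [mul_comm]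

theorem antiMatrix_one {n : ℕ} : antiMatrix (1 : Matrix (Fin n) (Fin n) ℂ) = 1 := by
  ext i j
  simp [antiMatrix, one_apply, eq_comm]

/-- The reflection of an invertible matrix in its antidiagonal. -/
def antiGL {n : ℕ} (g : GL (Fin n) ℂ) : GL (Fin n) ℂ where
  val := antiMatrix g
  inv := antiMatrix (g⁻¹ : GL (Fin n) ℂ)
  val_inv := by rw [← antiMatrix_mul, ← Units.val_mul]; simp [antiMatrix_one]
  inv_val := by rw [← antiMatrix_mul, ← Units.val_mul]; simp [antiMatrix_one]

theorem continuous_antiGL {n : ℕ} : Continuous (antiGL : GL (Fin n) ℂ → _) := by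
  have h : Continuous (antiMatrix : Matrix (Fin n) (Fin n) ℂ → _) :=
    continuous_matrix fun i j => continuous_id.matrix_elem _ _
  exact Units.continuous_iff.mpr
    ⟨h.comp Units.continuous_val, h.comp (Units.continuous_val.comp continuous_inv)⟩

theorem antiGL_mem_borel {n : ℕ} {g : GL (Fin n) ℂ} (hg : g ∈ borel n) : antiGL g ∈ borel n :=
  mem_borel.mpr fun _ _ hij => mem_borel.mp hg _ _ (Fin.rev_lt_rev.mpr hij)

theorem antiGL_mem_cell {n : ℕ} {w : Equiv.Perm (Fin n)} {g : GL (Fin n) ℂ} (hg : g ∈ cell w) :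
    antiGL g ∈ cell (Fin.revPerm * w⁻¹ * Fin.revPerm) := by
  obtain ⟨b, hb, b', hb', rfl⟩ := hg
  refine ⟨antiGL b', antiGL_mem_borel hb', antiGL b, antiGL_mem_borel hb, Units.ext ?_⟩
  have h : antiMatrix (permMat w) = permMat (Fin.revPerm * w⁻¹ * Fin.revPerm) := by
    ext i j
    rw [antiMatrix, of_apply, permMat_apply, permMat_apply]
    simp only [Equiv.Perm.mul_apply, Fin.revPerm_apply]
    refine if_congr ?_ rfl rfl
    constructor
    · intro h
      rw [h]
      simp
    · intro h
      rw [h]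
      simp
  change antiMatrix _ = antiMatrix _ * permMat _ * antiMatrix _
  rw [← h, Units.val_mul, Units.val_mul, antiMatrix_mul, antiMatrix_mul, coe_permGL, mul_assoc]

/-- The reflection of the index set of the coordinates in the antidiagonal. -/
def antiCoord {n : ℕ} (s : Coord n) : Coord n :=
  ⟨(s.1.2.rev, s.1.1.rev), Fin.rev_lt_rev.mpr s.2⟩

theorem antiCoord_antiCoord {n : ℕ} (s : Coord n) : antiCoord (antiCoord s) = s := by
  simp [antiCoord]

theorem antiGL_uGL {n : ℕ} (x : Coord n → ℂ) : antiGL (uGL x) = uGL (x ∘ antiCoord) := by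
  refine Units.ext ?_
  ext i j
  change unipotent x _ _ = unipotent _ _ _
  simp only [unipotent, of_apply, Fin.rev_lt_rev, Fin.rev_inj, eq_comm]
  rfl

/-- Reflection in the antidiagonal is an anti-automorphism that preserves the Borel subgroup, and it
reverses the order of `s_i` and `s_k`. -/
theorem rev_mul_tau_inv_mul_rev {n : ℕ} (i k : ℕ) :
    Fin.revPerm * (tau n i k)⁻¹ * Fin.revPerm = tau n k i := by
  rw [tau, tau, _root_.mul_inv_rev, _root_.mul_inv_rev, simple_inv, simple_inv, revPerm_inv]
  simp only [mul_assoc, revPerm_mul_self, mul_one]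

theorem comp_antiCoord_mem_chartVariety {n i k : ℕ} {x : Coord n → ℂ}
    (hx : x ∈ chartVariety (tau n i k)) : x ∘ antiCoord ∈ chartVariety (tau n k i) := by
  rw [chartVariety, Set.mem_ofPred_eq, ← antiGL_uGL, ← rev_mul_tau_inv_mul_rev]
  exact map_mem_closure continuous_antiGL hx fun g hg => antiGL_mem_cell hg

theorem comp_antiCoord_mem_tangentCone {n i k : ℕ} {v : Coord n → ℂ}
    (hv : v ∈ tangentCone (tau n i k)) : v ∘ antiCoord ∈ tangentCone (tau n k i) := by
  refine map_mem_tangentCone (w := tau n i k) (fun s => X (antiCoord s)) (fun v => v ∘ antiCoord)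
    (fun v => tendsto_const_nhds.congr' ?_) (fun x hx => ?_) hv
  · filter_upwards [self_mem_nhdsWithin] with t ht
    have ht' : t ≠ 0 := ht
    ext s
    simp [ht']
  · simpa [Function.comp_def] using comp_antiCoord_mem_chartVariety hx

theorem tangentCone_tau_subset_iff {n i k i' k' : ℕ} :
    tangentCone (tau n i k) ⊆ tangentCone (tau n i' k') ↔
      tangentCone (tau n k i) ⊆ tangentCone (tau n k' i') := by
  have key : ∀ {i k i' k' : ℕ}, tangentCone (tau n i k) ⊆ tangentCone (tau n i' k') →
      tangentCone (tau n k i) ⊆ tangentCone (tau n k' i') := by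
    intro i k i' k' h v hv
    have h1 := comp_antiCoord_mem_tangentCone (h (comp_antiCoord_mem_tangentCone hv))
    have h2 : (v ∘ antiCoord) ∘ antiCoord = v := by
      ext s
      simp [antiCoord_antiCoord]
    rwa [h2] at h1
  exact ⟨key, key⟩

/-! ### Homogeneous determinantal conditions -/

theorem isHomogeneous_det {σ ι : Type*} [Fintype ι] [DecidableEq ι]
    {M : Matrix ι ι (MvPolynomial σ ℂ)} (h : ∀ i j, (M i j).IsHomogeneous 1) :
    M.det.IsHomogeneous (Fintype.card ι) := by
  rw [det_apply]
  refine IsHomogeneous.sum _ _ _ fun σ _ => ?_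
  have h1 : (∏ i, M (σ i) i).IsHomogeneous (Fintype.card ι) := by
    have := IsHomogeneous.prod Finset.univ (fun i => M (σ i) i) (fun _ => 1) fun i _ => h _ _
    simpa using this
  rcases Int.units_eq_one_or (Equiv.Perm.sign σ) with h2 | h2
  · rwa [h2, one_smul]
  · rw [h2, Units.neg_smul, one_smul]
    exact h1.neg

/-- The hypothesis `r + c ≤ n` places the corner strictly below the diagonal, where every entry is a
coordinate. -/
theorem isHomogeneous_columnMinor {n r c : ℕ} (hr : r ≤ n) (hc : c ≤ n) (hrc : r + c ≤ n)
    (f : Fin c → Fin r) : (columnMinor hr hc f).IsHomogeneous c := by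
  have := isHomogeneous_det (M := (corner hr hc (genericUnipotent n)).submatrix f id) (by
    intro i j
    have hlt : Fin.castLE hc j < (⟨n - r + f i, by omega⟩ : Fin n) := by
      rw [Fin.lt_def]
      simp only [Fin.val_castLE]
      omega
    change IsHomogeneous (genericUnipotent n _ _) 1
    rw [genericUnipotent, of_apply]
    simp only [id]
    rw [dif_pos hlt]
    exact isHomogeneous_X _ _)
  rwa [Fintype.card_fin] at this

theorem corner_unipotent_smul {n r c : ℕ} (hr : r ≤ n) (hc : c ≤ n) (hrc : r + c ≤ n) (t : ℂ)
    (x : Coord n → ℂ) : corner hr hc (unipotent (t • x)) = t • corner hr hc (unipotent x) := by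
  ext i j
  have hlt : Fin.castLE hc j < (⟨n - r + i, by omega⟩ : Fin n) := by
    rw [Fin.lt_def]
    simp only [Fin.val_castLE]
    omega
  simp only [corner, submatrix_apply, Matrix.smul_apply, unipotent, of_apply]
  rw [dif_pos hlt, dif_pos hlt]
  rfl

theorem Meets.smul {n r c : ℕ} (hr : r ≤ n) (hc : c ≤ n) (hrc : r + c ≤ n) {x : Coord n → ℂ}
    (h : Meets c (n - r) (uGL x)) (t : ℂ) : Meets c (n - r) (uGL (t • x)) := by
  rw [meets_iff_corner hr hc] at h ⊢
  obtain ⟨v, hv, h⟩ := h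
  refine ⟨v, hv, ?_⟩
  rw [coe_uGL, corner_unipotent_smul hr hc hrc, smul_mulVec]
  rw [coe_uGL] at h
  rw [h, smul_zero]

end SchubertTangent

end

/-! ### Tangent directions of mixed intersections -/

noncomputable section

namespace SchubertTangent

open Matrix Topology Filter MvPolynomial

/-- The matrix determinant lemma without an invertibility assumption. -/
theorem det_add_vecMulVec {m : Type*} [Fintype m] [DecidableEq m] (A : Matrix m m ℂ)
    (u v : m → ℂ) : (A + vecMulVec u v).det = A.det + v ⬝ᵥ (A.adjugate *ᵥ u) := by
  have key : ∀ A : Matrix m m ℂ, A.det ≠ 0 →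
      (A + vecMulVec u v).det = A.det + v ⬝ᵥ (A.adjugate *ᵥ u) := by
    intro A hA
    have h := det_add_replicateCol_mul_replicateRow (ι := Unit) hA.isUnit u v
    rw [← vecMulVec_eq] at h
    rw [h, det_unique (n := Unit), Matrix.add_apply, one_apply_eq, mul_add, mul_one, Matrix.mul_assoc,
      ← replicateCol_mulVec, replicateRow_mul_replicateCol_apply, inv_def, smul_mulVec,
      dotProduct_smul, Ring.inverse_eq_inv', smul_eq_mul, mul_inv_cancel_left₀ hA]
  have hc : Continuous fun x : ℂ => A + x • (1 : Matrix m m ℂ) := by fun_prop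
  have h1 : Tendsto (fun x : ℂ => (A + x • (1 : Matrix m m ℂ) + vecMulVec u v).det) (𝓝[≠] 0)
      (𝓝 (A + vecMulVec u v).det) := by
    have h3 : Continuous fun x : ℂ => (A + x • (1 : Matrix m m ℂ) + vecMulVec u v).det :=
      (hc.add continuous_const).matrix_det
    have := (h3.tendsto 0).mono_left (nhdsWithin_le_nhds (s := {0}ᶜ))
    simpa only [zero_smul, add_zero] using this
  have h2 : Tendsto (fun x : ℂ => (A + x • (1 : Matrix m m ℂ)).det +
      v ⬝ᵥ ((A + x • (1 : Matrix m m ℂ)).adjugate *ᵥ u)) (𝓝[≠] 0)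
      (𝓝 (A.det + v ⬝ᵥ (A.adjugate *ᵥ u))) := by
    have h3 : Continuous fun x : ℂ => (A + x • (1 : Matrix m m ℂ)).det +
        v ⬝ᵥ ((A + x • (1 : Matrix m m ℂ)).adjugate *ᵥ u) :=
      hc.matrix_det.add (continuous_const.dotProduct (hc.matrix_adjugate.matrix_mulVec
        continuous_const))
    have := (h3.tendsto 0).mono_left (nhdsWithin_le_nhds (s := {0}ᶜ))
    simpa only [zero_smul, add_zero] using this
  refine tendsto_nhds_unique h1 (h2.congr' ?_)
  -- Small nonzero `x` are not eigenvalues of `-A`, so `A + x` is invertible there.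
  have h4 : ∀ᶠ x : ℂ in 𝓝[≠] 0, (-A).charpoly.eval x ≠ 0 := by
    have h6 : {x : ℂ | (-A).charpoly.eval x = 0}.Finite := by
      refine ((-A).charpoly.roots.toFinset.finite_toSet).subset fun x hx => ?_
      simp only [Finset.mem_coe, Multiset.mem_toFinset]
      exact (Polynomial.mem_roots (charpoly_monic _).ne_zero).mpr hx
    have h7 : ({x : ℂ | (-A).charpoly.eval x = 0} \ {0}).Finite := h6.subset Set.sdiff_subset
    have h8 := h7.isClosed.isOpen_compl.mem_nhds (x := (0 : ℂ)) (by simp)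
    filter_upwards [mem_nhdsWithin_of_mem_nhds h8, self_mem_nhdsWithin] with x hx hx0 hx1
    exact hx ⟨hx1, hx0⟩
  filter_upwards [h4] with x hx
  refine (key _ ?_).symm
  rw [eval_charpoly] at hx
  have : scalar m x - -A = A + x • (1 : Matrix m m ℂ) := by
    rw [sub_neg_eq_add, add_comm, smul_one_eq_diagonal]
    rfl
  rwa [this] at hx

theorem corner_one {n r c : ℕ} (hr : r ≤ n) (hc : c ≤ n) (hrc : r + c ≤ n) :
    corner hr hc (1 : Matrix (Fin n) (Fin n) ℂ) = 0 := by
  ext i j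
  rw [corner, submatrix_apply, one_apply_ne]
  · rfl
  · intro h
    have := congrArg Fin.val h
    simp only [Fin.val_castLE] at this
    omega

theorem corner_nilpotent {n r c : ℕ} (hr : r ≤ n) (hc : c ≤ n) (hrc : r + c ≤ n)
    (x : Coord n → ℂ) : corner hr hc (nilpotent x) = corner hr hc (unipotent x) := by
  have h := unipotent_smul 1 x
  rw [one_smul, one_smul] at h
  rw [h]
  have h1 : corner hr hc (1 + nilpotent x) = corner hr hc 1 + corner hr hc (nilpotent x) := rfl
  rw [h1, corner_one hr hc hrc, zero_add]

theorem unipotent_add_single {n : ℕ} (x : Coord n → ℂ) (s : Coord n) (c : ℂ) :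
    unipotent (x + c • Pi.single s 1) = unipotent x + c • single s.1.1 s.1.2 1 := by
  ext i j
  rw [Matrix.add_apply, Matrix.smul_apply, single_apply, unipotent, unipotent, of_apply, of_apply]
  by_cases h : j < i
  · rw [dif_pos h, dif_pos h, Pi.add_apply, Pi.smul_apply, Pi.single_apply]
    congr 2
    refine if_congr ?_ rfl rfl
    rw [Subtype.ext_iff, Prod.ext_iff]
    exact ⟨fun h => ⟨h.1.symm, h.2.symm⟩, fun h => ⟨h.1.symm, h.2.symm⟩⟩
  · have h1 : ¬(s.1.1 = i ∧ s.1.2 = j) := by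
      rintro ⟨h2, h3⟩
      exact h (h2 ▸ h3 ▸ s.2)
    rw [dif_neg h, dif_neg h, if_neg h1, smul_zero, add_zero]

theorem single_mul_mul_single {n : ℕ} (M : Matrix (Fin n) (Fin n) ℂ) (p q : Fin n) :
    single p q 1 * M * single p q 1 = M q p • single p q (1 : ℂ) := by
  ext i j
  rw [mul_assoc, mul_apply, Finset.sum_eq_single q]
  · rw [mul_apply, Finset.sum_eq_single p]
    · rw [Matrix.smul_apply, single_apply, single_apply, single_apply]
      by_cases h1 : p = i <;> by_cases h2 : q = j <;> simp [h1, h2]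
    · intro k _ hk
      simp [hk.symm]
    · simp
  · intro k _ hk
    simp [hk.symm]
  · simp

/-- This is the rank-one update formula for inverses. Its usual denominator is 1, because the entry
of the inverse that enters it lies above the diagonal; the correction is thus linear in `c`. -/
theorem uGL_add_single_inv {n : ℕ} (x : Coord n → ℂ) (s : Coord n) (c : ℂ) :
    ((uGL (x + c • Pi.single s 1))⁻¹ : GL (Fin n) ℂ) =
      (((uGL x)⁻¹ : GL (Fin n) ℂ) : Matrix (Fin n) (Fin n) ℂ) -
        c • vecMulVec (fun i => ((uGL x)⁻¹ : GL (Fin n) ℂ) i s.1.1)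
          (fun j => ((uGL x)⁻¹ : GL (Fin n) ℂ) s.1.2 j) := by
  set G : Matrix (Fin n) (Fin n) ℂ := (((uGL x)⁻¹ : GL (Fin n) ℂ) : Matrix (Fin n) (Fin n) ℂ) with hG
  have h1 : unipotent x * G = 1 := by
    rw [hG, ← coe_uGL, ← Units.val_mul]
    simp
  have h2 : vecMulVec (fun i => G i s.1.1) (fun j => G s.1.2 j) =
      G * single s.1.1 s.1.2 1 * G := by
    ext i j
    rw [vecMulVec_apply, mul_apply, Finset.sum_eq_single s.1.2]
    · rw [mul_apply, Finset.sum_eq_single s.1.1]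
      · simp
      · intro k _ hk
        simp [hk.symm]
      · simp
    · intro k _ hk
      rw [mul_apply, Finset.sum_eq_zero, zero_mul]
      intro l _
      simp [hk.symm]
    · simp
  refine Units.inv_eq_of_mul_eq_one_right ?_
  rw [coe_uGL, unipotent_add_single, h2]
  have h3 : single s.1.1 s.1.2 1 * (G * single s.1.1 s.1.2 1 * G) = 0 := by
    rw [← mul_assoc, ← mul_assoc, single_mul_mul_single, hG, uGL_inv_apply_of_lt x s.2, zero_smul,
      zero_mul]
  rw [add_mul, mul_sub, mul_sub, mul_smul_comm, smul_mul_assoc, smul_mul_assoc, mul_smul_comm, h3,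
    ← mul_assoc, ← mul_assoc, h1, one_mul]
  simp

/-- The vector of a coordinate in the lower-left `b × b` corner. -/
def cornerCoord {n b : ℕ} (hb : 2 * b ≤ n) (p q : Fin b) : Coord n :=
  ⟨(⟨n - b + p, by omega⟩, Fin.castLE (by omega) q), by
    rw [Fin.lt_def]
    simp only [Fin.val_castLE]
    omega⟩

/-- The hypothesis on `p` and `q` says that the coordinate lies in the `b × b` corner but outside
the `a × a` corner. -/
theorem corner_add_single {n a b : ℕ} (ha : a ≤ n) (hb : 2 * b ≤ n) {p q : Fin b}
    (hpq : (p : ℕ) + a < b ∨ a ≤ q) (x : Coord n → ℂ) (c : ℂ) :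
    corner ha ha (unipotent (x + c • Pi.single (cornerCoord hb p q) 1)) =
      corner ha ha (unipotent x) := by
  rw [unipotent_add_single]
  ext i j
  rw [corner, corner, submatrix_apply, submatrix_apply, Matrix.add_apply, Matrix.smul_apply,
    single_apply, if_neg, smul_zero, add_zero]
  rintro ⟨h1, h2⟩
  have h1' := congrArg Fin.val h1
  have h2' := congrArg Fin.val h2
  simp only [cornerCoord, Fin.val_castLE] at h1' h2'
  omega

/-- A common zero of two corner determinants is a tangent direction of a Schubert variety of the
mixed kind, provided that a cofactor outside the smaller corner does not vanish. -/
theorem mem_tangentCone_mixed {n a b : ℕ} (ha : 0 < a) (hab : a < b) (hb : 2 * b ≤ n)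
    (hab' : a + 2 ≤ n - b) {p q : Fin b} (hpq : (p : ℕ) + a < b ∨ a ≤ q) {v : Coord n → ℂ}
    (h1 : Meets a (n - a) (uGL v)) (h2 : Meets b (n - b) (uGL v))
    (h3 : (corner (by omega : b ≤ n) (by omega : b ≤ n) (unipotent v)).adjugate q p ≠ 0) :
    v ∈ tangentCone (tau n a (n - b)) := by
  have hbn : b ≤ n := by omega
  set C := corner hbn hbn (unipotent v) with hC
  have h2' : C.det = 0 := (meets_iff_det_corner hbn).mp h2
  let s := cornerCoord hb p q
  let G : ℂ → Matrix (Fin n) (Fin n) ℂ := fun t =>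
    (((uGL (t • v))⁻¹ : GL (Fin n) ℂ) : Matrix (Fin n) (Fin n) ℂ)
  let M : ℂ → Matrix (Fin b) (Fin b) ℂ := fun t => -corner hbn hbn (nilpotent v * G t)
  let col : ℂ → Fin b → ℂ := fun t i => G t ⟨n - b + i, by omega⟩ s.1.1
  let row : ℂ → Fin b → ℂ := fun t j => G t s.1.2 (Fin.castLE hbn j)
  let den : ℂ → ℂ := fun t => row t ⬝ᵥ ((M t).adjugate *ᵥ col t)
  -- The corner of the inverse is `t` times a rank-one perturbation of `M t`, so its determinant is
  -- affine in the change of the coordinate `s`. The coefficient is chosen to make this determinant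
  -- zero.
  let y : ℂ → Coord n → ℂ := fun t => v + ((M t).det / den t) • Pi.single s 1
  have hG : Tendsto G (𝓝[≠] 0) (𝓝 1) := tendsto_uGL_smul_inv v
  have hcorner : Continuous (corner hbn hbn : Matrix (Fin n) (Fin n) ℂ → _) :=
    continuous_id.matrix_submatrix _ _
  have hM : Tendsto M (𝓝[≠] 0) (𝓝 (-C)) := by
    have h4 := (tendsto_const_nhds (x := nilpotent v)).mul hG
    rw [mul_one] at h4
    have h5 := ((hcorner.tendsto _).comp h4).neg
    rwa [corner_nilpotent hbn hbn (by omega)] at h5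
  have hentry : ∀ i j, Tendsto (fun t => G t i j) (𝓝[≠] 0) (𝓝 ((1 : Matrix (Fin n) (Fin n) ℂ) i j)) :=
    fun i j => tendsto_pi_nhds.mp (tendsto_pi_nhds.mp hG i) j
  have hcol : Tendsto col (𝓝[≠] 0) (𝓝 (Pi.single p 1)) := by
    refine tendsto_pi_nhds.mpr fun i => ?_
    have h4 : (Pi.single p 1 : Fin b → ℂ) i =
        (1 : Matrix (Fin n) (Fin n) ℂ) ⟨n - b + i, by omega⟩ s.1.1 := by
      rw [one_apply, Pi.single_apply]
      refine if_congr ?_ rfl rfl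
      simp only [s, cornerCoord, Fin.ext_iff]
      omega
    rw [h4]
    exact hentry _ _
  have hrow : Tendsto row (𝓝[≠] 0) (𝓝 (Pi.single q 1)) := by
    refine tendsto_pi_nhds.mpr fun j => ?_
    have h4 : (Pi.single q 1 : Fin b → ℂ) j =
        (1 : Matrix (Fin n) (Fin n) ℂ) s.1.2 (Fin.castLE hbn j) := by
      rw [one_apply, Pi.single_apply]
      refine if_congr ?_ rfl rfl
      simp only [s, cornerCoord, Fin.ext_iff, Fin.val_castLE]
      exact eq_comm
    rw [h4]
    exact hentry _ _
  have hden : Tendsto den (𝓝[≠] 0) (𝓝 ((-C).adjugate q p)) := by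
    have hcont : Continuous fun z : (Fin b → ℂ) × Matrix (Fin b) (Fin b) ℂ × (Fin b → ℂ) =>
        z.1 ⬝ᵥ (z.2.1.adjugate *ᵥ z.2.2) :=
      continuous_fst.dotProduct ((continuous_fst.comp continuous_snd).matrix_adjugate.matrix_mulVec
        (continuous_snd.comp continuous_snd))
    have h4 := (hcont.tendsto (Pi.single q 1, -C, Pi.single p 1)).comp
      (hrow.prodMk_nhds (hM.prodMk_nhds hcol))
    simpa [Function.comp_def] using h4
  have hne : (-C).adjugate q p ≠ 0 := by
    rw [← neg_one_smul ℂ C, adjugate_smul, Matrix.smul_apply, smul_eq_mul]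
    exact mul_ne_zero (pow_ne_zero _ (by norm_num)) h3
  -- The numerator tends to `det (-C) = 0` and the denominator to a nonzero cofactor, so the
  -- correction disappears in the limit.
  have hdet : Tendsto (fun t => (M t).det / den t) (𝓝[≠] 0) (𝓝 0) := by
    have h4 := ((continuous_id.matrix_det (n := Fin b) (R := ℂ)).tendsto (-C)).comp hM
    have h5 := h4.div hden hne
    rwa [id, det_neg, h2', mul_zero, zero_div] at h5
  have hy : Tendsto y (𝓝[≠] 0) (𝓝 v) := by
    have h4 := (tendsto_const_nhds (x := v)).add (hdet.smul_const (Pi.single s (1 : ℂ)))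
    rwa [zero_smul, add_zero] at h4
  refine mem_tangentCone_of_tendsto tendsto_id_punctured self_mem_nhdsWithin hy ?_
  filter_upwards [hden.eventually_ne hne] with t ht
  rw [mem_chartVariety_tau ha (by omega) hab']
  constructor
  · refine Meets.smul (by omega) (by omega) (by omega) ?_ t
    rw [meets_iff_det_corner (by omega), coe_uGL, corner_add_single _ hb hpq, ← coe_uGL,
      ← meets_iff_det_corner]
    exact h1
  -- The condition on the large corner is read off the inverse matrix as singularity of its `b × b`
  -- corner.
  · have h4 : n - (n - b) = b := by omega
    rw [h4, ← meets_inv, meets_iff_det_corner hbn]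
    have h5 : t • y t = t • v + (t * ((M t).det / den t)) • Pi.single s 1 := by
      rw [smul_add, smul_smul]
    have h6 : corner hbn hbn (((uGL (t • y t))⁻¹ : GL (Fin n) ℂ) : Matrix (Fin n) (Fin n) ℂ) =
        t • (M t + vecMulVec (-((M t).det / den t) • col t) (row t)) := by
      rw [h5, uGL_add_single_inv]
      have h7 : corner hbn hbn (G t) = t • M t := by
        have h8 : corner hbn hbn (1 - t • (nilpotent v * G t)) =
            corner hbn hbn 1 - t • corner hbn hbn (nilpotent v * G t) := rfl
        have h9 : G t = 1 - t • (nilpotent v * G t) := uGL_smul_inv t v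
        rw [congrArg (corner hbn hbn) h9, h8, corner_one hbn hbn (by omega), zero_sub]
        simp only [M, smul_neg]
      ext i j
      have h10 := congrFun (congrFun h7 i) j
      simp only [corner, submatrix_apply, Matrix.sub_apply, Matrix.smul_apply, smul_eq_mul,
        Matrix.add_apply, vecMulVec_apply, Pi.smul_apply, G, col, row] at h10 ⊢
      rw [h10]
      ring
    rw [h6, det_smul, det_add_vecMulVec, mulVec_smul, dotProduct_smul, smul_eq_mul]
    have h11 : (M t).det + -((M t).det / den t) * den t = 0 := by
      field_simp
      ring
    exact mul_eq_zero_of_right _ h11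

end SchubertTangent

end

/-! ### Inclusions between Schubert varieties and tangent cones -/

noncomputable section

namespace SchubertTangent

open Matrix Topology Filter MvPolynomial

/-- The minors that express the condition are homogeneous, hence equal to their own initial forms.
-/
theorem meets_of_mem_tangentCone {n r c : ℕ} (hrc : r + c ≤ n) {w : Equiv.Perm (Fin n)}
    (hw : PermMeets c (n - r) w) {v : Coord n → ℂ} (hv : v ∈ tangentCone w) :
    Meets c (n - r) (uGL v) := by
  by_contra h
  obtain ⟨f, hf⟩ := (not_meets_iff (by omega) (by omega)).mp h
  have := eval_eq_zero_of_mem_tangentCone (columnMinor_mem_localIdeal (by omega) (by omega) f hw)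
    (isHomogeneous_columnMinor (by omega) (by omega) hrc f) hv
  rw [eval_columnMinor] at this
  exact hf this

theorem exists_mem_not_meets {n c e : ℕ} {w w' : Equiv.Perm (Fin n)}
    (h : chartVariety w ⊆ tangentCone w') (hw : ¬ PermMeets c e w) :
    ∃ v ∈ tangentCone w', ¬ Meets c e (uGL v) := by
  obtain ⟨x, hx⟩ := exists_mem_cell_inter_chart w
  exact ⟨x, h (subset_closure hx), fun h => hw ((meets_of_mem_cell hx).mp h)⟩

/-- A nonzero maximal minor in the first `b - 1` columns misses some row `p`. Up to sign it is the
cofactor at row `p` and the last column, a place outside every smaller corner. -/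
theorem exists_adjugate_ne_zero {n b : ℕ} (hb : b ≤ n) (hb0 : 0 < b)
    {M : Matrix (Fin n) (Fin n) ℂ} {f : Fin (b - 1) → Fin b}
    (hf : ((corner hb ((Nat.sub_le b 1).trans hb) M).submatrix f id).det ≠ 0) :
    ∃ p, (corner hb hb M).adjugate ⟨b - 1, by omega⟩ p ≠ 0 := by
  obtain ⟨p, hp⟩ : ∃ p, ∀ i, f i ≠ p := by
    by_contra! h
    have := Fintype.card_le_of_surjective f h
    simp only [Fintype.card_fin] at this
    omega
  refine ⟨p, fun h0 => hf ?_⟩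
  rw [adjugate_apply, ← exists_mulVec_eq_zero_iff] at h0
  obtain ⟨z, hz, hz0⟩ := h0
  have hlast : z ⟨b - 1, by omega⟩ = 0 := by
    have := congrFun hz0 p
    rw [mulVec, updateRow_self, single_dotProduct, one_mul] at this
    exact this
  rw [← exists_mulVec_eq_zero_iff]
  have hcast : ∀ j : Fin b, (j : ℕ) ≠ b - 1 → ∃ j' : Fin (b - 1), Fin.castLE (Nat.sub_le b 1) j' = j :=
    fun j hj => ⟨⟨j, by omega⟩, rfl⟩
  refine ⟨fun j => z (Fin.castLE (Nat.sub_le b 1) j), fun h => hz (funext fun j => ?_),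
    funext fun i => ?_⟩
  · by_cases hj : (j : ℕ) = b - 1
    · have : j = ⟨b - 1, by omega⟩ := Fin.ext hj
      rw [this, hlast]
      rfl
    · obtain ⟨j', rfl⟩ := hcast j hj
      exact congrFun h j'
  · have h1 := congrFun hz0 (f i)
    rw [mulVec, updateRow_ne (hp i), dotProduct] at h1
    refine Eq.trans ?_ h1
    rw [mulVec, dotProduct]
    have hinj : Function.Injective (Fin.castLE (Nat.sub_le b 1)) := Fin.castLE_injective _
    rw [← Finset.sum_subset (Finset.subset_univ (Finset.univ.image (Fin.castLE (Nat.sub_le b 1)))),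
      Finset.sum_image fun a _ b _ h => hinj h]
    · rfl
    · intro j _ hj
      have : j = ⟨b - 1, by omega⟩ := by
        by_contra hne
        obtain ⟨j', hj'⟩ := hcast j fun h => hne (Fin.ext h)
        exact hj (Finset.mem_image.mpr ⟨j', Finset.mem_univ _, hj'⟩)
      rw [this, hlast, mul_zero]

/-- A Schubert variety that lies in two corner hypersurfaces lies in the tangent cone of the
mixed intersection, provided that the `b × (b - 1)` corner has full rank on it. -/
theorem chartVariety_subset_tangentCone_mixed {n a b : ℕ} (ha : 0 < a) (hab : a < b)
    (hb : 2 * b ≤ n) (hab' : a + 2 ≤ n - b) {w : Equiv.Perm (Fin n)}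
    (h1 : PermMeets a (n - a) w) (h2 : PermMeets b (n - b) w)
    (h3 : ¬ PermMeets (b - 1) (n - b) w) :
    chartVariety w ⊆ tangentCone (tau n a (n - b)) := by
  have hbn : b ≤ n := by omega
  intro x hx f hf d hd
  obtain ⟨z, hz⟩ := exists_mem_cell_inter_chart w
  obtain ⟨g, hg⟩ := (not_meets_iff hbn ((Nat.sub_le b 1).trans hbn)).mp
    (fun h => h3 ((meets_of_mem_cell hz).mp h))
  obtain ⟨p, hp⟩ := exists_adjugate_ne_zero hbn (by omega) hg
  let H := (corner hbn hbn (genericUnipotent n)).adjugate ⟨b - 1, by omega⟩ p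
  have hH : ∀ y, eval y H = (corner hbn hbn (unipotent y)).adjugate ⟨b - 1, by omega⟩ p := by
    intro y
    have h4 := RingHom.map_adjugate (eval y) (corner hbn hbn (genericUnipotent n))
    rw [← genericUnipotent_map]
    exact congrFun (congrFun h4 _) _
  have hHw : H ∉ localIdeal w := by
    intro h
    have := mem_localIdeal_iff_cell.mp h z hz
    rw [hH] at this
    exact hp this
  -- Where `H` is nonzero the point is a tangent direction, so the initial form vanishes there.
  -- Since `H` is not in the prime ideal, the initial form is.
  have hprod : homogeneousComponent d f * H ∈ localIdeal w := by
    rw [mem_localIdeal]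
    intro y hy
    rw [map_mul]
    by_cases h0 : eval y H = 0
    · rw [h0, mul_zero]
    · rw [hH] at h0
      have hy' := mem_tangentCone_mixed ha hab hb hab' (Or.inr (by simp only; omega))
        (meets_of_mem_chartVariety (by omega) (by omega) h1 hy)
        (meets_of_mem_chartVariety (by omega) (by omega) h2 hy) h0
      rw [hy' f hf d hd, zero_mul]
  exact mem_localIdeal.mp (((localIdeal_isPrime w).mem_or_mem hprod).resolve_right hHw) x hx

theorem chartVariety_tau_subset_tangentCone {n i k : ℕ} (hi : 0 < i) (hik : i + 2 ≤ k)
    (hk : 2 * k ≤ n) : chartVariety (tau n i k) ⊆ tangentCone (tau n i k) := by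
  refine chartVariety_subset_tangentCone fun x hx t => ?_
  rw [mem_chartVariety_tau hi (by omega) hik] at hx ⊢
  exact ⟨hx.1.smul (by omega) (by omega) (by omega) t, hx.2.smul (by omega) (by omega) (by omega) t⟩

theorem chartVariety_tau_succ_subset_tangentCone {n a : ℕ} (ha : 0 < a) (han : 2 * a + 1 ≤ n) :
    chartVariety (tau n (a + 1) a) ⊆ tangentCone (tau n (a + 1) a) := by
  refine chartVariety_subset_tangentCone fun x hx t => ?_
  rw [mem_chartVariety_tau_succ ha (by omega)] at hx ⊢
  exact hx.smul (by omega) (by omega) (by omega) t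

theorem comp_antiCoord_comp_antiCoord {n : ℕ} (v : Coord n → ℂ) :
    (v ∘ antiCoord) ∘ antiCoord = v := by
  ext s
  simp [antiCoord_antiCoord]

theorem chartVariety_tau_succ_subset_tangentCone' {n a : ℕ} (ha : 0 < a) (han : 2 * a + 1 ≤ n) :
    chartVariety (tau n a (a + 1)) ⊆ tangentCone (tau n a (a + 1)) := by
  intro v hv
  have h := comp_antiCoord_mem_tangentCone
    (chartVariety_tau_succ_subset_tangentCone ha han (comp_antiCoord_mem_chartVariety hv))
  rwa [comp_antiCoord_comp_antiCoord] at h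

/-- The mixed intersection has the same tangent cone as the unmixed one if the corners are of
nonadjacent sizes. -/
theorem tangentCone_mixed {n a b : ℕ} (ha : 0 < a) (hab : a + 2 ≤ b) (hb : 2 * b ≤ n) :
    tangentCone (tau n a (n - b)) = tangentCone (tau n a b) := by
  have hm : ∀ c, 0 < c → c < n → (PermMeets c (n - c) (tau n a b) ↔ c = a ∨ c = b) := fun c =>
    permMeets_tau ha (by omega) (by omega) (by omega) (by omega)
  have ha' := (hm a ha (by omega)).mpr (Or.inl rfl)
  have hb' := (hm b (by omega) (by omega)).mpr (Or.inr rfl)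
  have hmem : ∀ v, Meets a (n - a) (uGL v) → Meets b (n - b) (uGL v) → v ∈ chartVariety (tau n a b) :=
    fun v h1 h2 => (mem_chartVariety_tau ha (by omega) hab).mpr ⟨h1, h2⟩
  -- Nonadjacency enters here: the condition would force `D_(b-1)` to contain the variety, but `b -
  -- 1` is neither `a` nor `b`.
  have hnot : ¬ PermMeets (b - 1) (n - b) (tau n a b) := by
    rintro ⟨j, hj, hw⟩
    have := (hm (b - 1) (by omega) (by omega)).mp ⟨j, hj, by omega⟩
    omega
  refine Set.Subset.antisymm (fun v hv => ?_) (fun v hv => ?_)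
  · refine chartVariety_tau_subset_tangentCone ha hab hb (hmem v ?_ ?_)
    · exact meets_of_mem_tangentCone (by omega) ((permMeets_tau ha (by omega) (by omega) (by omega)
        (by omega) ha (by omega)).mpr (Or.inl rfl)) hv
    · rw [tangentCone_tau_inv ha (by omega) (by omega) (by omega)] at hv
      refine meets_of_mem_tangentCone (by omega) ((permMeets_tau (by omega) (by omega) (by omega)
        (by omega) (by omega) (by omega) (by omega)).mpr (Or.inl ?_)) hv
      omega
  · refine chartVariety_subset_tangentCone_mixed ha (by omega) hb (by omega) ha' hb' hnot
      (hmem v ?_ ?_)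
    · exact meets_of_mem_tangentCone (by omega) ha' hv
    · exact meets_of_mem_tangentCone (by omega) hb' hv

/-- For adjacent sizes, the `(a + 1) × a` corner has full rank generically on this rank locus, so
the mixed cone contains the locus. This inclusion distinguishes the mixed cone from the cone of the
transposed rank locus. -/
theorem chartVariety_subset_tangentCone_mixed_succ {n a : ℕ} (ha : 0 < a) (han : 2 * a + 3 ≤ n) :
    chartVariety (tau n a (a + 1)) ⊆ tangentCone (tau n a (n - (a + 1))) := by
  have hm : ∀ c, 0 < c → c < n → (PermMeets c (n - c) (tau n a (a + 1)) ↔ c = a ∨ c = a + 1) :=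
    fun c => permMeets_tau ha (by omega) (by omega) (by omega) (by omega)
  exact chartVariety_subset_tangentCone_mixed ha (by omega) (by omega) (by omega)
    ((hm a ha (by omega)).mpr (Or.inl rfl)) ((hm (a + 1) (by omega) (by omega)).mpr (Or.inr rfl))
    (not_permMeets_tau_succ ha (by omega))

/-- A tangent direction of the intersection of complementary corner hypersurfaces. -/
def reflectedPoint (n a : ℕ) : Coord n → ℂ := fun s =>
  if s.1.1 = (simple n a s.1.2).rev ∧ 2 * ((s.1.2 : ℕ) + 1) ≤ n then 1 else 0

theorem unipotent_smul_reflectedPoint_mulVec {n a : ℕ} (ha : 0 < a) (han : 2 * a + 2 ≤ n) (t : ℂ)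
    (v : Fin n → ℂ) (i : Fin n) : (unipotent (t • reflectedPoint n a) *ᵥ v) i =
      v i + if 2 * ((simple n a i.rev : ℕ) + 1) ≤ n then t * v (simple n a i.rev) else 0 := by
  rw [unipotent_smul, add_mulVec, one_mulVec, smul_mulVec, Pi.add_apply, Pi.smul_apply, mulVec,
    dotProduct]
  congr 1
  have hself : ∀ j, simple n a (simple n a j) = j := fun j => by
    rw [← Equiv.Perm.mul_apply, simple_mul_self, Equiv.Perm.one_apply]
  have hi : i = (simple n a (simple n a i.rev)).rev := by rw [hself, Fin.rev_rev]
  rw [Finset.sum_eq_single (simple n a i.rev)]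
  · rw [nilpotent, of_apply]
    split_ifs with h1 h2 h2
    · simp [reflectedPoint, h2, hself]
    · simp [reflectedPoint, h2]
    · exfalso
      have h3 := val_simple ha (by omega : a < n) (simple n a i.rev)
      have h4 := congrArg Fin.val hi
      rw [Fin.val_rev] at h4
      rw [Fin.lt_def] at h1
      split_ifs at h3 <;> omega
    · simp
  · intro j _ hj
    rw [nilpotent, of_apply]
    split_ifs with h1
    · rw [reflectedPoint, if_neg, zero_mul]
      rintro ⟨h2, -⟩
      apply hj
      have h3 : i = (simple n a j).rev := h2
      rw [h3, Fin.rev_rev, hself]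
    · rw [zero_mul]
  · simp

theorem smul_reflectedPoint_mem_chartVariety {n a : ℕ} (ha : 0 < a) (han : 2 * a + 2 ≤ n) (t : ℂ) :
    t • reflectedPoint n a ∈ chartVariety (tau n a (n - a)) := by
  have hs : ∀ j : Fin n, (simple n a j : ℕ) =
      if (j : ℕ) + 1 = a then a else if (j : ℕ) = a then a - 1 else j :=
    val_simple ha (by omega)
  rw [mem_chartVariety_tau ha (by omega) (by omega)]
  let A : Fin n := ⟨a - 1, by omega⟩
  let A' : Fin n := ⟨n - 1 - a, by omega⟩
  have hAA' : A ≠ A' := by simp only [A, A', ne_eq, Fin.mk.injEq]; omega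
  constructor
  · refine ⟨Pi.single A 1, by simp, fun k hk => ?_, fun k hk => ?_⟩
    · refine Pi.single_eq_of_ne (fun h => ?_) _
      have := congrArg Fin.val h
      simp only [A] at this
      omega
    · have h1 : k ≠ A := fun h => by
        have := congrArg Fin.val h
        simp only [A] at this
        omega
      have h2 : simple n a k.rev ≠ A := fun h => by
        have h3 := congrArg Fin.val h
        rw [hs, Fin.val_rev] at h3
        simp only [A] at h3
        split_ifs at h3 <;> omega
      rw [coe_uGL, unipotent_smul_reflectedPoint_mulVec ha han, Pi.single_eq_of_ne h1,
        Pi.single_eq_of_ne h2]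
      simp
  -- Column `A` has its off-diagonal entry `t` in row `A'`, and column `A'` is trivial below the
  -- diagonal. The matrix therefore sends this vector to the basis vector of `A`.
  · refine ⟨Pi.single A 1 - t • Pi.single A' 1, fun h => ?_, fun k hk => ?_, fun k hk => ?_⟩
    · have := congrFun h A
      simp [hAA'] at this
    · have h1 : k ≠ A := fun h => by
        have := congrArg Fin.val h
        simp only [A] at this
        omega
      have h2 : k ≠ A' := fun h => by
        have := congrArg Fin.val h
        simp only [A'] at this
        omega
      simp [h1, h2]
    · have h1 : k ≠ A := fun h => by
        have := congrArg Fin.val h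
        simp only [A] at this
        omega
      rw [coe_uGL, unipotent_smul_reflectedPoint_mulVec ha han]
      by_cases h2 : k = A'
      · have h3 : simple n a k.rev = A := by
          refine Fin.ext ?_
          rw [hs, Fin.val_rev, h2]
          simp only [A, A']
          split_ifs <;> omega
        rw [h3, if_pos (by simp only [A]; omega), h2]
        simp [hAA', hAA'.symm]
      · have h3 : simple n a k.rev ≠ A := fun h => by
          have h3 := congrArg Fin.val h
          rw [hs, Fin.val_rev] at h3
          have h4 : (k : ℕ) ≠ n - 1 - a := fun h => h2 (Fin.ext h)
          simp only [A] at h3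
          split_ifs at h3 <;> omega
        split_ifs with h4
        · have h5 : simple n a k.rev ≠ A' := fun h => by
            rw [h] at h4
            simp only [A'] at h4
            omega
          simp [h1, h2, h3, h5]
        · simp [h1, h2]

theorem reflectedPoint_mem_tangentCone {n a : ℕ} (ha : 0 < a) (han : 2 * a + 2 ≤ n) :
    reflectedPoint n a ∈ tangentCone (tau n a (n - a)) :=
  mem_tangentCone_of_tendsto tendsto_id_punctured self_mem_nhdsWithin tendsto_const_nhds
    (Eventually.of_forall fun t => smul_reflectedPoint_mem_chartVariety ha han t)

/-- For `c ≠ a` the transposition `s_a` preserves the first `c` positions, so the `c × c` corner is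
a permutation matrix. -/
theorem not_meets_reflectedPoint {n a c : ℕ} (ha : 0 < a) (han : 2 * a + 2 ≤ n)
    (hcn : 2 * c ≤ n) (hca : c ≠ a) : ¬ Meets c (n - c) (uGL (reflectedPoint n a)) := by
  have hs : ∀ j : Fin n, (simple n a j : ℕ) =
      if (j : ℕ) + 1 = a then a else if (j : ℕ) = a then a - 1 else j :=
    val_simple ha (by omega)
  rintro ⟨v, hv, hc, he⟩
  refine hv (funext fun j => ?_)
  rcases lt_or_ge (j : ℕ) c with hj | hj
  · have h1 : (simple n a j : ℕ) < c := by
      rw [hs]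
      split_ifs <;> omega
    have h2 := he (simple n a j).rev (by rw [Fin.val_rev]; omega)
    have h3 := unipotent_smul_reflectedPoint_mulVec ha han 1 v (simple n a j).rev
    rw [one_smul] at h3
    have h4 : simple n a (simple n a j) = j := by
      rw [← Equiv.Perm.mul_apply, simple_mul_self, Equiv.Perm.one_apply]
    rw [coe_uGL, h3, Fin.rev_rev, h4, if_pos (by omega), one_mul,
      hc (simple n a j).rev (by rw [Fin.val_rev]; omega), zero_add] at h2
    exact h2
  · exact hc j hj

end SchubertTangent

end

/-! ### Classification of the cones and counting -/

noncomputable section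

namespace SchubertTangent

open Matrix Topology Filter MvPolynomial

/-- Pairs of positions that represent each tangent cone in codimension `2` once. -/
def Canonical (n i k : ℕ) : Prop :=
  0 < i ∧ 0 < k ∧ (i + 2 ≤ k ∧ 2 * k ≤ n ∨ i + 2 ≤ k ∧ i + k + 1 = n ∨ i + 2 ≤ k ∧ i + k = n ∨
    i = k + 1 ∧ 2 * k + 1 ≤ n ∨ k = i + 1 ∧ 2 * i + 1 ≤ n)

instance (n i k : ℕ) : Decidable (Canonical n i k) := by
  unfold Canonical
  infer_instance

theorem Canonical.bounds {n i k : ℕ} (h : Canonical n i k) :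
    0 < i ∧ i < n ∧ 0 < k ∧ k < n ∧ i ≠ k := by
  unfold Canonical at h
  omega

theorem meets_of_mem_tangentCone_tau {n i k c : ℕ} (hi : 0 < i) (hi' : i < n) (hk : 0 < k)
    (hk' : k < n) (hik : i ≠ k) (hc : c = i ∨ c = k) {v : Coord n → ℂ} (hcn : 2 * c ≤ n)
    (hv : v ∈ tangentCone (tau n i k)) : Meets c (n - c) (uGL v) :=
  meets_of_mem_tangentCone (by omega)
    ((permMeets_tau hi hi' hk hk' hik (by omega) (by omega)).mpr hc) hv

/-- The middle corner hypersurfaces that contain a canonical tangent cone. -/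
theorem Canonical.forall_meets_iff {n i k c : ℕ} (h : Canonical n i k) (hc : 0 < c)
    (hcn : 2 * c ≤ n) :
    (∀ v ∈ tangentCone (tau n i k), Meets c (n - c) (uGL v)) ↔
      c = i ∨ c = k ∨ n - c = i ∨ n - c = k := by
  obtain ⟨hi, hi', hk, hk', hik⟩ := h.bounds
  constructor
  · intro hall
    by_contra hne
    -- A Schubert variety inside the cone supplies a point of its open cell, where only the
    -- incidence conditions of its own permutation hold.
    have hperm : ∀ {i' k' : ℕ}, 0 < i' → i' < n → 0 < k' → k' < n → i' ≠ k' →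
        chartVariety (tau n i' k') ⊆ tangentCone (tau n i k) → c = i' ∨ c = k' := by
      intro i' k' h1 h2 h3 h4 h5 hsub
      by_contra hne'
      obtain ⟨v, hv, hv'⟩ := exists_mem_not_meets hsub
        (mt (permMeets_tau h1 h2 h3 h4 h5 hc (by omega)).mp hne')
      exact hv' (hall v hv)
    obtain ⟨-, -, ⟨h1, h2⟩ | ⟨h1, h2⟩ | ⟨h1, h2⟩ | ⟨rfl, h2⟩ | ⟨rfl, h2⟩⟩ := h
    · have := hperm hi hi' hk hk' hik (chartVariety_tau_subset_tangentCone hi h1 h2)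
      omega
    · obtain rfl : k = n - (i + 1) := by omega
      have := hperm hi hi' (by omega) (by omega) (by omega)
        (chartVariety_subset_tangentCone_mixed_succ hi (by omega))
      omega
    -- Only one folded size occurs here, and the explicit tangent direction avoids every other
    -- corner hypersurface.
    · obtain rfl : k = n - i := by omega
      exact not_meets_reflectedPoint hi (by omega) hcn (by omega)
        (hall _ (reflectedPoint_mem_tangentCone hi (by omega)))
    · have := hperm hi hi' hk hk' hik (chartVariety_tau_succ_subset_tangentCone hk h2)
      omega
    · have := hperm hi hi' hk hk' hik (chartVariety_tau_succ_subset_tangentCone' hi h2)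
      omega
  · intro hor v hv
    by_cases h1 : c = i ∨ c = k
    · exact meets_of_mem_tangentCone_tau hi hi' hk hk' hik h1 hcn hv
    · rw [tangentCone_tau_inv hi hi' hk hk'] at hv
      exact meets_of_mem_tangentCone_tau (by omega) (by omega) (by omega) (by omega) (by omega)
        (by omega) hcn hv

theorem not_chartVariety_tau_succ_subset {n a : ℕ} (ha : 0 < a) (han : 2 * a + 1 ≤ n) :
    ¬ chartVariety (tau n a (a + 1)) ⊆ tangentCone (tau n (a + 1) a) := by
  intro h
  obtain ⟨v, hv, hv'⟩ := exists_mem_not_meets h (not_permMeets_tau_succ ha (by omega))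
  exact hv' (meets_of_mem_tangentCone (by omega) (permMeets_tau_succ ha (by omega)) hv)

theorem tangentCone_tau_succ_ne {n a : ℕ} (ha : 0 < a) (han : 2 * a + 1 ≤ n) :
    tangentCone (tau n (a + 1) a) ≠ tangentCone (tau n a (a + 1)) := fun h =>
  not_chartVariety_tau_succ_subset ha (by omega)
    ((chartVariety_tau_succ_subset_tangentCone' ha han).trans h.superset)

theorem tangentCone_mixed_succ_ne {n a : ℕ} (ha : 0 < a) (han : 2 * a + 3 ≤ n) :
    tangentCone (tau n a (n - (a + 1))) ≠ tangentCone (tau n (a + 1) a) := fun h =>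
  not_chartVariety_tau_succ_subset ha (by omega)
    ((chartVariety_subset_tangentCone_mixed_succ ha han).trans h.subset)

/-- The two simple transpositions of the mixed permutation commute, so its cone is invariant under
reflection in the antidiagonal, whereas the two rank loci are exchanged. The claim thus reduces to
`tangentCone_mixed_succ_ne`. -/
theorem tangentCone_mixed_succ_ne' {n a : ℕ} (ha : 0 < a) (han : 2 * a + 3 ≤ n) :
    tangentCone (tau n a (n - (a + 1))) ≠ tangentCone (tau n a (a + 1)) := by
  intro h
  have h1 := tangentCone_tau_subset_iff.mp h.subset
  have h2 := tangentCone_tau_subset_iff.mp h.superset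
  have hcomm : tau n a (n - (a + 1)) = tau n (n - (a + 1)) a :=
    tau_comm ha (by omega) (by omega) (by omega) (by omega)
  rw [← hcomm] at h1 h2
  exact tangentCone_mixed_succ_ne ha han (h1.antisymm h2)

/-- The positions of a canonical pair, folded into the lower half. -/
theorem Canonical.exists_fold {n i k : ℕ} (h : Canonical n i k) :
    ∃ p q, 0 < p ∧ p ≤ q ∧ 2 * q ≤ n ∧
      (∀ c, 2 * c ≤ n → ((c = i ∨ c = k ∨ n - c = i ∨ n - c = k) ↔ c = p ∨ c = q)) ∧
      (i = p ∧ k = q ∧ p + 2 ≤ q ∨ i = p ∧ k = n - (p + 1) ∧ q = p + 1 ∧ 2 * p + 3 ≤ n ∨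
        i = p ∧ k = n - p ∧ q = p ∧ 2 * p + 2 ≤ n ∨
        (i = p + 1 ∧ k = p ∨ i = p ∧ k = p + 1) ∧ 2 * p + 1 ≤ n ∧ (q = p → 2 * p + 1 = n) ∧
          q ≤ p + 1) := by
  obtain ⟨hi, hk, ⟨h1, h2⟩ | ⟨h1, h2⟩ | ⟨h1, h2⟩ | ⟨h1, h2⟩ | ⟨h1, h2⟩⟩ := h
  · exact ⟨i, k, by omega, by omega, by omega, fun c hc => by omega, by omega⟩
  · exact ⟨i, i + 1, by omega, by omega, by omega, fun c hc => by omega, by omega⟩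
  · exact ⟨i, i, by omega, by omega, by omega, fun c hc => by omega, by omega⟩
  -- If `2 * k + 1 = n`, the position `k + 1` folds back to `k`, and the two folded positions
  -- coincide.
  · rcases h2.eq_or_lt with h3 | h3
    · exact ⟨k, k, by omega, by omega, by omega, fun c hc => by omega, by omega⟩
    · exact ⟨k, k + 1, by omega, by omega, by omega, fun c hc => by omega, by omega⟩
  · rcases h2.eq_or_lt with h3 | h3
    · exact ⟨i, i, by omega, by omega, by omega, fun c hc => by omega, by omega⟩
    · exact ⟨i, i + 1, by omega, by omega, by omega, fun c hc => by omega, by omega⟩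

/-- The corner hypersurfaces that contain the cone determine the folded positions `p ≤ q`. The pairs
that still share them are the two orders of `p` and `p + 1` and the mixed pair with `q = p + 1`; the
three inequalities of cones, each used in both directions, separate these. -/
theorem Canonical.injective {n i k i' k' : ℕ} (h : Canonical n i k)
    (h' : Canonical n i' k') (heq : tangentCone (tau n i k) = tangentCone (tau n i' k')) :
    i = i' ∧ k = k' := by
  obtain ⟨p, q, hp, hpq, hq, hc, hcase⟩ := h.exists_fold
  obtain ⟨p', q', hp', hpq', hq', hc', hcase'⟩ := h'.exists_fold
  have key : ∀ c, 0 < c → 2 * c ≤ n → ((c = p ∨ c = q) ↔ (c = p' ∨ c = q')) := fun c h1 h2 => by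
    rw [← hc c h2, ← hc' c h2, ← h.forall_meets_iff h1 h2, ← h'.forall_meets_iff h1 h2, heq]
  have k1 := (key p hp (by omega)).mp (Or.inl rfl)
  have k2 := (key q (by omega) hq).mp (Or.inr rfl)
  have k3 := (key p' hp' (by omega)).mpr (Or.inl rfl)
  have k4 := (key q' (by omega) hq').mpr (Or.inr rfl)
  obtain rfl : p = p' := by omega
  obtain rfl : q = q' := by omega
  clear key k1 k2 k3 k4 hc hc'
  have n1 : i = p → k = n - (p + 1) → i' = p + 1 → k' = p → 2 * p + 3 ≤ n → False :=
    fun h1 h2 h3 h4 h5 => tangentCone_mixed_succ_ne hp h5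
      (by rw [h1, h2, h3, h4] at heq; exact heq)
  have n2 : i = p → k = n - (p + 1) → i' = p → k' = p + 1 → 2 * p + 3 ≤ n → False :=
    fun h1 h2 h3 h4 h5 => tangentCone_mixed_succ_ne' hp h5
      (by rw [h1, h2, h3, h4] at heq; exact heq)
  have n3 : i = p + 1 → k = p → i' = p → k' = p + 1 → 2 * p + 1 ≤ n → False :=
    fun h1 h2 h3 h4 h5 => tangentCone_tau_succ_ne hp h5
      (by rw [h1, h2, h3, h4] at heq; exact heq)
  have n4 : i' = p → k' = n - (p + 1) → i = p + 1 → k = p → 2 * p + 3 ≤ n → False :=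
    fun h1 h2 h3 h4 h5 => tangentCone_mixed_succ_ne hp h5
      (by rw [h1, h2, h3, h4] at heq; exact heq.symm)
  have n5 : i' = p → k' = n - (p + 1) → i = p → k = p + 1 → 2 * p + 3 ≤ n → False :=
    fun h1 h2 h3 h4 h5 => tangentCone_mixed_succ_ne' hp h5
      (by rw [h1, h2, h3, h4] at heq; exact heq.symm)
  have n6 : i' = p + 1 → k' = p → i = p → k = p + 1 → 2 * p + 1 ≤ n → False :=
    fun h1 h2 h3 h4 h5 => tangentCone_tau_succ_ne hp h5
      (by rw [h1, h2, h3, h4] at heq; exact heq.symm)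
  clear heq h h'
  rcases hcase with ⟨h1, h2, h3⟩ | ⟨h1, h2, h3, h4⟩ | ⟨h1, h2, h3, h4⟩ |
      ⟨⟨h1, h2⟩ | ⟨h1, h2⟩, h3, h4, h5⟩ <;>
    rcases hcase' with ⟨g1, g2, g3⟩ | ⟨g1, g2, g3, g4⟩ | ⟨g1, g2, g3, g4⟩ |
      ⟨⟨g1, g2⟩ | ⟨g1, g2⟩, g3, g4, g5⟩ <;>
    first
    | (clear n1 n2 n3 n4 n5 n6; omega)
    | exact (n1 h1 h2 g1 g2 h4).elim
    | exact (n2 h1 h2 g1 g2 h4).elim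
    | exact (n3 h1 h2 g1 g2 h3).elim
    | exact (n4 g1 g2 h1 h2 g4).elim
    | exact (n5 g1 g2 h1 h2 g4).elim
    | exact (n6 g1 g2 h1 h2 g3).elim

/-- Inversion moves a pair with both positions in the upper half to the lower half, and a mixed pair
to one with `i + k ≤ n`. Mixed pairs that fold to nonadjacent sizes are then replaced by the unmixed
pair. -/
theorem exists_canonical {n i k : ℕ} (hi : 0 < i) (hi' : i < n) (hk : 0 < k) (hk' : k < n)
    (hik : i ≠ k) :
    ∃ i' k', Canonical n i' k' ∧ tangentCone (tau n i k) = tangentCone (tau n i' k') := by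
  have commuting : ∀ {i k}, 0 < i → k < n → i + 2 ≤ k →
      ∃ i' k', Canonical n i' k' ∧ tangentCone (tau n i k) = tangentCone (tau n i' k') := by
    intro i k hi hk hik
    rcases le_or_gt (2 * k) n with h | h
    · exact ⟨i, k, by unfold Canonical; omega, rfl⟩
    rcases le_or_gt n (2 * i) with h' | h'
    · exact ⟨n - k, n - i, by unfold Canonical; omega,
        tangentCone_tau_inv hi (by omega) (by omega) hk⟩
    rcases le_or_gt (i + k) n with h3 | h3
    · by_cases h4 : i + k + 1 = n ∨ i + k = n
      · exact ⟨i, k, by unfold Canonical; omega, rfl⟩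
      · refine ⟨i, n - k, by unfold Canonical; omega, ?_⟩
        have h5 := tangentCone_mixed (b := n - k) hi (by omega) (by omega : 2 * (n - k) ≤ n)
        rwa [Nat.sub_sub_self hk.le] at h5
    · rw [tangentCone_tau_inv hi (by omega) (by omega) hk]
      by_cases h4 : i + k = n + 1
      · exact ⟨n - k, n - i, by unfold Canonical; omega, rfl⟩
      · exact ⟨n - k, i, by unfold Canonical; omega,
          tangentCone_mixed (by omega) (by omega) (by omega)⟩
  rcases le_or_gt (i + 2) k with h | h
  · exact commuting hi hk' h
  rcases le_or_gt (k + 2) i with h' | h'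
  · rw [← tau_comm hk hk' hi hi' h']
    exact commuting hk hi' h'
  by_cases h3 : i + k ≤ n
  · exact ⟨i, k, by unfold Canonical; omega, rfl⟩
  · exact ⟨n - k, n - i, by unfold Canonical; omega, tangentCone_tau_inv hi hi' hk hk'⟩

/-- The canonical pairs as a finite set. -/
def canonicalPairs (n : ℕ) : Finset (ℕ × ℕ) :=
  (Finset.range n ×ˢ Finset.range n).filter fun p => Canonical n p.1 p.2

theorem mem_canonicalPairs {n : ℕ} {p : ℕ × ℕ} :
    p ∈ canonicalPairs n ↔ Canonical n p.1 p.2 := by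
  rw [canonicalPairs, Finset.mem_filter, Finset.mem_product, Finset.mem_range, Finset.mem_range]
  exact ⟨fun h => h.2, fun h => ⟨⟨h.bounds.2.1, h.bounds.2.2.2.1⟩, h⟩⟩

theorem ncard_tangentCone (n : ℕ) :
    Set.ncard {T : Set (Coord n → ℂ) | ∃ w : Equiv.Perm (Fin n), codim w = 2 ∧ T = tangentCone w} =
      (canonicalPairs n).card := by
  have himage : {T : Set (Coord n → ℂ) |
      ∃ w : Equiv.Perm (Fin n), codim w = 2 ∧ T = tangentCone w} =
      (fun p : ℕ × ℕ => tangentCone (tau n p.1 p.2)) '' (canonicalPairs n : Set (ℕ × ℕ)) := by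
    ext T
    constructor
    · rintro ⟨w, hw, rfl⟩
      obtain ⟨i, k, hi, hi', hk, hk', hik, rfl⟩ := codim_eq_two_iff.mp hw
      obtain ⟨i', k', hc, he⟩ := exists_canonical hi hi' hk hk' hik
      exact ⟨(i', k'), mem_canonicalPairs.mpr hc, he.symm⟩
    · rintro ⟨⟨i, k⟩, hp, rfl⟩
      obtain ⟨hi, hi', hk, hk', hik⟩ := (mem_canonicalPairs.mp hp).bounds
      exact ⟨_, codim_eq_two_iff.mpr ⟨i, k, hi, hi', hk, hk', hik, rfl⟩, rfl⟩
  rw [himage, Set.InjOn.ncard_image, Set.ncard_coe_finset]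
  rintro ⟨i, k⟩ hp ⟨i', k'⟩ hp' heq
  obtain ⟨rfl, rfl⟩ := (mem_canonicalPairs.mp hp).injective (mem_canonicalPairs.mp hp') heq
  rfl

/-- The pairs `0 < i < k ≤ m` at distance at least two. -/
def distantPairs (m : ℕ) : Finset (ℕ × ℕ) :=
  (Finset.range m).biUnion fun j => (Finset.range (j - 1)).image fun i => (i + 1, j + 1)

theorem mem_distantPairs {m : ℕ} {p : ℕ × ℕ} :
    p ∈ distantPairs m ↔ 0 < p.1 ∧ p.1 + 2 ≤ p.2 ∧ p.2 ≤ m := by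
  obtain ⟨i, k⟩ := p
  simp only [distantPairs, Finset.mem_biUnion, Finset.mem_image, Finset.mem_range, Prod.mk.injEq]
  constructor
  · rintro ⟨j, hj, i', hi', rfl, rfl⟩
    omega
  · rintro ⟨h1, h2, h3⟩
    exact ⟨k - 1, by omega, i - 1, by omega, by omega, by omega⟩

theorem card_distantPairs (m : ℕ) : (distantPairs (m + 1)).card * 2 = m * (m - 1) := by
  have hcard : ∀ j, ((Finset.range (j - 1)).image fun i => (i + 1, j + 1)).card = j - 1 := fun j => by
    rw [Finset.card_image_of_injective _ fun a b h => by simpa using h, Finset.card_range]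
  rw [distantPairs, Finset.card_biUnion, Finset.sum_congr rfl fun j _ => hcard j,
    Finset.sum_range_succ', Nat.zero_sub, add_zero]
  · exact Finset.sum_range_id_mul_two m
  · intro x _ y _ hxy
    rw [Function.onFun, Finset.disjoint_left]
    rintro p hp hp'
    obtain ⟨a, -, rfl⟩ := Finset.mem_image.mp hp
    obtain ⟨b, -, hb⟩ := Finset.mem_image.mp hp'
    simp only [Prod.mk.injEq] at hb
    omega

/-- The summands count, in order, the unmixed pairs, the mixed pairs with adjacent folded sizes,
those with equal folded sizes, and the two orders of adjacent positions. -/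
theorem card_canonicalPairs (n : ℕ) : (canonicalPairs n).card = (distantPairs (n / 2)).card +
    ((n - 3) / 2 + ((n - 2) / 2 + ((n - 1) / 2 + (n - 1) / 2))) := by
  have hunion : canonicalPairs n = distantPairs (n / 2) ∪
      ((Finset.range ((n - 3) / 2)).image (fun i => (i + 1, n - (i + 2))) ∪
      ((Finset.range ((n - 2) / 2)).image (fun i => (i + 1, n - (i + 1))) ∪
      ((Finset.range ((n - 1) / 2)).image (fun i => (i + 2, i + 1)) ∪
      (Finset.range ((n - 1) / 2)).image (fun i => (i + 1, i + 2))))) := by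
    ext ⟨i, k⟩
    simp only [mem_canonicalPairs, Finset.mem_union, mem_distantPairs, Finset.mem_image,
      Finset.mem_range, Prod.mk.injEq]
    constructor
    · rintro ⟨hi, hk, h | h | h | h | h⟩
      · exact Or.inl (by omega)
      · exact Or.inr (Or.inl ⟨i - 1, by omega, by omega, by omega⟩)
      · exact Or.inr (Or.inr (Or.inl ⟨i - 1, by omega, by omega, by omega⟩))
      · exact Or.inr (Or.inr (Or.inr (Or.inl ⟨k - 1, by omega, by omega, by omega⟩)))
      · exact Or.inr (Or.inr (Or.inr (Or.inr ⟨i - 1, by omega, by omega, by omega⟩)))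
    · unfold Canonical
      rintro (h | ⟨j, h⟩ | ⟨j, h⟩ | ⟨j, h⟩ | ⟨j, h⟩) <;> omega
  have hcard : ∀ (m : ℕ) (f : ℕ → ℕ × ℕ), (∀ i j, f i = f j → i = j) →
      ((Finset.range m).image f).card = m := fun m f hf => by
    rw [Finset.card_image_of_injective _ hf, Finset.card_range]
  rw [hunion, Finset.card_union_of_disjoint, Finset.card_union_of_disjoint,
    Finset.card_union_of_disjoint, Finset.card_union_of_disjoint, hcard, hcard, hcard, hcard]
  case _ | _ | _ | _ =>
    intro i j h
    have := congrArg Prod.fst h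
    simp only at this
    omega
  all_goals
    rw [Finset.disjoint_left]
    rintro ⟨i, k⟩
    simp only [Finset.mem_union, mem_distantPairs, Finset.mem_image,
      Finset.mem_range, Prod.mk.injEq]
  · rintro ⟨a, ha⟩ ⟨b, hb⟩
    omega
  · rintro ⟨a, ha⟩ (⟨b, hb⟩ | ⟨b, hb⟩) <;> omega
  · rintro ⟨a, ha⟩ (⟨b, hb⟩ | ⟨b, hb⟩ | ⟨b, hb⟩) <;> omega
  · rintro ha (⟨b, hb⟩ | ⟨b, hb⟩ | ⟨b, hb⟩ | ⟨b, hb⟩) <;> omega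

end SchubertTangent

end

theorem proposition6p1 (n : ℕ) (hn : 3 ≤ n) :
    (Odd n →
      ((Set.ncard {T : Set (SchubertTangent.Coord n → ℂ) |
          ∃ w : Equiv.Perm (Fin n), SchubertTangent.codim w = 2 ∧
            T = SchubertTangent.tangentCone w} : ℕ) : ℚ)
        = 2 + ((n : ℚ) - 3) * ((n : ℚ) + 11) / 8) ∧
    (Even n →
      ((Set.ncard {T : Set (SchubertTangent.Coord n → ℂ) |
          ∃ w : Equiv.Perm (Fin n), SchubertTangent.codim w = 2 ∧
            T = SchubertTangent.tangentCone w} : ℕ) : ℚ)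
        = 3 + ((n : ℚ) - 4) * ((n : ℚ) + 14) / 8) := by
  rw [SchubertTangent.ncard_tangentCone, SchubertTangent.card_canonicalPairs]
  constructor
  · rintro ⟨m, rfl⟩
    obtain ⟨m, rfl⟩ : ∃ j, m = j + 1 := ⟨m - 1, by omega⟩
    have h := SchubertTangent.card_distantPairs m
    rw [show (2 * (m + 1) + 1) / 2 = m + 1 by omega, show (2 * (m + 1) + 1 - 3) / 2 = m by omega,
      show (2 * (m + 1) + 1 - 2) / 2 = m by omega, show (2 * (m + 1) + 1 - 1) / 2 = m + 1 by omega]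
    have h' : ((SchubertTangent.distantPairs (m + 1)).card : ℚ) * 2 = m * (m - 1) := by
      -- The case `m = 0` is split off because `m - 1` is truncated in the natural numbers.
      rcases m with _ | m
      · simpa using h
      · rw [Nat.add_sub_cancel] at h
        push_cast
        rw [add_sub_cancel_right]
        exact_mod_cast h
    push_cast
    linear_combination h' / 2
  · rintro ⟨m, rfl⟩
    obtain ⟨m, rfl⟩ : ∃ j, m = j + 2 := ⟨m - 2, by omega⟩
    have h := SchubertTangent.card_distantPairs (m + 1)
    rw [show (m + 2 + (m + 2)) / 2 = m + 1 + 1 by omega,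
      show (m + 2 + (m + 2) - 3) / 2 = m by omega,
      show (m + 2 + (m + 2) - 2) / 2 = m + 1 by omega,
      show (m + 2 + (m + 2) - 1) / 2 = m + 1 by omega]
    have h' : ((SchubertTangent.distantPairs (m + 1 + 1)).card : ℚ) * 2 = (m + 1) * m := by
      exact_mod_cast h
    push_cast
    linear_combination h' / 2
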